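/- Let $\pi\colon E\to\mathbb R$ be a smooth bundle (a smooth surjective submersion suffices) with $\dim E=n+1$, let $\eta=dt$ be the canonical volume form of $\mathbb R$, let $k\ge 1$, and let $J^r\pi$ denote the manifold of $r$-jets of local sections of $\pi$, with coordinates $(t,q_0^A,\dots,q_r^A)$ induced by adapted coordinates $(t,q^A)$ of $E$, and with projection $\bar\pi^r\colon J^r\pi\to\mathbb R$. Let $\mathcal L=L\,(\bar\pi^k)^*\eta$ be a Lagrangian density on $J^k\pi$, with $L\in C^\infty(J^k\pi)$. Let $d_T$ be the total time derivative and put $$\hat p_A^{\,s}=\sum_{i=0}^{k-1-s}(-1)^i d_T^i\Big(\frac{\partial L}{\partial q^A_{s+1+i}}\Big),\qquad 0\le s\le k-1 .$$ The extended Legendre-Ostrogradsky map $\widetilde{\mathcal{FL}}\colon J^{2k-1}\pi\to T^*(J^{k-1}\pi)$ is the map over the projection $J^{2k-1}\pi\to J^{k-1}\pi$ given locally by the covector $\sum_{s=0}^{k-1}\hat p_A^{\,s}\,dq_s^A+\big(L-\sum_{s=0}^{k-1}\hat p_A^{\,s}q_{s+1}^A\big)dt$; the restricted map $\mathcal{FL}\colon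 J^{2k-1}\pi\to J^{k-1}\pi^*=T^*(J^{k-1}\pi)/(\bar\pi^{k-1})^*T^*\mathbb R$ is its composition with the quotient map. Let $\Theta_{\mathcal L}=\widetilde{\mathcal{FL}}^*\Theta_{k-1}$ be the pull-back of the tautological $1$-form of $T^*(J^{k-1}\pi)$, and $\Omega_{\mathcal L}=-d\Theta_{\mathcal L}$ (the Poincaré-Cartan forms on $J^{2k-1}\pi$). Consider the statements: 1. $\Omega_{\mathcal L}$ has maximal rank on $J^{2k-1}\pi$, that is, rank $2kn$ at every point (note that $\dim J^{2k-1}\pi=2kn+1$); 2. $(\Omega_{\mathcal L},(\bar\pi^{2k-1})^*\eta)$ is a cosymplectic structure on $J^{2k-1}\pi$, that is, both forms are closed and $\Omega_{\mathcal L}^{kn}\wedge(\bar\pi^{2k-1})^*\eta$ is a volume form; 3. $\mathcal{FL}\colon J^{2k-1}\pi\to J^{k-1}\pi^*$ is a local diffeomorphism; 4. $\widetilde{\mathcal{FL}}\colon J^{2k-1}\pi\to T^*(J^{k-1}\pi)$ is an immersion. If $k\ge 2$, then (1), (2), (3) and (4) are equivalent. For every $k\ge 1$ (thus also in the first-order case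 $k=1$), (2), (3) and (4) are equivalent, and they imply (1). -/

import Mathlib

open Set Filter
open scoped Manifold ContDiff Topology

noncomputable section

/-- The typical fibre `ℝⁿ` in which the coordinates `q = (q^A)` take values. -/
abbrev Fib (n : ℕ) : Type := EuclideanSpace ℝ (Fin n)

/-- A bundle `π : E → ℝ` over the time line whose total space is a smooth manifold of dimension
`n + 1`: a smooth surjective submersion. -/
class IsBundleOverLine (n : ℕ) {E : Type*} [TopologicalSpace E]
    [ChartedSpace (EuclideanSpace ℝ (Fin (n + 1))) E] [IsManifold (𝓡 (n + 1)) ∞ E]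
    (π : E → ℝ) : Prop where
  isSubmersion : Manifold.IsSubmersion (𝓡 (n + 1)) 𝓘(ℝ, ℝ) ∞ π
  surjective : Function.Surjective π

/-- A local chart `(t, q^A)` of `E` adapted to `π`. -/
structure AdaptedChart (n : ℕ) {E : Type*} [TopologicalSpace E]
    [ChartedSpace (EuclideanSpace ℝ (Fin (n + 1))) E] (π : E → ℝ) where
  chart : OpenPartialHomeomorph E (ℝ × Fib n)
  smooth : ContMDiffOn (𝓡 (n + 1)) 𝓘(ℝ, ℝ × Fib n) ∞ chart chart.source
  smooth_symm : ContMDiffOn 𝓘(ℝ, ℝ × Fib n) (𝓡 (n + 1)) ∞ chart.symm chart.target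
  fst_eq : ∀ x ∈ chart.source, (chart x).1 = π x

/-- A smooth local section of `π`, defined near `t`. -/
structure LocalSection (n : ℕ) {E : Type*} [TopologicalSpace E]
    [ChartedSpace (EuclideanSpace ℝ (Fin (n + 1))) E] (π : E → ℝ) (t : ℝ) where
  toFun : ℝ → E
  smooth : ∀ᶠ s in 𝓝 t, ContMDiffAt 𝓘(ℝ, ℝ) (𝓡 (n + 1)) ∞ toFun s
  isSection : ∀ᶠ s in 𝓝 t, π (toFun s) = s

lemma exists_adaptedChart {n : ℕ} {E : Type*} [TopologicalSpace E]
    [ChartedSpace (EuclideanSpace ℝ (Fin (n + 1))) E] [IsManifold (𝓡 (n + 1)) ∞ E]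
    (π : E → ℝ) [hπ : IsBundleOverLine n π] (x : E) :
    ∃ e : AdaptedChart n π, x ∈ e.chart.source := by
  obtain ⟨F, _, _, hF⟩ := hπ.isSubmersion
  have h := hF x
  let B := h.equiv
  have hfin : FiniteDimensional ℝ F := Module.Finite.of_surjective
    ((LinearMap.snd ℝ ℝ F).comp B.toLinearEquiv.toLinearMap)
    (Prod.snd_surjective.comp B.surjective)
  have hrank : Module.finrank ℝ F = Module.finrank ℝ (Fib n) := by
    have := B.toLinearEquiv.finrank_eq
    simp only [finrank_euclideanSpace, Fintype.card_fin, Module.finrank_prod,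
      Module.finrank_self] at this ⊢
    omega
  let A : F ≃L[ℝ] Fib n := ContinuousLinearEquiv.ofFinrankEq hrank
  let C : EuclideanSpace ℝ (Fin (n + 1)) ≃L[ℝ] ℝ × Fib n :=
    B.trans ((ContinuousLinearEquiv.refl ℝ ℝ).prodCongr A)
  let φ := h.domChart
  let ψ := h.codChart
  have hsrc : φ.source ⊆ π ⁻¹' ψ.source := h.source_subset_preimage_source
  have hwr : ∀ y ∈ φ.source, (C (φ y)).1 = ψ (π y) := by
    intro y hy
    have hy2 : φ y ∈ (φ.extend (𝓡 (n + 1))).target := by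
      rw [OpenPartialHomeomorph.extend_target]
      exact ⟨φ.map_source hy, mem_range_self (f := 𝓡 (n + 1)) _⟩
    have := h.writtenInCharts hy2
    simp only [Function.comp, OpenPartialHomeomorph.extend_coe_symm,
      OpenPartialHomeomorph.extend_coe] at this
    have h2 : φ.symm (φ y) = y := φ.left_inv hy
    change ψ (π (φ.symm (φ y))) = (B (φ y)).1 at this
    rw [h2] at this
    exact this.symm
  let c : OpenPartialHomeomorph E (ℝ × Fib n) :=
    (φ.transHomeomorph C.toHomeomorph).trans (ψ.symm.prod (OpenPartialHomeomorph.refl (Fib n)))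
  have hcs : c.source = φ.source := by
    ext y
    simp only [c, OpenPartialHomeomorph.trans_source, mem_inter_iff, mem_preimage]
    constructor
    · exact fun hy => hy.1
    · intro hy
      refine ⟨hy, ?_⟩
      have : (C (φ y)).1 ∈ ψ.target := by
        rw [hwr y hy]; exact ψ.map_source (hsrc hy)
      simpa using this
  have hφ : ContMDiffOn (𝓡 (n + 1)) (𝓡 (n + 1)) ∞ φ φ.source :=
    contMDiffOn_of_mem_maximalAtlas h.domChart_mem_maximalAtlas
  have hφ' : ContMDiffOn (𝓡 (n + 1)) (𝓡 (n + 1)) ∞ φ.symm φ.target :=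
    contMDiffOn_symm_of_mem_maximalAtlas h.domChart_mem_maximalAtlas
  have hψ : ContDiffOn ℝ ∞ ψ ψ.source :=
    (contMDiffOn_of_mem_maximalAtlas h.codChart_mem_maximalAtlas).contDiffOn
  have hψ' : ContDiffOn ℝ ∞ ψ.symm ψ.target :=
    (contMDiffOn_symm_of_mem_maximalAtlas h.codChart_mem_maximalAtlas).contDiffOn
  refine ⟨⟨c, ?_, ?_, ?_⟩, by rw [hcs]; exact h.mem_domChart_source⟩
  · have h1 : ContMDiffOn (𝓡 (n + 1)) 𝓘(ℝ, ℝ × Fib n) ∞ (fun y => C (φ y)) c.source :=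
      C.contDiff.contMDiff.comp_contMDiffOn (hcs ▸ hφ)
    have h2 : ContDiffOn ℝ ∞ (fun p : ℝ × Fib n => (ψ.symm p.1, p.2)) {p | p.1 ∈ ψ.target} :=
      (hψ'.comp contDiffOn_fst fun p hp => hp).prodMk contDiffOn_snd
    refine h2.contMDiffOn.comp h1 fun y hy => ?_
    change (C (φ y)).1 ∈ ψ.target
    rw [hcs] at hy
    rw [hwr y hy]
    exact ψ.map_source (hsrc hy)
  · have h2 : ContDiffOn ℝ ∞ (fun p : ℝ × Fib n => C.symm (ψ p.1, p.2)) {p | p.1 ∈ ψ.source} :=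
      C.symm.contDiff.comp_contDiffOn
        ((hψ.comp contDiffOn_fst fun p hp => hp).prodMk contDiffOn_snd)
    have ht : c.target = {p | p.1 ∈ ψ.source ∧ C.symm (ψ p.1, p.2) ∈ φ.target} := by
      ext p
      simp [c]
    refine hφ'.comp (h2.contMDiffOn.mono ?_) ?_ (f := fun p : ℝ × Fib n => C.symm (ψ p.1, p.2))
    · intro p hp
      exact (ht ▸ hp).1
    · intro p hp
      exact (ht ▸ hp).2
  · intro y hy
    rw [hcs] at hy
    change ψ.symm (C (φ y)).1 = π y
    rw [hwr y hy, ψ.left_inv (hsrc hy)]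

section Jets

variable (n : ℕ) {E : Type*} [TopologicalSpace E]
  [ChartedSpace (EuclideanSpace ℝ (Fin (n + 1))) E] (π : E → ℝ)

/-- Two local sections have the same `r`-jet at `t` if they agree at `t` and, in adapted charts,
their coordinates have the same derivatives at `t` up to order `r`. -/
def jetSetoid (r : ℕ) (t : ℝ) : Setoid (LocalSection n π t) where
  r φ ψ := φ.toFun t = ψ.toFun t ∧ ∀ e : AdaptedChart n π, φ.toFun t ∈ e.chart.source →
    ∀ i ≤ r, iteratedDeriv i (fun s => (e.chart (φ.toFun s)).2) t =
      iteratedDeriv i (fun s => (e.chart (ψ.toFun s)).2) t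
  iseqv :=
    { refl := fun _ => ⟨rfl, fun _ _ _ _ => rfl⟩
      symm := fun h => ⟨h.1.symm, fun e he i hi => (h.2 e (h.1 ▸ he) i hi).symm⟩
      trans := fun h h' => ⟨h.1.trans h'.1, fun e he i hi =>
        (h.2 e he i hi).trans (h'.2 e (h.1 ▸ he) i hi)⟩ }

/-- The set `J^r π` of `r`-jets `j^r_t φ` of local sections of `π`. -/
def Jet (r : ℕ) : Type _ := Σ t : ℝ, Quotient (jetSetoid n π r t)

end Jets

/-- The space `ℝ × (ℝⁿ)^{r+1}` of jet coordinates `(t, q_0, …, q_r)`. -/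
abbrev JetModel (n r : ℕ) : Type := ℝ × (Fin (r + 1) → Fib n)

section JetCharts

variable {n : ℕ} {E : Type*} [TopologicalSpace E]
  [ChartedSpace (EuclideanSpace ℝ (Fin (n + 1))) E] {π : E → ℝ} {r : ℕ}

/-- The time `t` of the jet `j^r_t φ`, i.e. the projection `J^r π → ℝ`. -/
def Jet.time (j : Jet n π r) : ℝ := j.1

/-- A local section representing a jet. -/
def Jet.rep (j : Jet n π r) : LocalSection n π j.time := Quotient.out j.2

/-- The point `φ t` of `E` under the jet `j^r_t φ`. -/
def Jet.pt (j : Jet n π r) : E := j.rep.toFun j.time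

/-- The `r`-jet at `t` of a local section. -/
def LocalSection.jet {t : ℝ} (φ : LocalSection n π t) (r : ℕ) : Jet n π r :=
  ⟨t, Quotient.mk (jetSetoid n π r t) φ⟩

/-- The projection `J^r π → J^s π` for `s ≤ r`. -/
def Jet.proj {s r : ℕ} (h : s ≤ r) (j : Jet n π r) : Jet n π s :=
  ⟨j.1, Quotient.map (sa := jetSetoid n π r j.1) (sb := jetSetoid n π s j.1) id
    (fun _ _ hab => ⟨hab.1, fun e he i hi => hab.2 e he i (hi.trans h)⟩) j.2⟩

/-- The curve `s ↦ q_0 + q_1 (s - t) + … + q_r (s - t)^r / r!`. -/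
def taylorCurve (z : JetModel n r) (s : ℝ) : Fib n :=
  ∑ i : Fin (r + 1), ((s - z.1) ^ (i : ℕ) / ((i : ℕ).factorial : ℝ)) • z.2 i

lemma contDiff_taylorCurve :
    ContDiff ℝ ∞ (fun p : ℝ × JetModel n r => taylorCurve p.2 p.1) := by
  unfold taylorCurve
  fun_prop

lemma iteratedDeriv_taylorCurve (z : JetModel n r) (i : Fin (r + 1)) :
    iteratedDeriv i (taylorCurve z) z.1 = z.2 i := by
  have hmono : ∀ j : ℕ, iteratedDeriv (i : ℕ) (fun s : ℝ => (s - z.1) ^ j / (j.factorial : ℝ)) z.1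
      = if (i : ℕ) = j then 1 else 0 := by
    intro j
    rw [iteratedDeriv_div_const, iteratedDeriv_comp_sub_const (i : ℕ) (fun s : ℝ => s ^ j) z.1]
    simp only [sub_self]
    rw [iteratedDeriv_fun_pow_zero]
    split_ifs with h
    · subst h
      field_simp
    · simp
  have hc : ∀ j : Fin (r + 1), ContDiffAt ℝ (i : ℕ)
      (fun s : ℝ => (s - z.1) ^ (j : ℕ) / ((j : ℕ).factorial : ℝ)) z.1 := by
    intro j
    fun_prop
  have hs : iteratedDeriv (i : ℕ) (taylorCurve z) z.1 = ∑ j : Fin (r + 1), iteratedDeriv (i : ℕ)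
      (fun s : ℝ => ((s - z.1) ^ (j : ℕ) / ((j : ℕ).factorial : ℝ)) • z.2 j) z.1 :=
    iteratedDeriv_fun_sum (fun j _ => (hc j).smul contDiffAt_const)
  rw [hs, Finset.sum_eq_single i]
  · rw [iteratedDeriv_smul_const (hc i), hmono, if_pos rfl, one_smul]
  · intro j _ hj
    rw [iteratedDeriv_smul_const (hc j), hmono, if_neg, zero_smul]
    exact fun h => hj (Fin.ext h.symm)
  · simp

lemma taylorCurve_self (z : JetModel n r) : taylorCurve z z.1 = z.2 0 := by
  simpa using iteratedDeriv_taylorCurve z 0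

lemma eventually_taylorCurve_mem (e : AdaptedChart n π) (z : JetModel n r)
    (hz : (z.1, z.2 0) ∈ e.chart.target) :
    ∀ᶠ s in 𝓝 z.1, (s, taylorCurve z s) ∈ e.chart.target := by
  have hc : Continuous fun s : ℝ => (s, taylorCurve z s) :=
    continuous_id.prodMk (contDiff_taylorCurve.continuous.comp (by fun_prop :
      Continuous fun s : ℝ => (s, z)))
  exact hc.continuousAt.eventually (e.chart.open_target.mem_nhds (by simpa [taylorCurve_self]))

/-- The local section with prescribed jet coordinates in an adapted chart. -/
def AdaptedChart.taylorSection (e : AdaptedChart n π) (z : JetModel n r)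
    (hz : (z.1, z.2 0) ∈ e.chart.target) : LocalSection n π z.1 where
  toFun s := e.chart.symm (s, taylorCurve z s)
  smooth := by
    filter_upwards [eventually_taylorCurve_mem e z hz] with s hs
    have h1 : ContMDiffAt 𝓘(ℝ, ℝ × Fib n) (𝓡 (n + 1)) ∞ e.chart.symm (s, taylorCurve z s) :=
      e.smooth_symm.contMDiffAt (e.chart.open_target.mem_nhds hs)
    refine h1.comp s (ContDiffAt.contMDiffAt ?_)
    exact (contDiff_id.prodMk (contDiff_taylorCurve.comp
      (contDiff_id.prodMk contDiff_const))).contDiffAt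
  isSection := by
    filter_upwards [eventually_taylorCurve_mem e z hz] with s hs
    rw [← e.fst_eq _ (e.chart.map_target hs), e.chart.right_inv hs]


/-- The coordinate expression `(s, q (s))` of a local section. -/
def AdaptedChart.curve (e : AdaptedChart n π) {t : ℝ} (φ : LocalSection n π t) (s : ℝ) :
    ℝ × Fib n :=
  e.chart (φ.toFun s)

lemma LocalSection.continuousAt {t : ℝ} (φ : LocalSection n π t) : ContinuousAt φ.toFun t :=
  φ.smooth.self_of_nhds.continuousAt

lemma AdaptedChart.contDiffAt_curve (e : AdaptedChart n π) {t : ℝ} (φ : LocalSection n π t)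
    (h : φ.toFun t ∈ e.chart.source) : ContDiffAt ℝ ∞ (e.curve φ) t :=
  ContMDiffAt.contDiffAt (ContMDiffAt.comp t
    (e.smooth.contMDiffAt (e.chart.open_source.mem_nhds h)) φ.smooth.self_of_nhds)

lemma AdaptedChart.curve_eventuallyEq (e : AdaptedChart n π) {t : ℝ} (φ : LocalSection n π t)
    (h : φ.toFun t ∈ e.chart.source) :
    e.curve φ =ᶠ[𝓝 t] fun s => (s, (e.curve φ s).2) := by
  filter_upwards [φ.continuousAt.eventually (e.chart.open_source.mem_nhds h), φ.isSection]
    with s hs hs'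
  refine Prod.ext ?_ rfl
  change (e.chart (φ.toFun s)).1 = s
  rw [e.fst_eq _ hs, hs']

lemma iteratedDeriv_comp_congr {F : ℝ × Fib n → Fib n} {γ₁ γ₂ : ℝ → ℝ × Fib n} {t : ℝ}
    (hF : ContDiffAt ℝ ∞ F (γ₁ t)) (h₁ : ContDiffAt ℝ ∞ γ₁ t) (h₂ : ContDiffAt ℝ ∞ γ₂ t)
    (hd : ∀ i ≤ r, iteratedDeriv i γ₁ t = iteratedDeriv i γ₂ t) {i : ℕ} (hi : i ≤ r) :
    iteratedDeriv i (F ∘ γ₁) t = iteratedDeriv i (F ∘ γ₂) t := by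
  have h0 : γ₁ t = γ₂ t := by simpa using hd 0 (Nat.zero_le _)
  have hd' : ∀ j ≤ i, iteratedFDeriv ℝ j γ₁ t = iteratedFDeriv ℝ j γ₂ t := by
    intro j hj
    rw [iteratedFDeriv_eq_equiv_comp, iteratedFDeriv_eq_equiv_comp]
    simp only [Function.comp]
    rw [hd j (hj.trans hi)]
  rw [iteratedDeriv_eq_iteratedFDeriv, iteratedDeriv_eq_iteratedFDeriv,
    iteratedFDeriv_comp hF h₁ (by exact_mod_cast le_top : ((i : ℕ) : WithTop ℕ∞) ≤ ∞),
    iteratedFDeriv_comp (h0 ▸ hF) h₂ (by exact_mod_cast le_top : ((i : ℕ) : WithTop ℕ∞) ≤ ∞)]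
  congr 1
  simp only [FormalMultilinearSeries.taylorComp, h0]
  refine Finset.sum_congr rfl fun c _ => ?_
  simp only [FormalMultilinearSeries.compAlongOrderedFinpartition, ftaylorSeries]
  congr 1
  funext m
  exact hd' _ (c.partSize_le m)

lemma iteratedDeriv_graph {t : ℝ} {c : ℝ → Fib n} (hc : ContDiffAt ℝ ∞ c t) (i : ℕ) :
    iteratedDeriv i (fun s : ℝ => (s, c s)) t = (iteratedDeriv i (fun s : ℝ => s) t,
      iteratedDeriv i c t) := by
  have hi : ((i : ℕ) : WithTop ℕ∞) ≤ ∞ := by exact_mod_cast le_top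
  rw [iteratedDeriv_eq_iteratedFDeriv, iteratedDeriv_eq_iteratedFDeriv,
    iteratedDeriv_eq_iteratedFDeriv,
    iteratedFDeriv_prodMk (f := fun s : ℝ => s) contDiffAt_id hc hi]
  rfl

/-- Agreement of the derivatives up to order `r` in one adapted chart suffices. -/
lemma jetSetoid_of_chart {t : ℝ} (φ ψ : LocalSection n π t) (e : AdaptedChart n π)
    (hφ : φ.toFun t ∈ e.chart.source) (h0 : φ.toFun t = ψ.toFun t)
    (h : ∀ i ≤ r, iteratedDeriv i (fun s => (e.chart (φ.toFun s)).2) t =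
      iteratedDeriv i (fun s => (e.chart (ψ.toFun s)).2) t) :
    jetSetoid n π r t φ ψ := by
  refine ⟨h0, fun e' he' i hi => ?_⟩
  have hψ : ψ.toFun t ∈ e.chart.source := h0 ▸ hφ
  have key : ∀ χ : LocalSection n π t, χ.toFun t ∈ e.chart.source →
      (fun s => (e'.chart (χ.toFun s)).2) =ᶠ[𝓝 t]
        (fun p => (e'.chart (e.chart.symm p)).2) ∘ e.curve χ := by
    intro χ hχ
    filter_upwards [χ.continuousAt.eventually (e.chart.open_source.mem_nhds hχ)] with s hs
    simp [AdaptedChart.curve, e.chart.left_inv hs]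
  rw [(key φ hφ).iteratedDeriv_eq, (key ψ hψ).iteratedDeriv_eq]
  refine iteratedDeriv_comp_congr (r := r) ?_ (e.contDiffAt_curve φ hφ) (e.contDiffAt_curve ψ hψ)
    ?_ hi
  · refine ContDiffAt.snd (ContMDiffAt.contDiffAt ?_)
    have ht : e.curve φ t ∈ e.chart.target := e.chart.map_source hφ
    refine ContMDiffAt.comp (I' := 𝓡 (n + 1)) (e.curve φ t) ?_
      (e.smooth_symm.contMDiffAt (e.chart.open_target.mem_nhds ht))
    refine e'.smooth.contMDiffAt (e'.chart.open_source.mem_nhds ?_)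
    simpa [AdaptedChart.curve, e.chart.left_inv hφ] using he'
  · intro j hj
    rw [(e.curve_eventuallyEq φ hφ).iteratedDeriv_eq, (e.curve_eventuallyEq ψ hψ).iteratedDeriv_eq,
      iteratedDeriv_graph (e.contDiffAt_curve φ hφ).snd,
      iteratedDeriv_graph (e.contDiffAt_curve ψ hψ).snd]
    exact congrArg _ (h j hj)

lemma LocalSection.rep_jet_rel {t : ℝ} (φ : LocalSection n π t) :
    jetSetoid n π r t (φ.jet r).rep φ :=
  Quotient.exact (Quotient.out_eq (Quotient.mk (jetSetoid n π r t) φ))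

lemma LocalSection.pt_jet {t : ℝ} (φ : LocalSection n π t) : (φ.jet r).pt = φ.toFun t :=
  φ.rep_jet_rel.1

lemma Jet.jet_rep (j : Jet n π r) : j.rep.jet r = j := by
  obtain ⟨t, q⟩ := j
  exact congrArg (Sigma.mk t) (Quotient.out_eq q)

/-- The jet coordinates `(t, q_0, …, q_r)`, `q_i = d^i q / dt^i`, induced by an adapted chart. -/
def AdaptedChart.coords (e : AdaptedChart n π) (r : ℕ) (j : Jet n π r) : JetModel n r :=
  (j.time, fun i => iteratedDeriv i (fun s => (e.chart (j.rep.toFun s)).2) j.time)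

lemma AdaptedChart.coords_jet (e : AdaptedChart n π) {t : ℝ} (φ : LocalSection n π t)
    (h : φ.toFun t ∈ e.chart.source) : e.coords r (φ.jet r) =
      (t, fun i : Fin (r + 1) => iteratedDeriv i (fun s => (e.chart (φ.toFun s)).2) t) := by
  refine Prod.ext rfl (funext fun i => ?_)
  exact φ.rep_jet_rel.2 e (φ.rep_jet_rel.1 ▸ h) i (Nat.lt_succ_iff.1 i.2)

lemma AdaptedChart.chart_pt (e : AdaptedChart n π) {j : Jet n π r} (h : j.pt ∈ e.chart.source) :
    e.chart j.pt = ((e.coords r j).1, (e.coords r j).2 0) := by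
  refine Prod.ext ?_ (by simp [AdaptedChart.coords, Jet.pt])
  rw [e.fst_eq _ h]
  exact j.rep.isSection.self_of_nhds

lemma AdaptedChart.taylorSection_self (e : AdaptedChart n π) (z : JetModel n r)
    (hz : (z.1, z.2 0) ∈ e.chart.target) :
    (e.taylorSection z hz).toFun z.1 = e.chart.symm (z.1, z.2 0) := by
  simp [AdaptedChart.taylorSection, taylorCurve_self]

lemma AdaptedChart.coords_taylorSection (e : AdaptedChart n π) (z : JetModel n r)
    (hz : (z.1, z.2 0) ∈ e.chart.target) :
    e.coords r ((e.taylorSection z hz).jet r) = z := by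
  rw [e.coords_jet _ (by rw [e.taylorSection_self]; exact e.chart.map_target hz)]
  refine Prod.ext rfl (funext fun i => ?_)
  have : (fun s => (e.chart ((e.taylorSection z hz).toFun s)).2) =ᶠ[𝓝 z.1] taylorCurve z := by
    filter_upwards [eventually_taylorCurve_mem e z hz] with s hs
    simp [AdaptedChart.taylorSection, e.chart.right_inv hs]
  rw [← iteratedDeriv_taylorCurve z i]
  exact this.iteratedDeriv_eq _

lemma contDiffOn_iteratedDeriv {Z G : Type*} [NormedAddCommGroup Z] [NormedSpace ℝ Z]
    [NormedAddCommGroup G] [NormedSpace ℝ G] {Φ : ℝ × Z → G} {W : Set (ℝ × Z)} (hW : IsOpen W)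
    (hΦ : ContDiffOn ℝ ∞ Φ W) (i : ℕ) :
    ContDiffOn ℝ ∞ (fun p : ℝ × Z => iteratedDeriv i (fun s => Φ (s, p.2)) p.1) W := by
  induction i with
  | zero => simpa using hΦ
  | succ i ih =>
    refine ((ih.fderiv_of_isOpen hW (m := ∞) (by simp)).clm_apply
      (contDiffOn_const (c := ((1 : ℝ), (0 : Z))))).congr fun p hp => ?_
    rw [iteratedDeriv_succ]
    have h1 : HasFDerivAt (fun p : ℝ × Z => iteratedDeriv i (fun s => Φ (s, p.2)) p.1)
        (fderiv ℝ (fun p : ℝ × Z => iteratedDeriv i (fun s => Φ (s, p.2)) p.1) p) p :=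
      ((ih.contDiffAt (hW.mem_nhds hp)).differentiableAt (by simp)).hasFDerivAt
    have h2 : HasDerivAt (fun s : ℝ => (s, p.2)) ((1 : ℝ), (0 : Z)) p.1 :=
      (hasDerivAt_id p.1).prodMk (hasDerivAt_const p.1 p.2)
    exact (HasFDerivAt.comp_hasDerivAt p.1 h1 h2).deriv

/-- Smoothness of the changes of jet coordinates. -/
lemma AdaptedChart.contDiffOn_transition (e e' : AdaptedChart n π) :
    ContDiffOn ℝ ∞ (fun z : JetModel n r => ((z.1, fun i : Fin (r + 1) =>
        iteratedDeriv i (fun s => (e'.chart (e.chart.symm (s, taylorCurve z s))).2) z.1) :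
          JetModel n r))
      {z | (z.1, z.2 0) ∈ (e.chart.symm.trans e'.chart).source} := by
  have hg : ContDiff ℝ ∞ (fun p : ℝ × JetModel n r => (p.1, taylorCurve p.2 p.1)) :=
    contDiff_fst.prodMk contDiff_taylorCurve
  have hW : IsOpen ((fun p : ℝ × JetModel n r => (p.1, taylorCurve p.2 p.1)) ⁻¹'
      (e.chart.symm.trans e'.chart).source) :=
    (e.chart.symm.trans e'.chart).open_source.preimage hg.continuous
  have hF : ContDiffOn ℝ ∞ (fun p => (e'.chart (e.chart.symm p)).2)
      (e.chart.symm.trans e'.chart).source := by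
    refine ContDiffOn.snd (ContMDiffOn.contDiffOn ?_)
    refine e'.smooth.comp (e.smooth_symm.mono fun p hp => ?_) fun p hp => ?_
    · exact ((e.chart.symm.trans_source e'.chart) ▸ hp).1
    · exact ((e.chart.symm.trans_source e'.chart) ▸ hp).2
  have hΦ := hF.comp hg.contDiffOn (s := (fun p : ℝ × JetModel n r =>
    (p.1, taylorCurve p.2 p.1)) ⁻¹' (e.chart.symm.trans e'.chart).source) fun _ h => h
  refine contDiffOn_fst.prodMk (contDiffOn_pi.2 fun i => ?_)
  refine (contDiffOn_iteratedDeriv hW hΦ i).comp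
    (f := fun z : JetModel n r => (z.1, z)) (contDiff_fst.prodMk contDiff_id).contDiffOn ?_
  intro z hz
  simpa [taylorCurve_self] using hz

end JetCharts

section JetManifold

variable {n : ℕ} {E : Type*} [TopologicalSpace E]
  [ChartedSpace (EuclideanSpace ℝ (Fin (n + 1))) E] [IsManifold (𝓡 (n + 1)) ∞ E]
  {π : E → ℝ} [hπ : IsBundleOverLine n π] {r : ℕ}

variable (n π) in
/-- A choice of adapted chart around each point of `E`. -/
def adaptedChartAt (x : E) : AdaptedChart n π :=
  (exists_adaptedChart (n := n) π x).choose

lemma mem_adaptedChartAt_source (x : E) : x ∈ (adaptedChartAt n π x).chart.source :=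
  (exists_adaptedChart (n := n) π x).choose_spec

instance Jet.instNonempty : Nonempty (Jet n π r) := by
  obtain ⟨x, -⟩ := hπ.surjective 0
  let e := adaptedChartAt n π x
  have hx : x ∈ e.chart.source := mem_adaptedChartAt_source x
  exact ⟨(e.taylorSection (r := r) ((e.chart x).1, fun _ => (e.chart x).2)
    (e.chart.map_source hx)).jet r⟩

open Classical in
/-- The jet with given coordinates in an adapted chart. -/
def AdaptedChart.ofCoords (e : AdaptedChart n π) (z : JetModel n r) : Jet n π r :=
  if h : (z.1, z.2 0) ∈ e.chart.target then (e.taylorSection z h).jet r else Classical.arbitrary _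

/-- The chart of `J^r π` induced by an adapted chart of `E`. -/
def AdaptedChart.jetEquiv (e : AdaptedChart n π) (r : ℕ) :
    PartialEquiv (Jet n π r) (JetModel n r) where
  toFun := e.coords r
  invFun := e.ofCoords
  source := {j | j.pt ∈ e.chart.source}
  target := {z | (z.1, z.2 0) ∈ e.chart.target}
  map_source' j hj := by
    have := e.chart.map_source hj
    rwa [e.chart_pt hj] at this
  map_target' z hz := by
    have hz' : (z.1, z.2 0) ∈ e.chart.target := hz
    simp only [AdaptedChart.ofCoords, hz', dif_pos, mem_ofPred_eq, LocalSection.pt_jet,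
      e.taylorSection_self]
    exact e.chart.map_target hz'
  left_inv' j hj := by
    have hj' : j.pt ∈ e.chart.source := hj
    have hz : ((e.coords r j).1, (e.coords r j).2 0) ∈ e.chart.target := by
      have := e.chart.map_source hj'
      rwa [e.chart_pt hj'] at this
    rw [AdaptedChart.ofCoords, dif_pos hz]
    have h0 : (e.taylorSection (e.coords r j) hz).toFun j.time = j.pt := by
      have := e.taylorSection_self (e.coords r j) hz
      rw [← e.chart_pt hj', e.chart.left_inv hj'] at this
      exact this
    conv_rhs => rw [← j.jet_rep]
    refine congrArg (Sigma.mk j.time) (Quotient.sound ?_)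
    have hs : (e.taylorSection (e.coords r j) hz).toFun j.time ∈ e.chart.source := h0 ▸ hj'
    refine jetSetoid_of_chart _ _ e hs h0 fun i hi => ?_
    have h1 := e.coords_taylorSection (e.coords r j) hz
    have h2 := e.coords_jet (r := r) (e.taylorSection (e.coords r j) hz) hs
    have h3 := congrFun (congrArg Prod.snd (h2.symm.trans h1)) ⟨i, Nat.lt_succ_iff.2 hi⟩
    exact h3
  right_inv' z hz := by
    have hz' : (z.1, z.2 0) ∈ e.chart.target := hz
    simp only [AdaptedChart.ofCoords, hz', dif_pos]
    exact e.coords_taylorSection z hz'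

lemma AdaptedChart.transition_source (e e' : AdaptedChart n π) :
    ((e.jetEquiv r).symm.trans (e'.jetEquiv r)).source =
      {z | (z.1, z.2 0) ∈ (e.chart.symm.trans e'.chart).source} := by
  ext z
  rw [PartialEquiv.trans_source, OpenPartialHomeomorph.trans_source]
  refine and_congr_right fun hz => ?_
  have hz' : (z.1, z.2 0) ∈ e.chart.target := hz
  change (e.ofCoords z).pt ∈ e'.chart.source ↔ e.chart.symm (z.1, z.2 0) ∈ e'.chart.source
  simp only [AdaptedChart.ofCoords, hz', dif_pos, LocalSection.pt_jet, e.taylorSection_self]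

lemma AdaptedChart.contDiffOn_jetTransition (e e' : AdaptedChart n π) :
    ContDiffOn ℝ ∞ ((e.jetEquiv r).symm.trans (e'.jetEquiv r))
      ((e.jetEquiv r).symm.trans (e'.jetEquiv r)).source := by
  rw [e.transition_source]
  refine (e.contDiffOn_transition e').congr fun z hz => ?_
  rw [mem_ofPred_eq, OpenPartialHomeomorph.trans_source] at hz
  have hz' : (z.1, z.2 0) ∈ e.chart.target := hz.1
  change e'.coords r (e.ofCoords z) = _
  simp only [AdaptedChart.ofCoords, hz', dif_pos]
  rw [e'.coords_jet _ (by rw [e.taylorSection_self]; exact hz.2)]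
  rfl

variable (n π r) in
/-- The smooth atlas of `J^r π`, made of the charts induced by the adapted charts of `E`. -/
def jetCore : ChartedSpaceCore (JetModel n r) (Jet n π r) where
  atlas := Set.range fun e : AdaptedChart n π => e.jetEquiv r
  chartAt j := (adaptedChartAt n π j.pt).jetEquiv r
  mem_chart_source j := mem_adaptedChartAt_source j.pt
  chart_mem_atlas _ := mem_range_self _
  open_source := by
    rintro _ _ ⟨e, rfl⟩ ⟨e', rfl⟩
    rw [e.transition_source]
    exact (e.chart.symm.trans e'.chart).open_source.preimage
      (by fun_prop : Continuous fun z : JetModel n r => (z.1, z.2 0))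
  continuousOn_toFun := by
    rintro _ _ ⟨e, rfl⟩ ⟨e', rfl⟩
    exact (e.contDiffOn_jetTransition e').continuousOn

instance Jet.instTopologicalSpace : TopologicalSpace (Jet n π r) :=
  (jetCore n π r).toTopologicalSpace

instance Jet.instChartedSpace : ChartedSpace (JetModel n r) (Jet n π r) :=
  (jetCore n π r).toChartedSpace

/-- The chart of the manifold `J^r π` induced by an adapted chart of `E`. -/
def AdaptedChart.jetChart (e : AdaptedChart n π) (r : ℕ) :
    OpenPartialHomeomorph (Jet n π r) (JetModel n r) :=
  (jetCore n π r).openPartialHomeomorph (e.jetEquiv r) (mem_range_self e)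

lemma AdaptedChart.jetChart_mem_atlas (e : AdaptedChart n π) (r : ℕ) :
    e.jetChart r ∈ atlas (JetModel n r) (Jet n π r) :=
  mem_iUnion.2 ⟨e.jetEquiv r, mem_iUnion.2 ⟨mem_range_self e, rfl⟩⟩

instance Jet.instIsManifold : IsManifold 𝓘(ℝ, JetModel n r) ∞ (Jet n π r) := by
  refine isManifold_of_contDiffOn _ _ _ fun c c' hc hc' => ?_
  obtain ⟨e, he, hce⟩ : ∃ e ∈ (jetCore n π r).atlas, ∃ h, c =
      (jetCore n π r).openPartialHomeomorph e h := by
    obtain ⟨e, he⟩ := mem_iUnion.1 hc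
    obtain ⟨h, h'⟩ := mem_iUnion.1 he
    exact ⟨e, h, h, h'⟩
  obtain ⟨e', he', hce'⟩ : ∃ e ∈ (jetCore n π r).atlas, ∃ h, c' =
      (jetCore n π r).openPartialHomeomorph e h := by
    obtain ⟨e, he⟩ := mem_iUnion.1 hc'
    obtain ⟨h, h'⟩ := mem_iUnion.1 he
    exact ⟨e, h, h, h'⟩
  obtain ⟨_, rfl⟩ := hce
  obtain ⟨_, rfl⟩ := hce'
  obtain ⟨a, rfl⟩ := he
  obtain ⟨b, rfl⟩ := he'
  have := a.contDiffOn_jetTransition (r := r) b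
  refine (this.congr fun _ _ => rfl).mono fun z hz => ?_
  exact hz.1

end JetManifold

section DualBundles

variable {n : ℕ} {E : Type*} [TopologicalSpace E]
  [ChartedSpace (EuclideanSpace ℝ (Fin (n + 1))) E] [IsManifold (𝓡 (n + 1)) ∞ E]
  {π : E → ℝ} [hπ : IsBundleOverLine n π] {r : ℕ}

variable (n π r) in
/-- The cotangent bundle `T^*(J^r π)`. -/
abbrev JetCotangent : Type _ :=
  Bundle.TotalSpace (JetModel n r →L[ℝ] ℝ) (fun j : Jet n π r =>
    TangentSpace 𝓘(ℝ, JetModel n r) j →L[ℝ] Bundle.Trivial (Jet n π r) ℝ j)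

/-- The `1`-form `dt` on `J^r π` at a jet. -/
def Jet.dt (j : Jet n π r) : TangentSpace 𝓘(ℝ, JetModel n r) j →L[ℝ] ℝ :=
  mfderiv 𝓘(ℝ, JetModel n r) 𝓘(ℝ, ℝ) Jet.time j

variable (n π r) in
/-- The quotient bundle `J^r π^* = T^*(J^r π) / ⟨dt⟩`. -/
def RestrictedDual : Type _ :=
  Σ j : Jet n π r, (TangentSpace 𝓘(ℝ, JetModel n r) j →L[ℝ] ℝ) ⧸ Submodule.span ℝ {j.dt}

/-- The quotient map `μ : T^*(J^r π) → J^r π^*`. -/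
def JetCotangent.toRestricted (p : JetCotangent n π r) : RestrictedDual n π r :=
  ⟨p.proj, Submodule.Quotient.mk p.snd⟩

/-- The coordinate space of `J^r π^*`, with coordinates `(t, q_0, …, q_r, p^0, …, p^r)`. -/
abbrev RestrictedModel (n r : ℕ) : Type :=
  JetModel n r × ((Fin (r + 1) → Fib n) →L[ℝ] ℝ)

/-- The differential at `j` of a jet chart. -/
def AdaptedChart.tangentMap (e : AdaptedChart n π) (j : Jet n π r) :
    TangentSpace 𝓘(ℝ, JetModel n r) j →L[ℝ] JetModel n r :=
  mfderiv 𝓘(ℝ, JetModel n r) 𝓘(ℝ, JetModel n r) (e.jetChart r) j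

/-- The momentum coordinates `(p^0, …, p^r)` of a covector `p dt + p^i dq_i`. -/
def AdaptedChart.vert (e : AdaptedChart n π) (j : Jet n π r)
    (α : TangentSpace 𝓘(ℝ, JetModel n r) j →L[ℝ] ℝ) : (Fin (r + 1) → Fib n) →L[ℝ] ℝ :=
  (α.comp (e.tangentMap j).inverse).comp (ContinuousLinearMap.inr ℝ ℝ (Fin (r + 1) → Fib n))

lemma AdaptedChart.mdifferentiable_jetChart (e : AdaptedChart n π) (r : ℕ) :
    (e.jetChart r).MDifferentiable 𝓘(ℝ, JetModel n r) 𝓘(ℝ, JetModel n r) :=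
  mdifferentiable_of_mem_atlas (e.jetChart_mem_atlas r)

lemma AdaptedChart.isInvertible_tangentMap (e : AdaptedChart n π) {j : Jet n π r}
    (hj : j.pt ∈ e.chart.source) : (e.tangentMap j).IsInvertible :=
  ⟨(e.mdifferentiable_jetChart r).mfderiv (x := j) hj, rfl⟩

lemma AdaptedChart.dt_eq (e : AdaptedChart n π) {j : Jet n π r} (hj : j.pt ∈ e.chart.source) :
    j.dt = (ContinuousLinearMap.fst ℝ ℝ (Fin (r + 1) → Fib n)).comp (e.tangentMap j) := by
  have h1 : MDifferentiableAt 𝓘(ℝ, JetModel n r) 𝓘(ℝ, JetModel n r) (e.jetChart r) j :=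
    (e.mdifferentiable_jetChart r).mdifferentiableAt hj
  have h2 : HasMFDerivAt 𝓘(ℝ, JetModel n r) 𝓘(ℝ, ℝ) (fun z : JetModel n r => z.1)
      (e.jetChart r j) (ContinuousLinearMap.fst ℝ ℝ (Fin (r + 1) → Fib n)) :=
    hasFDerivAt_fst.hasMFDerivAt
  exact (h2.comp j h1.hasMFDerivAt).mfderiv

lemma AdaptedChart.vert_dt (e : AdaptedChart n π) {j : Jet n π r} (hj : j.pt ∈ e.chart.source) :
    e.vert j j.dt = 0 := by
  rw [AdaptedChart.vert, e.dt_eq hj, ContinuousLinearMap.comp_assoc _ (e.tangentMap j),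
    (e.isInvertible_tangentMap hj).self_comp_inverse]
  ext v
  simp

lemma AdaptedChart.vert_out (e : AdaptedChart n π) {j : Jet n π r} (hj : j.pt ∈ e.chart.source)
    (α : TangentSpace 𝓘(ℝ, JetModel n r) j →L[ℝ] ℝ) :
    e.vert j (Quotient.out (Submodule.Quotient.mk α :
      (TangentSpace 𝓘(ℝ, JetModel n r) j →L[ℝ] ℝ) ⧸ Submodule.span ℝ {j.dt})) = e.vert j α := by
  have h : (Submodule.Quotient.mk (Quotient.out (Submodule.Quotient.mk α :
      (TangentSpace 𝓘(ℝ, JetModel n r) j →L[ℝ] ℝ) ⧸ Submodule.span ℝ {j.dt})) :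
      (TangentSpace 𝓘(ℝ, JetModel n r) j →L[ℝ] ℝ) ⧸ Submodule.span ℝ {j.dt}) =
      Submodule.Quotient.mk α := Quotient.out_eq _
  obtain ⟨c, hc⟩ := Submodule.mem_span_singleton.1 ((Submodule.Quotient.eq _).1 h)
  have h2 : e.vert j (c • j.dt) = 0 := by
    have : e.vert j (c • j.dt) = c • e.vert j j.dt := by
      ext v; simp [AdaptedChart.vert]
    rw [this, e.vert_dt hj, smul_zero]
  rw [hc] at h2
  rw [← sub_eq_zero, ← h2]
  ext v
  simp [AdaptedChart.vert]

/-- The chart `(t, q_i, p^i)` of `J^r π^*` induced by an adapted chart of `E`. The momentum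
coordinates of a class do not depend on the representing covector. -/
def AdaptedChart.dualEquiv (e : AdaptedChart n π) (r : ℕ) :
    PartialEquiv (RestrictedDual n π r) (RestrictedModel n r) where
  toFun w := (e.coords r w.1, e.vert w.1 (Quotient.out w.2))
  invFun z := ⟨e.ofCoords z.1, Submodule.Quotient.mk
    ((z.2.comp (ContinuousLinearMap.snd ℝ ℝ (Fin (r + 1) → Fib n))).comp
      (e.tangentMap (e.ofCoords z.1)))⟩
  source := {w | w.1.pt ∈ e.chart.source}
  target := {z | (z.1.1, z.1.2 0) ∈ e.chart.target}
  map_source' w hw := (e.jetEquiv r).map_source hw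
  map_target' z hz := (e.jetEquiv r).map_target (x := z.1) hz
  left_inv' w hw := by
    obtain ⟨j, a⟩ := w
    have hj : j.pt ∈ e.chart.source := hw
    have h0 : e.ofCoords (e.coords r j) = j := (e.jetEquiv r).left_inv hj
    have h1 : ∀ j' : Jet n π r, j' = j → (⟨j', Submodule.Quotient.mk
        (((e.vert j (Quotient.out a)).comp (ContinuousLinearMap.snd ℝ ℝ (Fin (r + 1) → Fib n))).comp
          (e.tangentMap j'))⟩ : RestrictedDual n π r) = ⟨j, a⟩ := by
      rintro j' rfl
      refine congrArg (Sigma.mk j') ?_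
      conv_rhs => rw [← Quotient.out_eq a]
      refine (Submodule.Quotient.eq _).2 (Submodule.mem_span_singleton.2
        ⟨-(Quotient.out a) ((e.tangentMap j').inverse (1, 0)), ?_⟩)
      have hdt := e.dt_eq hj
      obtain ⟨D, hD⟩ := e.isInvertible_tangentMap hj
      ext v
      have hdv : j'.dt v = (D v).1 := by rw [hdt, ← hD]; rfl
      have hv : v = D.symm (D v) := (D.symm_apply_apply v).symm
      have h3 : D v = (D v).1 • ((1 : ℝ), (0 : Fin (r + 1) → Fib n)) + ((0 : ℝ), (D v).2) := by
        ext <;> simp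
      have h4 : Quotient.out a v = (D v).1 * Quotient.out a (D.symm (1, 0)) +
          Quotient.out a (D.symm (0, (D v).2)) := by
        conv_lhs => rw [hv, h3]
        simp only [map_add, map_smul, smul_eq_mul]
      simp only [AdaptedChart.vert, ← hD, ContinuousLinearMap.inverse_equiv]
      simp [h4, hdv]
      ring
    exact h1 _ h0
  right_inv' z hz := by
    have hj : (e.ofCoords z.1).pt ∈ e.chart.source := (e.jetEquiv r).map_target (x := z.1) hz
    refine Prod.ext ((e.jetEquiv r).right_inv (x := z.1) hz) ?_
    change e.vert _ (Quotient.out (Submodule.Quotient.mk _)) = _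
    rw [e.vert_out hj, AdaptedChart.vert, ContinuousLinearMap.comp_assoc _ (e.tangentMap _),
      (e.isInvertible_tangentMap hj).self_comp_inverse]
    ext v
    simp

lemma AdaptedChart.dual_transition_source (e e' : AdaptedChart n π) :
    ((e.dualEquiv r).symm.trans (e'.dualEquiv r)).source =
      {z | z.1 ∈ ((e.jetEquiv r).symm.trans (e'.jetEquiv r)).source} := rfl

lemma AdaptedChart.tangentMap_comp_inverse (e e' : AdaptedChart n π) {j : Jet n π r}
    (hj : j.pt ∈ e.chart.source) (hj' : j.pt ∈ e'.chart.source) :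
    (e.tangentMap j).comp (e'.tangentMap j).inverse =
      fderiv ℝ ((e'.jetEquiv r).symm.trans (e.jetEquiv r)) (e'.coords r j) := by
  have hm : MDifferentiableAt 𝓘(ℝ, JetModel n r) 𝓘(ℝ, JetModel n r) (e'.jetChart r) j :=
    (e'.mdifferentiable_jetChart r).mdifferentiableAt hj'
  have hs : e'.coords r j ∈ ((e'.jetEquiv r).symm.trans (e.jetEquiv r)).source := by
    rw [PartialEquiv.trans_source]
    refine ⟨(e'.jetEquiv r).map_source hj', ?_⟩
    change (e'.ofCoords (e'.coords r j)).pt ∈ e.chart.source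
    rw [show e'.ofCoords (e'.coords r j) = j from (e'.jetEquiv r).left_inv hj']
    exact hj
  have hT := ((e'.contDiffOn_jetTransition (r := r) e).contDiffAt
    (((jetCore n π r).open_source _ _ (mem_range_self e') (mem_range_self e)).mem_nhds
      hs)).differentiableAt (by simp)
  have hc := hT.hasFDerivAt.hasMFDerivAt.comp (x := j) (f := e'.jetChart r) hm.hasMFDerivAt
  have heq : (e.jetChart r : Jet n π r → JetModel n r) =ᶠ[𝓝 j]
      ((e'.jetEquiv r).symm.trans (e.jetEquiv r)) ∘ (e'.jetChart r) := by
    filter_upwards [(e'.jetChart r).open_source.mem_nhds hj'] with i hi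
    have : (e'.jetEquiv r).symm (e'.jetEquiv r i) = i := (e'.jetEquiv r).left_inv hi
    change e.jetEquiv r i = e.jetEquiv r ((e'.jetEquiv r).symm (e'.jetEquiv r i))
    rw [this]
  have h5 : e.tangentMap j = (fderiv ℝ ((e'.jetEquiv r).symm.trans (e.jetEquiv r))
      (e'.coords r j)).comp (e'.tangentMap j) := (hc.congr_of_eventuallyEq heq).mfderiv
  rw [h5, ContinuousLinearMap.comp_assoc _ (e'.tangentMap j),
    (e'.isInvertible_tangentMap hj').self_comp_inverse]
  exact ContinuousLinearMap.comp_id _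

lemma AdaptedChart.contDiffOn_dualTransition (e e' : AdaptedChart n π) :
    ContDiffOn ℝ ∞ ((e.dualEquiv r).symm.trans (e'.dualEquiv r))
      ((e.dualEquiv r).symm.trans (e'.dualEquiv r)).source := by
  rw [e.dual_transition_source]
  set τ := (e.jetEquiv r).symm.trans (e'.jetEquiv r) with hτ
  set τ' := (e'.jetEquiv r).symm.trans (e.jetEquiv r) with hτ'
  have h1 : ContDiffOn ℝ ∞ τ τ.source := e.contDiffOn_jetTransition e'
  have h2 : ContDiffOn ℝ ∞ τ' τ'.source := e'.contDiffOn_jetTransition e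
  have hst : MapsTo τ τ.source τ'.source := by
    intro z hz
    have := τ.map_source hz
    exact this
  have h3 : ContDiffOn ℝ ∞ (fun z : RestrictedModel n r => τ z.1) {z | z.1 ∈ τ.source} :=
    h1.comp contDiffOn_fst fun z hz => hz
  have h4 : ContDiffOn ℝ ∞ (fderiv ℝ τ') τ'.source :=
    h2.fderiv_of_isOpen ((jetCore n π r).open_source _ _ (mem_range_self e') (mem_range_self e))
      (by simp)
  have h5 : ContDiffOn ℝ ∞ (fun z : RestrictedModel n r => fderiv ℝ τ' (τ z.1))
      {z | z.1 ∈ τ.source} := h4.comp h3 fun z hz => hst hz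
  have h6 : ContDiffOn ℝ ∞ (fun z : RestrictedModel n r =>
      ((z.2.comp (ContinuousLinearMap.snd ℝ ℝ (Fin (r + 1) → Fib n))).comp
        (fderiv ℝ τ' (τ z.1))).comp (ContinuousLinearMap.inr ℝ ℝ (Fin (r + 1) → Fib n)))
      {z | z.1 ∈ τ.source} :=
    ((contDiffOn_snd.clm_comp contDiffOn_const).clm_comp h5).clm_comp contDiffOn_const
  refine (h3.prodMk h6).congr fun z hz => ?_
  have hz' : z.1 ∈ τ.source := hz
  rw [hτ, PartialEquiv.trans_source] at hz'
  have hj : (e.ofCoords z.1).pt ∈ e.chart.source := (e.jetEquiv r).map_target hz'.1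
  have hj' : (e.ofCoords z.1).pt ∈ e'.chart.source := hz'.2
  refine Prod.ext rfl ?_
  change e'.vert _ (Quotient.out (Submodule.Quotient.mk _)) = _
  rw [e'.vert_out hj', AdaptedChart.vert, ContinuousLinearMap.comp_assoc _ (e.tangentMap _),
    e.tangentMap_comp_inverse e' hj hj']
  rfl

variable (n π r) in
/-- The smooth atlas of `J^r π^*`. -/
def restrictedCore : ChartedSpaceCore (RestrictedModel n r) (RestrictedDual n π r) where
  atlas := Set.range fun e : AdaptedChart n π => e.dualEquiv r
  chartAt w := (adaptedChartAt n π w.1.pt).dualEquiv r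
  mem_chart_source w := mem_adaptedChartAt_source w.1.pt
  chart_mem_atlas _ := mem_range_self _
  open_source := by
    rintro _ _ ⟨e, rfl⟩ ⟨e', rfl⟩
    exact ((jetCore n π r).open_source _ _ (mem_range_self e) (mem_range_self e')).preimage
      continuous_fst
  continuousOn_toFun := by
    rintro _ _ ⟨e, rfl⟩ ⟨e', rfl⟩
    exact (e.contDiffOn_dualTransition e').continuousOn

instance RestrictedDual.instTopologicalSpace : TopologicalSpace (RestrictedDual n π r) :=
  (restrictedCore n π r).toTopologicalSpace

instance RestrictedDual.instChartedSpace :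
    ChartedSpace (RestrictedModel n r) (RestrictedDual n π r) :=
  (restrictedCore n π r).toChartedSpace

instance RestrictedDual.instIsManifold :
    IsManifold 𝓘(ℝ, RestrictedModel n r) ∞ (RestrictedDual n π r) := by
  refine isManifold_of_contDiffOn _ _ _ fun c c' hc hc' => ?_
  obtain ⟨_, he⟩ := mem_iUnion.1 hc
  obtain ⟨⟨a, rfl⟩, rfl⟩ := mem_iUnion.1 he
  obtain ⟨_, he'⟩ := mem_iUnion.1 hc'
  obtain ⟨⟨b, rfl⟩, rfl⟩ := mem_iUnion.1 he'
  exact ((a.contDiffOn_dualTransition (r := r) b).congr fun _ _ => rfl).mono fun z hz => hz.1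

end DualBundles

section Forms

variable {H : Type*} [NormedAddCommGroup H] [NormedSpace ℝ H] {M : Type*} [TopologicalSpace M]
  [ChartedSpace H M] {p : ℕ}

/-- Differential `p`-forms (not necessarily smooth) on a manifold `M` modelled on `H`. -/
abbrev DiffForm (H : Type*) [NormedAddCommGroup H] [NormedSpace ℝ H] (M : Type*)
    [TopologicalSpace M] [ChartedSpace H M] (p : ℕ) : Type _ :=
  ∀ x : M, TangentSpace 𝓘(ℝ, H) x [⋀^Fin p]→L[ℝ] ℝ

/-- The coordinate expression of a form in the preferred chart at `x`. -/
def DiffForm.inChart (α : DiffForm H M p) (x : M) : H → H [⋀^Fin p]→L[ℝ] ℝ := fun z =>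
  (α ((chartAt H x).symm z)).compContinuousLinearMap
    (mfderiv 𝓘(ℝ, H) 𝓘(ℝ, H) (chartAt H x).symm z)

/-- Smoothness of a differential form. -/
def DiffForm.IsSmooth (α : DiffForm H M p) : Prop :=
  ∀ x : M, ContDiffOn ℝ ∞ (DiffForm.inChart α x) (chartAt H x).target

/-- The exterior derivative of a differential form, computed at `x` in the preferred chart. -/
def DiffForm.d (α : DiffForm H M p) : DiffForm H M (p + 1) := fun x =>
  (extDeriv (DiffForm.inChart α x) (chartAt H x x)).compContinuousLinearMap
    (mfderiv 𝓘(ℝ, H) 𝓘(ℝ, H) (chartAt H x) x)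

/-- A field of covectors, seen as a `1`-form. -/
def oneForm (β : ∀ x : M, TangentSpace 𝓘(ℝ, H) x →L[ℝ] ℝ) : DiffForm H M 1 := fun x =>
  ContinuousAlternatingMap.ofSubsingleton ℝ (TangentSpace 𝓘(ℝ, H) x) ℝ (0 : Fin 1) (β x)

/-- The rank at `x` of a `2`-form, i.e. of the map `u ↦ α (u, ·)`. -/
def DiffForm.rank (α : DiffForm H M 2) (x : M) : ℕ :=
  Module.finrank ℝ (LinearMap.range (α x).toAlternatingMap.curryLeft)

/-- A `2`-form has maximal rank if at every point its rank is the largest even number not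
exceeding the dimension. -/
def DiffForm.HasMaximalRank (α : DiffForm H M 2) : Prop :=
  ∀ x : M, DiffForm.rank α x = 2 * (Module.finrank ℝ (TangentSpace 𝓘(ℝ, H) x) / 2)

/-- The value `(α^m ∧ η) (v_0, …, v_{2m})`. -/
def DiffForm.powWedge (m : ℕ) (α : DiffForm H M 2) (η : DiffForm H M 1) (x : M)
    (v : Fin (2 * m + 1) → TangentSpace 𝓘(ℝ, H) x) : ℝ :=
  (2 ^ m : ℝ)⁻¹ * ∑ σ : Equiv.Perm (Fin (2 * m + 1)), ((Equiv.Perm.sign σ : ℤ) : ℝ) *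
    ((∏ i : Fin m, α x ![v (σ ⟨2 * i, by omega⟩), v (σ ⟨2 * i + 1, by omega⟩)]) *
      η x ![v (σ (Fin.last (2 * m)))])

/-- `(α, η)` is a cosymplectic structure on the `(2m+1)`-dimensional manifold `M`. -/
structure IsCosymplectic (m : ℕ) (α : DiffForm H M 2) (η : DiffForm H M 1) : Prop where
  finrank_eq : Module.finrank ℝ H = 2 * m + 1
  smooth_two : DiffForm.IsSmooth α
  smooth_one : DiffForm.IsSmooth η
  closed_two : DiffForm.d α = fun _ => 0
  closed_one : DiffForm.d η = fun _ => 0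
  volume : ∀ x : M, ∃ v, DiffForm.powWedge m α η x v ≠ 0

end Forms

section Ostrogradsky

variable {n N : ℕ} {W : Type*} [NormedAddCommGroup W] [NormedSpace ℝ W]

/-- The coordinate `q_i` (zero for `i > N`). -/
def qCoord (i : ℕ) (z : JetModel n N) : Fib n := if h : i < N + 1 then z.2 ⟨i, h⟩ else 0

/-- The coordinate directions `∂/∂q_i^A` (zero for `i > N`). -/
def qDirection (n N i : ℕ) : Fib n →L[ℝ] JetModel n N :=
  if h : i < N + 1 then (ContinuousLinearMap.inr ℝ ℝ (Fin (N + 1) → Fib n)).comp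
    (ContinuousLinearMap.single ℝ (fun _ : Fin (N + 1) => Fib n) ⟨i, h⟩) else 0

/-- The partial derivatives `∂F/∂q_i^A`, as a covector in `A`. -/
def partialQ (F : JetModel n N → ℝ) (i : ℕ) (z : JetModel n N) : Fib n →L[ℝ] ℝ :=
  (fderiv ℝ F z).comp (qDirection n N i)

/-- The total time derivative `d_T f = ∂f/∂t + ∑ q_{i+1}^A ∂f/∂q_i^A`. A function of jets of order
`s` is seen as a function on jets of a fixed higher order `N`; for `s < N` the terms on the right
only involve coordinates of order at most `N`. -/
def totalDeriv (f : JetModel n N → W) (z : JetModel n N) : W :=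
  fderiv ℝ f z (1, fun i : Fin (N + 1) => qCoord (i + 1) z)

/-- The Jacobi-Ostrogradsky momenta
`p^s = ∑_{i=0}^{k-s-1} (-1)^i d_T^i (∂L/∂q_{s+1+i})`, `0 ≤ s ≤ k - 1`. -/
def momentum (k : ℕ) (F : JetModel n N → ℝ) (s : ℕ) (z : JetModel n N) : Fib n →L[ℝ] ℝ :=
  ∑ i ∈ Finset.range (k - s), (-1 : ℝ) ^ i • totalDeriv^[i] (partialQ F (s + 1 + i)) z

/-- The covector `p dt + ∑_{s<k} p^s dq_s` in the coordinates of `J^{k-1} π`, where `p^s` are the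
momenta and `p = L - ∑_{s<k} p^s q_{s+1}`. -/
def legendreCovector (k : ℕ) (F : JetModel n N → ℝ) (z : JetModel n N) :
    JetModel n (k - 1) →L[ℝ] ℝ :=
  (F z - ∑ s ∈ Finset.range k, momentum k F s z (qCoord (s + 1) z)) •
      ContinuousLinearMap.fst ℝ ℝ (Fin (k - 1 + 1) → Fib n) +
    ∑ s : Fin (k - 1 + 1), ((momentum k F s z).comp (ContinuousLinearMap.proj s)).comp
      (ContinuousLinearMap.snd ℝ ℝ (Fin (k - 1 + 1) → Fib n))

end Ostrogradsky

section Lagrangian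

variable {n : ℕ} {E : Type*} [TopologicalSpace E]
  [ChartedSpace (EuclideanSpace ℝ (Fin (n + 1))) E] [IsManifold (𝓡 (n + 1)) ∞ E]
  {π : E → ℝ} [hπ : IsBundleOverLine n π] {k : ℕ}

/-- The coordinate expression on `J^{2k-1} π` of a `k`-th order Lagrangian function. -/
def AdaptedChart.lagrangian (e : AdaptedChart n π) (L : Jet n π k → ℝ)
    (z : JetModel n (2 * k - 1)) : ℝ :=
  L (e.ofCoords (z.1, fun i : Fin (k + 1) => qCoord i z))

/-- The projection `J^{2k-1} π → J^{k-1} π`. -/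
def Jet.lower (y : Jet n π (2 * k - 1)) : Jet n π (k - 1) := y.proj (by omega)

/-- The extended Legendre-Ostrogradsky map in the coordinates induced by an adapted chart. -/
def AdaptedChart.legendre (e : AdaptedChart n π) (L : Jet n π k → ℝ) (y : Jet n π (2 * k - 1)) :
    JetCotangent n π (k - 1) :=
  ⟨y.lower, (legendreCovector k (e.lagrangian L) (e.coords (2 * k - 1) y)).comp
    (e.tangentMap y.lower)⟩

/-- The extended Legendre-Ostrogradsky map `J^{2k-1} π → T^*(J^{k-1} π)`, given locally by
`p^s = ∑ (-1)^i d_T^i (∂L/∂q_{s+1+i})` and `p = L - ∑ p^s q_{s+1}` in any adapted chart. -/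
def extendedLegendre (L : Jet n π k → ℝ) (y : Jet n π (2 * k - 1)) : JetCotangent n π (k - 1) :=
  (adaptedChartAt n π y.pt).legendre L y

/-- The restricted Legendre-Ostrogradsky map `J^{2k-1} π → J^{k-1} π^*`. -/
def restrictedLegendre (L : Jet n π k → ℝ) (y : Jet n π (2 * k - 1)) :
    RestrictedDual n π (k - 1) :=
  (extendedLegendre L y).toRestricted

/-- The Poincaré-Cartan `1`-form on `J^{2k-1} π`, i.e. the pull-back of the tautological form of
`T^*(J^{k-1} π)` by the extended Legendre-Ostrogradsky map. -/
def poincareCartanOne (L : Jet n π k → ℝ) :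
    DiffForm (JetModel n (2 * k - 1)) (Jet n π (2 * k - 1)) 1 :=
  oneForm fun y => ContinuousLinearMap.comp (extendedLegendre L y).snd
    (mfderiv 𝓘(ℝ, JetModel n (2 * k - 1)) 𝓘(ℝ, JetModel n (k - 1)) Jet.lower y)

/-- The Poincaré-Cartan `2`-form `-dΘ`. -/
def poincareCartanTwo (L : Jet n π k → ℝ) :
    DiffForm (JetModel n (2 * k - 1)) (Jet n π (2 * k - 1)) 2 :=
  fun y => -DiffForm.d (poincareCartanOne L) y

variable (n π k) in
/-- The pull-back of `η = dt` to `J^{2k-1} π`. -/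
def timeForm : DiffForm (JetModel n (2 * k - 1)) (Jet n π (2 * k - 1)) 1 :=
  oneForm fun y => y.dt

end Lagrangian

end

set_option linter.unusedSectionVars false

noncomputable section

/-! All the conditions are compared with one pointwise property, `IsRegularAt`: the differentials of
`t`, of `q_0, …, q_{k-1}` and of the momenta `p^0, …, p^{k-1}` have no common kernel. These are `2kn
+ 1` scalar forms on a space of dimension `2kn + 1`, so regularity says that they form a coframe.

In jet coordinates the Poincaré-Cartan form is `Θ = L dt + ∑ p^s ω_s`, with contact forms `ω_s =
dq_s - q_{s+1} dt`. The recursion `∂L/∂q_{s+1} = p^s + d_T p^{s+1}` (`partialQ_succ_eq`) turns its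
differential into `∑ (dp^s - r_s dt) ∧ ω_s`, where `r_s = d_T p^s` for `s > 0` and `r_0 = ∂L/∂q_0`
(`fderiv_cartanForm_sub`). Thus `Ω` has Darboux shape in the forms `ω_s`, `dp^s - r_s dt`, which
together with `dt` form a coframe exactly at regular points (`injective_darbouxMap_iff`). There
`Ω^{kn} ∧ dt ≠ 0` and `Ω` has rank `2kn`. At any other point a nonzero vector annihilates both `dt`
and `Ω`, which kills the volume form. The two Legendre maps are handled by the inverse function
theorem: each of their local representatives has injective derivative exactly at the regular points.

The converse from the rank needs `k ≥ 2`. At a degenerate point the Hessian `∂²L/∂q_k∂q_k` has a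
null vector `a` (`isRegularAt_of_injective`). The velocity `(1, q_1, …, q_N, 0)`, the direction `a`
in `q_{2k-2}` and all directions in `q_{2k-1}` span a space of dimension `n + 2`. Every `ω_s` with
`s < k` and every `dp^s - r_s dt` with `0 < s < k` vanishes on it. The remaining `n` components,
those with `s = 0`, leave a kernel of `Ω` of dimension at least `2`, so the rank drops below `2kn`
(`two_le_finrank_ker`). For `k = 1` this fails: with `n = 1` and `L = q` one gets `Ω = -dq ∧ dt`, of
rank `2`, although `p^0 = 0`.

All of this is local, while the Legendre map is defined with a chart that varies with the point.
Chart independence comes from the transformation laws of momenta and contact forms under prolonged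
changes of coordinates, which are transposes of each other (`momentum_prolong`,
`cartanForm_prolong`). -/

lemma two_le_infty : (2 : WithTop ℕ∞) ≤ ∞ := by
  change ((2 : ℕ∞) : WithTop ℕ∞) ≤ ((⊤ : ℕ∞) : WithTop ℕ∞)
  exact WithTop.coe_le_coe.2 le_top

/-! ### Coordinate calculus of the total derivative and the order of a function. -/

section JetCalculus

variable {n N : ℕ} {W W' : Type*} [NormedAddCommGroup W] [NormedSpace ℝ W]
  [NormedAddCommGroup W'] [NormedSpace ℝ W']

/-- The velocity `(1, q_1, …, q_N, 0)` along which the total time derivative differentiates. -/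
def jetVelocity (z : JetModel n N) : JetModel n N :=
  (1, fun i : Fin (N + 1) => qCoord (i + 1) z)

/-- The function `f` depends only on the coordinates `t, q_0, …, q_m`. -/
def IndepAbove (m : ℕ) (f : JetModel n N → W) : Prop :=
  ∀ z d : JetModel n N, d.1 = 0 → (∀ i, i ≤ m → qCoord i d = 0) → f (z + d) = f z

lemma qCoord_add (i : ℕ) (z d : JetModel n N) : qCoord i (z + d) = qCoord i z + qCoord i d := by
  unfold qCoord; split_ifs <;> simp

lemma qCoord_smul (i : ℕ) (c : ℝ) (z : JetModel n N) : qCoord i (c • z) = c • qCoord i z := by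
  unfold qCoord; split_ifs <;> simp

/-- The coordinate `q_i` as a continuous linear map. -/
def qCoordL (n N i : ℕ) : JetModel n N →L[ℝ] Fib n :=
  if h : i < N + 1 then (ContinuousLinearMap.proj (R := ℝ) (φ := fun _ : Fin (N + 1) => Fib n)
    ⟨i, h⟩).comp (ContinuousLinearMap.snd ℝ ℝ _) else 0

@[simp] lemma qCoordL_apply (i : ℕ) (z : JetModel n N) : qCoordL n N i z = qCoord i z := by
  unfold qCoordL qCoord; split_ifs <;> rfl

lemma contDiff_qCoord (i : ℕ) : ContDiff ℝ ∞ (qCoord (n := n) (N := N) i) := by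
  have : qCoord (n := n) (N := N) i = qCoordL n N i := by ext1 z; simp
  rw [this]; exact (qCoordL n N i).contDiff

lemma contDiff_jetVelocity : ContDiff ℝ ∞ (jetVelocity (n := n) (N := N)) :=
  contDiff_const.prodMk (contDiff_pi.2 fun _ => contDiff_qCoord _)

@[simp] lemma qCoord_fin (i : Fin (N + 1)) (z : JetModel n N) : qCoord (i : ℕ) z = z.2 i :=
  dif_pos i.2

lemma qCoord_of_lt {i : ℕ} (h : i < N + 1) (z : JetModel n N) : qCoord i z = z.2 ⟨i, h⟩ := by
  simp [qCoord, h]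

lemma qCoord_jetVelocity {i : ℕ} (h : i < N + 1) (z : JetModel n N) :
    qCoord i (jetVelocity z) = qCoord (i + 1) z := by
  rw [qCoord_of_lt h]; rfl

@[simp] lemma qDirection_fst (i : ℕ) (a : Fib n) : (qDirection n N i a).1 = 0 := by
  unfold qDirection; split_ifs <;> simp

lemma qCoord_qDirection_self {i : ℕ} (h : i < N + 1) (a : Fib n) :
    qCoord i (qDirection n N i a) = a := by
  simp [qCoord, qDirection, h]

lemma qCoord_qDirection_of_ne {i j : ℕ} (h : i ≠ j) (a : Fib n) :
    qCoord i (qDirection n N j a) = 0 := by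
  unfold qCoord qDirection
  split_ifs with h1 h2
  · have : (⟨i, h1⟩ : Fin (N + 1)) ≠ ⟨j, h2⟩ := fun h' => h (congrArg Fin.val h')
    simp [Pi.single_eq_of_ne this]
  · simp
  · rfl

lemma jetModel_ext {z w : JetModel n N} (h1 : z.1 = w.1)
    (h2 : ∀ i < N + 1, qCoord i z = qCoord i w) : z = w := by
  refine Prod.ext h1 (funext fun i => ?_)
  simpa using h2 i i.2

/-- Decomposition of a vector along the coordinate directions. -/
lemma jetModel_decomp (v : JetModel n N) :
    v = v.1 • ((1 : ℝ), (0 : Fin (N + 1) → Fib n)) +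
      ∑ i ∈ Finset.range (N + 1), qDirection n N i (qCoord i v) := by
  refine jetModel_ext ?_ fun i hi => ?_
  · simp [Prod.fst_sum]
  · rw [qCoord_add, qCoord_smul, ← qCoordL_apply _ (∑ i ∈ _, _), map_sum, Finset.sum_eq_single i]
    · rw [qCoordL_apply, qCoord_qDirection_self hi]
      simp [qCoord_of_lt hi]
    · intro j _ hj
      rw [qCoordL_apply, qCoord_qDirection_of_ne hj.symm]
    · intro h; exact absurd (Finset.mem_range.2 hi) h

lemma apply_decomp (D : JetModel n N →L[ℝ] W) (v : JetModel n N) :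
    D v = v.1 • D (1, 0) +
      ∑ i ∈ Finset.range (N + 1), D (qDirection n N i (qCoord i v)) := by
  conv_lhs => rw [jetModel_decomp v]
  rw [map_add, map_smul, map_sum]

/-- Linear forms that vanish in the directions of order at least `m`. -/
lemma apply_decomp_of_le (D : JetModel n N →L[ℝ] W) {m : ℕ} (hm : m ≤ N + 1)
    (hD : ∀ i, m ≤ i → ∀ a, D (qDirection n N i a) = 0) (v : JetModel n N) :
    D v = v.1 • D (1, 0) + ∑ i ∈ Finset.range m, D (qDirection n N i (qCoord i v)) := by
  rw [apply_decomp D v]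
  congr 1
  refine (Finset.sum_subset (Finset.range_subset_range.2 hm) fun i _ hi => hD i ?_ _).symm
  simpa using hi

namespace IndepAbove

variable {m m' : ℕ} {f g : JetModel n N → W}

lemma mono (h : IndepAbove m f) (hm : m ≤ m') : IndepAbove m' f :=
  fun z d h1 h2 => h z d h1 fun i hi => h2 i (hi.trans hm)

lemma comp_left {α : Type*} [NormedAddCommGroup α] [NormedSpace ℝ α] (h : IndepAbove m f)
    (φ : W → α) : IndepAbove m (fun z => φ (f z)) :=
  fun z d h1 h2 => congrArg φ (h z d h1 h2)

lemma sum {ι : Type*} {s : Finset ι} {f : ι → JetModel n N → W}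
    (h : ∀ i ∈ s, IndepAbove m (f i)) : IndepAbove m (fun z => ∑ i ∈ s, f i z) :=
  fun z d h1 h2 => Finset.sum_congr rfl fun i hi => h i hi z d h1 h2

lemma fderiv_add (h : IndepAbove m f) (z d : JetModel n N) (h1 : d.1 = 0)
    (h2 : ∀ i, i ≤ m → qCoord i d = 0) : fderiv ℝ f (z + d) = fderiv ℝ f z := by
  rw [← fderiv_comp_add_right]
  congr 1
  ext1 w
  exact h w d h1 h2

lemma fderiv (h : IndepAbove m f) : IndepAbove m (fderiv ℝ f) :=
  fun z d h1 h2 => h.fderiv_add z d h1 h2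

/-- The function is constant along the line `z + t d`. -/
lemma fderiv_apply_eq_zero (h : IndepAbove m f) (z d : JetModel n N) (h1 : d.1 = 0)
    (h2 : ∀ i, i ≤ m → qCoord i d = 0) : _root_.fderiv ℝ f z d = 0 := by
  by_cases hf : DifferentiableAt ℝ f z
  · have hc : HasDerivAt (fun t : ℝ => z + t • d) d 0 := by
      simpa using ((hasDerivAt_id (0 : ℝ)).smul_const d).const_add z
    have hf' : HasFDerivAt f (_root_.fderiv ℝ f z) (z + (0 : ℝ) • d) := by
      simpa using hf.hasFDerivAt
    have h3 := hf'.comp_hasDerivAt (0 : ℝ) hc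
    have h4 : (f ∘ fun t : ℝ => z + t • d) = fun _ => f z := by
      ext1 t
      refine h z (t • d) (by simp [h1]) fun i hi => ?_
      rw [qCoord_smul, h2 i hi, smul_zero]
    rw [h4] at h3
    exact h3.unique (hasDerivAt_const _ _)
  -- At points of non-differentiability the derivative is zero by convention, so no smoothness is
  -- needed.
  · simp [fderiv_zero_of_not_differentiableAt hf]

lemma fderiv_qDirection (h : IndepAbove m f) {i : ℕ} (hi : m < i) (z : JetModel n N)
    (a : Fib n) : _root_.fderiv ℝ f z (qDirection n N i a) = 0 :=
  h.fderiv_apply_eq_zero z _ (qDirection_fst i a) fun _ hj =>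
    qCoord_qDirection_of_ne (by omega) a

/-- The derivative of `f` only sees the components of the velocity of order at most `m`, and these
are `q_1, …, q_{m+1}`. -/
lemma totalDeriv (h : IndepAbove m f) : IndepAbove (m + 1) (totalDeriv f) := by
  intro z d h1 h2
  change _root_.fderiv ℝ f (z + d) (jetVelocity (z + d)) = _root_.fderiv ℝ f z (jetVelocity z)
  rw [h.fderiv_add z d h1 fun i hi => h2 i (by omega), ← sub_eq_zero, ← map_sub]
  refine h.fderiv_apply_eq_zero z _ (by simp [jetVelocity]) fun i hi => ?_
  by_cases hN : i < N + 1
  · rw [qCoord_of_lt hN]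
    simp [jetVelocity, qCoord_add, h2 (i + 1) (by omega)]
  · simp [qCoord, hN]

lemma iterate_totalDeriv (h : IndepAbove m f) (i : ℕ) :
    IndepAbove (m + i) (_root_.totalDeriv^[i] f) := by
  induction i with
  | zero => exact h
  | succ i ih => rw [Function.iterate_succ_apply']; exact ih.totalDeriv

end IndepAbove

lemma totalDeriv_eq (f : JetModel n N → W) (z : JetModel n N) :
    totalDeriv f z = fderiv ℝ f z (jetVelocity z) := rfl

lemma jetVelocity_add_smul_qDirection (z : JetModel n N) (c : ℝ) (s : ℕ) (hs : s + 1 ≤ N)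
    (a : Fib n) : jetVelocity (z + c • qDirection n N (s + 1) a) =
      jetVelocity z + c • qDirection n N s a := by
  refine jetModel_ext (by simp [jetVelocity]) fun i hi => ?_
  rw [qCoord_jetVelocity hi, qCoord_add, qCoord_add, qCoord_jetVelocity hi, qCoord_smul,
    qCoord_smul]
  by_cases h : i = s
  · subst h
    rw [qCoord_qDirection_self hi, qCoord_qDirection_self (by omega)]
  · rw [qCoord_qDirection_of_ne h, qCoord_qDirection_of_ne (by omega)]

/-- The top-order derivative of a total derivative. -/
lemma fderiv_totalDeriv_top {m : ℕ} {f : JetModel n N → W} (h : IndepAbove m f) (hm : m + 1 ≤ N)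
    {z : JetModel n N} (hf : DifferentiableAt ℝ (totalDeriv f) z) (a : Fib n) :
    fderiv ℝ (totalDeriv f) z (qDirection n N (m + 1) a) =
      fderiv ℝ f z (qDirection n N m a) := by
  have hc : HasDerivAt (fun t : ℝ => z + t • qDirection n N (m + 1) a)
      (qDirection n N (m + 1) a) 0 := by
    simpa using ((hasDerivAt_id (0 : ℝ)).smul_const (qDirection n N (m + 1) a)).const_add z
  have hf' : HasFDerivAt (totalDeriv f) (fderiv ℝ (totalDeriv f) z)
      (z + (0 : ℝ) • qDirection n N (m + 1) a) := by simpa using hf.hasFDerivAt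
  have h3 := hf'.comp_hasDerivAt (0 : ℝ) hc
  have h4 : (totalDeriv f ∘ fun t : ℝ => z + t • qDirection n N (m + 1) a) =
      fun t => totalDeriv f z + t • fderiv ℝ f z (qDirection n N m a) := by
    ext1 t
    simp only [Function.comp, totalDeriv_eq]
    rw [h.fderiv_add z _ (by simp) fun i hi => by
      rw [qCoord_smul, qCoord_qDirection_of_ne (by omega), smul_zero],
      jetVelocity_add_smul_qDirection _ _ _ hm, map_add, map_smul]
  rw [h4] at h3
  have h5 : HasDerivAt (fun t : ℝ => totalDeriv f z + t • fderiv ℝ f z (qDirection n N m a))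
      (fderiv ℝ f z (qDirection n N m a)) 0 := by
    simpa using ((hasDerivAt_id (0 : ℝ)).smul_const
      (fderiv ℝ f z (qDirection n N m a))).const_add (totalDeriv f z)
  exact h3.unique h5

/-! ### Smoothness, top-order derivatives and the commutator of `d_T` with `∂/∂q`. -/

section Smooth

variable {U : Set (JetModel n N)} {f : JetModel n N → W}

lemma ContDiffOn.totalDeriv (hU : IsOpen U) (hf : ContDiffOn ℝ ∞ f U) :
    ContDiffOn ℝ ∞ (totalDeriv f) U :=
  (hf.fderiv_of_isOpen hU (m := ∞) (by simp)).clm_apply contDiff_jetVelocity.contDiffOn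

lemma ContDiffOn.iterate_totalDeriv (hU : IsOpen U) (hf : ContDiffOn ℝ ∞ f U) (i : ℕ) :
    ContDiffOn ℝ ∞ (_root_.totalDeriv^[i] f) U := by
  induction i with
  | zero => exact hf
  | succ i ih => rw [Function.iterate_succ_apply']; exact ih.totalDeriv hU

lemma ContDiffOn.partialQ {F : JetModel n N → ℝ} (hU : IsOpen U) (hF : ContDiffOn ℝ ∞ F U)
    (i : ℕ) : ContDiffOn ℝ ∞ (partialQ F i) U :=
  (hF.fderiv_of_isOpen hU (m := ∞) (by simp)).clm_comp contDiffOn_const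

lemma ContDiffOn.momentum {F : JetModel n N → ℝ} (hU : IsOpen U) (hF : ContDiffOn ℝ ∞ F U)
    (k s : ℕ) : ContDiffOn ℝ ∞ (momentum k F s) U :=
  ContDiffOn.sum fun i _ => (((hF.partialQ hU _).iterate_totalDeriv hU i).const_smul _)

lemma ContDiffOn.differentiableAt_of_isOpen (hU : IsOpen U) (hf : ContDiffOn ℝ ∞ f U)
    {z : JetModel n N} (hz : z ∈ U) : DifferentiableAt ℝ f z :=
  (hf.contDiffAt (hU.mem_nhds hz)).differentiableAt (by simp)

lemma fderiv_iterate_totalDeriv_top (hU : IsOpen U) (hf : ContDiffOn ℝ ∞ f U) {m : ℕ}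
    (h : IndepAbove m f) (i : ℕ) (hi : m + i ≤ N) {z : JetModel n N} (hz : z ∈ U) (a : Fib n) :
    fderiv ℝ (totalDeriv^[i] f) z (qDirection n N (m + i) a) =
      fderiv ℝ f z (qDirection n N m a) := by
  induction i with
  | zero => rfl
  | succ i ih =>
    have hs := hf.iterate_totalDeriv hU (i + 1)
    rw [Function.iterate_succ_apply'] at hs ⊢
    rw [← ih (by omega)]
    exact fderiv_totalDeriv_top (h.iterate_totalDeriv i) (by omega)
      (hs.differentiableAt_of_isOpen hU hz) a

/-- The commutator of the total derivative with a coordinate derivative. -/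
lemma fderiv_totalDeriv_qDirection (hU : IsOpen U) (hf : ContDiffOn ℝ ∞ f U) {s : ℕ}
    (hs : s + 1 ≤ N) {z : JetModel n N} (hz : z ∈ U) (a : Fib n) :
    fderiv ℝ (totalDeriv f) z (qDirection n N (s + 1) a) =
      totalDeriv (fun w => fderiv ℝ f w (qDirection n N (s + 1) a)) z +
        fderiv ℝ f z (qDirection n N s a) := by
  have hd : DifferentiableAt ℝ (fderiv ℝ f) z :=
    (hf.fderiv_of_isOpen hU (m := ∞) (by simp)).differentiableAt_of_isOpen hU hz
  have hv : DifferentiableAt ℝ (jetVelocity (n := n) (N := N)) z :=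
    contDiff_jetVelocity.differentiable (by simp) z
  -- The coordinate `q_{s+1}` is the component of order `s` of the velocity. This is the source of
  -- the commutator term; the rest is symmetry of the second derivative.
  have hv' : fderiv ℝ jetVelocity z (qDirection n N (s + 1) a) = qDirection n N s a := by
    have hc : HasDerivAt (fun t : ℝ => z + t • qDirection n N (s + 1) a)
        (qDirection n N (s + 1) a) 0 := by
      simpa using ((hasDerivAt_id (0 : ℝ)).smul_const (qDirection n N (s + 1) a)).const_add z
    have h1 : HasFDerivAt jetVelocity (fderiv ℝ jetVelocity z)
      (z + (0 : ℝ) • qDirection n N (s + 1) a) := by simpa using hv.hasFDerivAt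
    have h2 := h1.comp_hasDerivAt (0 : ℝ) hc
    have h3 : HasDerivAt (jetVelocity ∘ fun t : ℝ => z + t • qDirection n N (s + 1) a)
        (qDirection n N s a) 0 := by
      have : (jetVelocity ∘ fun t : ℝ => z + t • qDirection n N (s + 1) a) =
          fun t => jetVelocity z + t • qDirection n N s a :=
        funext fun t => jetVelocity_add_smul_qDirection z t s hs a
      rw [this]
      simpa using ((hasDerivAt_id (0 : ℝ)).smul_const (qDirection n N s a)).const_add
        (jetVelocity z)
    exact h2.unique h3
  have hsymm : IsSymmSndFDerivAt ℝ f z :=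
    (hf.contDiffAt (hU.mem_nhds hz)).isSymmSndFDerivAt (by simpa using two_le_infty)
  have e1 : totalDeriv f = fun w => fderiv ℝ f w (jetVelocity w) := rfl
  rw [e1, fderiv_clm_apply hd hv, totalDeriv_eq, fderiv_clm_apply hd (by fun_prop)]
  simp only [add_apply, ContinuousLinearMap.comp_apply,
    ContinuousLinearMap.flip_apply, hv', fderiv_fun_const]
  rw [hsymm.eq, add_comm]
  simp

end Smooth

/-! ### Order, recursion and top derivatives of the Ostrogradsky momenta. -/

section Momenta

variable {k : ℕ} {F : JetModel n N → ℝ} {U : Set (JetModel n N)}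

lemma IndepAbove.partialQ (h : IndepAbove k F) (i : ℕ) : IndepAbove k (partialQ F i) :=
  h.fderiv.comp_left fun D => D.comp (qDirection n N i)

lemma momentum_eq_zero {s : ℕ} (hs : k ≤ s) : momentum k F s = 0 := by
  ext1 z
  simp [momentum, Nat.sub_eq_zero_of_le hs]

/-- The summand of index `i` is the `i`-th total derivative of a function of order `k`, and `i ≤ k -
1 - s`. These sharp orders give the derivatives of the momenta a triangular structure. -/
lemma momentum_indepAbove (h : IndepAbove k F) {s : ℕ} (hs : s < k) :
    IndepAbove (2 * k - 1 - s) (momentum k F s) :=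
  IndepAbove.sum fun i hi => by
    have := Finset.mem_range.1 hi
    exact (((h.partialQ _).iterate_totalDeriv i).comp_left fun w => (-1 : ℝ) ^ i • w).mono
      (by omega)

/-- The recursion `∂L/∂q_{s+1} = p^s + d_T p^{s+1}`. -/
lemma partialQ_succ_eq (hU : IsOpen U) (hF : ContDiffOn ℝ ∞ F U) {s : ℕ} (hs : s < k)
    {z : JetModel n N} (hz : z ∈ U) :
    partialQ F (s + 1) z = momentum k F s z + totalDeriv (momentum k F (s + 1)) z := by
  obtain ⟨r, hr⟩ : ∃ r, k - s = r + 1 := ⟨k - s - 1, by omega⟩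
  have hr' : k - (s + 1) = r := by omega
  have hd : ∀ i, DifferentiableAt ℝ (totalDeriv^[i] (partialQ F (s + 1 + 1 + i))) z := fun i =>
    ((hF.partialQ hU _).iterate_totalDeriv hU i).differentiableAt_of_isOpen hU hz
  have h1 : totalDeriv (momentum k F (s + 1)) z = ∑ i ∈ Finset.range r,
      (-1 : ℝ) ^ i • totalDeriv^[i + 1] (partialQ F (s + 1 + 1 + i)) z := by
    have e : momentum k F (s + 1) = fun z => ∑ i ∈ Finset.range r,
        (-1 : ℝ) ^ i • totalDeriv^[i] (partialQ F (s + 1 + 1 + i)) z := by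
      ext1 z; rw [momentum, hr']
    rw [e, totalDeriv_eq, fderiv_fun_sum fun i _ => (hd i).fun_const_smul _]
    simp only [sum_apply]
    refine Finset.sum_congr rfl fun i _ => ?_
    rw [fderiv_fun_const_smul (hd i), Function.iterate_succ_apply']
    rfl
  -- The summand `i = 0` of `p^s` is `∂L/∂q_{s+1}`; the others are, up to sign, those of `d_T
  -- p^{s+1}` shifted by one.
  rw [h1, momentum, hr, Finset.sum_range_succ']
  simp only [pow_zero, one_smul, add_zero, Function.iterate_zero, id, pow_succ]
  rw [add_right_comm, ← Finset.sum_add_distrib, Finset.sum_eq_zero, zero_add]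
  intro i _
  rw [show s + 1 + (i + 1) = s + 1 + 1 + i by omega]
  ext a
  simp only [mul_neg_one, add_apply, smul_apply, smul_eq_mul, zero_apply]
  ring

/-- The derivatives of the momenta of highest order are given by the Hessian of `L`. -/
lemma fderiv_momentum_top (hU : IsOpen U) (hF : ContDiffOn ℝ ∞ F U) (h : IndepAbove k F)
    {s : ℕ} (hs : s < k) (hN : 2 * k ≤ N + 1) {z : JetModel n N} (hz : z ∈ U) (a : Fib n) :
    fderiv ℝ (momentum k F s) z (qDirection n N (2 * k - 1 - s) a) =
      (-1 : ℝ) ^ (k - 1 - s) • fderiv ℝ (partialQ F k) z (qDirection n N k a) := by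
  have hd : ∀ i, DifferentiableAt ℝ (totalDeriv^[i] (partialQ F (s + 1 + i))) z := fun i =>
    ((hF.partialQ hU _).iterate_totalDeriv hU i).differentiableAt_of_isOpen hU hz
  have e : momentum k F s = fun z => ∑ i ∈ Finset.range (k - s),
        (-1 : ℝ) ^ i • totalDeriv^[i] (partialQ F (s + 1 + i)) z := rfl
  rw [e, fderiv_fun_sum fun i _ => (hd i).fun_const_smul _]
  simp only [sum_apply]
  -- Only the last summand reaches the order `2k - 1 - s`.
  rw [Finset.sum_eq_single (k - 1 - s)]
  · rw [fderiv_fun_const_smul (hd _), smul_apply]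
    congr 1
    rw [show s + 1 + (k - 1 - s) = k by omega, show 2 * k - 1 - s = k + (k - 1 - s) by omega]
    exact fderiv_iterate_totalDeriv_top hU (hF.partialQ hU k) (h.partialQ k) _ (by omega) hz a
  · intro i hi hne
    have := Finset.mem_range.1 hi
    rw [fderiv_fun_const_smul (hd _), smul_apply,
      ((h.partialQ _).iterate_totalDeriv i).fderiv_qDirection (by omega), smul_zero]
  · intro hi
    exact absurd (Finset.mem_range.2 (by omega)) hi

end Momenta

end JetCalculus

/-! ### The Poincaré-Cartan form in coordinates, its differential, and regularity. -/

section PoincareCartan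

variable {n N k : ℕ} {F : JetModel n N → ℝ} {U : Set (JetModel n N)}

/-- The projection forgetting the coordinates of order greater than `M`. -/
def truncL (n N M : ℕ) : JetModel n N →L[ℝ] JetModel n M :=
  (ContinuousLinearMap.fst ℝ ℝ _).prod
    (ContinuousLinearMap.pi fun i : Fin (M + 1) => qCoordL n N i)

@[simp] lemma truncL_fst (M : ℕ) (v : JetModel n N) : (truncL n N M v).1 = v.1 := rfl

@[simp] lemma truncL_snd (M : ℕ) (v : JetModel n N) (i : Fin (M + 1)) :
    (truncL n N M v).2 i = qCoord i v := by simp [truncL]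

lemma qCoord_truncL {M i : ℕ} (hi : i < M + 1) (v : JetModel n N) :
    qCoord i (truncL n N M v) = qCoord i v := by
  rw [qCoord_of_lt hi, truncL_snd]

lemma truncL_surjective {M : ℕ} (h : M ≤ N) : Function.Surjective (truncL n N M) := fun w => by
  refine ⟨(w.1, fun i => qCoord i w), jetModel_ext rfl fun i hi => ?_⟩
  rw [qCoord_truncL hi, qCoord_of_lt (show i < N + 1 by omega)]

/-- The contact forms `dq_s - q_{s+1} dt`. -/
def contactForm (s : ℕ) (z : JetModel n N) : JetModel n N →L[ℝ] Fib n :=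
  qCoordL n N s - (ContinuousLinearMap.fst ℝ ℝ _).smulRight (qCoord (s + 1) z)

lemma contactForm_apply (s : ℕ) (z v : JetModel n N) :
    contactForm s z v = qCoord s v - v.1 • qCoord (s + 1) z := by
  simp [contactForm]

/-- The Poincaré-Cartan form `∑ p^s dq_s + (L - ∑ p^s q_{s+1}) dt` in jet coordinates. -/
def cartanForm (k : ℕ) (F : JetModel n N → ℝ) (z : JetModel n N) : JetModel n N →L[ℝ] ℝ :=
  (legendreCovector k F z).comp (truncL n N (k - 1))

/-- The term `-∑ p^s q_{s+1} dt` combines with `∑ p^s dq_s` into contact forms. In the form `Θ = L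
dt + ∑ p^s ω_s` both the differential and the change of coordinates can be computed. -/
lemma cartanForm_apply (hk : 1 ≤ k) (z v : JetModel n N) :
    cartanForm k F z v =
      v.1 * F z + ∑ s ∈ Finset.range k, momentum k F s z (contactForm s z v) := by
  have h1 : ∀ s, momentum k F s z (contactForm s z v) = momentum k F s z (qCoord s v) -
      v.1 * momentum k F s z (qCoord (s + 1) z) := fun s => by
    rw [contactForm_apply, map_sub, map_smul, smul_eq_mul]
  have h2 : ∑ s : Fin (k - 1 + 1), momentum k F s z (qCoord s v) =
      ∑ s ∈ Finset.range k, momentum k F s z (qCoord s v) := by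
    rw [Fin.sum_univ_eq_sum_range (fun s => momentum k F s z (qCoord s v)), Nat.sub_add_cancel hk]
  simp only [h1, Finset.sum_sub_distrib, ← Finset.mul_sum, ← h2]
  simp only [cartanForm, legendreCovector, ContinuousLinearMap.comp_apply, add_apply, smul_apply,
    ContinuousLinearMap.coe_fst', truncL_fst, sum_apply, ContinuousLinearMap.coe_snd',
    ContinuousLinearMap.proj_apply, truncL_snd, smul_eq_mul]
  ring

lemma ContDiffOn.legendreCovector (hU : IsOpen U) (hF : ContDiffOn ℝ ∞ F U) (k : ℕ) :
    ContDiffOn ℝ ∞ (legendreCovector k F) U := by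
  unfold _root_.legendreCovector
  refine ContDiffOn.add (ContDiffOn.smul (hF.sub (ContDiffOn.sum fun s _ =>
    (hF.momentum hU k s).clm_apply (contDiff_qCoord _).contDiffOn)) contDiffOn_const)
    (ContDiffOn.sum fun s _ => ((hF.momentum hU k s).clm_comp contDiffOn_const).clm_comp
      contDiffOn_const)

lemma ContDiffOn.cartanForm (hU : IsOpen U) (hF : ContDiffOn ℝ ∞ F U) (k : ℕ) :
    ContDiffOn ℝ ∞ (cartanForm k F) U :=
  (hF.legendreCovector hU k).clm_comp contDiffOn_const

/-- The total derivatives of the momenta on solutions of the Euler-Lagrange equation: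
`∂L/∂q_0` for `s = 0` and `d_T p^s` for `s > 0`. -/
def momentumRate (k : ℕ) (F : JetModel n N → ℝ) (s : ℕ) (z : JetModel n N) : Fib n →L[ℝ] ℝ :=
  if s = 0 then partialQ F 0 z else totalDeriv (momentum k F s) z

/-- By the recursion, the part `p^s` of `∂L/∂q_{s+1}` cancels and `d_T p^{s+1}` remains. Putting
`∂L/∂q_0` as the rate of order zero makes this an identity at all jets, with no use of the
Euler-Lagrange equation. -/
lemma fderiv_sub_sum_momentum (hU : IsOpen U) (hF : ContDiffOn ℝ ∞ F U) (h : IndepAbove k F)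
    (hk : 1 ≤ k) (hN : k ≤ N) {z : JetModel n N} (hz : z ∈ U) (u : JetModel n N) :
    fderiv ℝ F z u - ∑ s ∈ Finset.range k, momentum k F s z (qCoord (s + 1) u) =
      u.1 * fderiv ℝ F z (1, 0) +
        ∑ s ∈ Finset.range k, momentumRate k F s z (qCoord s u) := by
  rw [apply_decomp_of_le (fderiv ℝ F z) (m := k + 1) (by omega)
    (fun i hi a => h.fderiv_qDirection (by omega) z a) u, Finset.sum_range_succ']
  have h1 : ∀ s ∈ Finset.range k, fderiv ℝ F z (qDirection n N (s + 1) (qCoord (s + 1) u)) =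
      momentum k F s z (qCoord (s + 1) u) + momentumRate k F (s + 1) z (qCoord (s + 1) u) := by
    intro s hs
    have := congrArg (fun D : Fib n →L[ℝ] ℝ => D (qCoord (s + 1) u))
      (partialQ_succ_eq hU hF (Finset.mem_range.1 hs) hz)
    simpa [momentumRate, partialQ] using this
  -- Since `p^k = 0`, the rate of order `k` vanishes and the sum may be extended to match the `k +
  -- 1` partial derivatives of `L`.
  have h2 : ∑ s ∈ Finset.range k, momentumRate k F s z (qCoord s u) =
      ∑ s ∈ Finset.range (k + 1), momentumRate k F s z (qCoord s u) := by
    rw [Finset.sum_range_succ]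
    simp [momentumRate, (show k ≠ 0 by omega), momentum_eq_zero (le_refl k), totalDeriv_eq]
  rw [Finset.sum_congr rfl h1, Finset.sum_add_distrib, h2, Finset.sum_range_succ']
  have h3 : momentumRate k F 0 z (qCoord 0 u) = fderiv ℝ F z (qDirection n N 0 (qCoord 0 u)) := by
    simp [momentumRate, partialQ]
  rw [h3, smul_eq_mul]
  ring

/-- Product rule on `L dt + ∑ p^s ω_s`: the derivative of `ω_s` contributes `-p^s dq_{s+1}`, which
joins `dL` in the coefficient of `dt`. -/
lemma fderiv_cartanForm (hU : IsOpen U) (hF : ContDiffOn ℝ ∞ F U) (h : IndepAbove k F)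
    (hk : 1 ≤ k) (hN : k ≤ N) {z : JetModel n N} (hz : z ∈ U) (u v : JetModel n N) :
    fderiv ℝ (cartanForm k F) z u v =
      ∑ s ∈ Finset.range k, fderiv ℝ (momentum k F s) z u (contactForm s z v) +
        v.1 * (u.1 * fderiv ℝ F z (1, 0) +
          ∑ s ∈ Finset.range k, momentumRate k F s z (qCoord s u)) := by
  have hd := (hF.cartanForm hU k).differentiableAt_of_isOpen hU hz
  have hp : ∀ s, HasFDerivAt (momentum k F s) (fderiv ℝ (momentum k F s) z) z := fun s =>
    ((hF.momentum hU k s).differentiableAt_of_isOpen hU hz).hasFDerivAt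
  have hF' : HasFDerivAt F (fderiv ℝ F z) z := (hF.differentiableAt_of_isOpen hU hz).hasFDerivAt
  have hc : ∀ s, HasFDerivAt (fun z : JetModel n N => contactForm s z v)
      (-(v.1 • qCoordL n N (s + 1))) z := by
    intro s
    have : (fun z : JetModel n N => contactForm s z v) =
        fun z => qCoord s v - (v.1 • qCoordL n N (s + 1)) z := by
      ext1 z; rw [contactForm_apply]; simp
    rw [this]
    exact (v.1 • qCoordL n N (s + 1)).hasFDerivAt.const_sub _
  have h1 : HasFDerivAt (fun z => cartanForm k F z v) _ z :=
    ((hF'.const_mul v.1).add (HasFDerivAt.fun_sum (u := Finset.range k)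
      fun s _ => (hp s).clm_apply (hc s))).congr_of_eventuallyEq
      (Eventually.of_forall fun z => cartanForm_apply hk z v)
  have h2 := congrArg (fun D => D u)
    (h1.unique (hd.hasFDerivAt.clm_apply (hasFDerivAt_const v z)))
  rw [← fderiv_sub_sum_momentum hU hF h hk hN hz]
  simp only [add_apply, smul_apply, sum_apply, ContinuousLinearMap.comp_apply,
    ContinuousLinearMap.flip_apply, neg_apply, map_neg, map_smul, qCoordL_apply, smul_eq_mul,
    Finset.sum_add_distrib, Finset.sum_neg_distrib, ← Finset.mul_sum, zero_apply, map_zero,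
    zero_add] at h2
  rw [← h2]
  ring

/-- The forms `dp^s - (d_T p^s) dt` appearing in the Poincaré-Cartan `2`-form. -/
def momentumForm (k : ℕ) (F : JetModel n N → ℝ) (s : ℕ) (z : JetModel n N) :
    JetModel n N →L[ℝ] Fib n →L[ℝ] ℝ :=
  fderiv ℝ (momentum k F s) z -
    (ContinuousLinearMap.fst ℝ ℝ _).smulRight (momentumRate k F s z)

lemma momentumForm_apply (s : ℕ) (z u : JetModel n N) :
    momentumForm k F s z u = fderiv ℝ (momentum k F s) z u - u.1 • momentumRate k F s z := by
  simp [momentumForm]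

/-- The exterior derivative of the Poincaré-Cartan form is `∑ (dp^s - (d_T p^s) dt) ∧ ω_s`. -/
lemma fderiv_cartanForm_sub (hU : IsOpen U) (hF : ContDiffOn ℝ ∞ F U) (h : IndepAbove k F)
    (hk : 1 ≤ k) (hN : k ≤ N) {z : JetModel n N} (hz : z ∈ U) (u v : JetModel n N) :
    fderiv ℝ (cartanForm k F) z u v - fderiv ℝ (cartanForm k F) z v u =
      ∑ s ∈ Finset.range k, (momentumForm k F s z u (contactForm s z v) -
        momentumForm k F s z v (contactForm s z u)) := by
  have h1 : ∀ s, momentumForm k F s z u (contactForm s z v) -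
        momentumForm k F s z v (contactForm s z u) =
      fderiv ℝ (momentum k F s) z u (contactForm s z v) -
        fderiv ℝ (momentum k F s) z v (contactForm s z u) +
        (v.1 * momentumRate k F s z (qCoord s u) - u.1 * momentumRate k F s z (qCoord s v)) := by
    intro s
    have : u.1 * momentumRate k F s z (contactForm s z v) -
        v.1 * momentumRate k F s z (contactForm s z u) =
        u.1 * momentumRate k F s z (qCoord s v) - v.1 * momentumRate k F s z (qCoord s u) := by
      simp only [contactForm_apply, map_sub, map_smul, smul_eq_mul]
      ring
    simp only [momentumForm_apply, sub_apply, smul_apply, smul_eq_mul]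
    linear_combination -this
  -- The term `u.1 * v.1 * ∂L/∂t` is symmetric and drops out of the difference.
  rw [fderiv_cartanForm hU hF h hk hN hz, fderiv_cartanForm hU hF h hk hN hz]
  simp only [h1, Finset.sum_add_distrib, Finset.sum_sub_distrib, ← Finset.mul_sum]
  ring

/-- The nondegeneracy of a Lagrangian at a point: the differentials of `t`, of the coordinates
`q_0, …, q_{k-1}` and of the momenta have no common kernel. -/
def IsRegularAt (k : ℕ) (F : JetModel n N → ℝ) (z : JetModel n N) : Prop :=
  ∀ u : JetModel n N, u.1 = 0 → (∀ s < k, qCoord s u = 0) →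
    (∀ s < k, fderiv ℝ (momentum k F s) z u = 0) → u = 0

/-- The extended Legendre map in coordinates. -/
def legendreExt (k : ℕ) (F : JetModel n N → ℝ) (z : JetModel n N) :
    JetModel n (k - 1) × (JetModel n (k - 1) →L[ℝ] ℝ) :=
  (truncL n N (k - 1) z, legendreCovector k F z)

/-- The restricted Legendre map in coordinates. -/
def legendreRes (k : ℕ) (F : JetModel n N → ℝ) (z : JetModel n N) : RestrictedModel n (k - 1) :=
  (truncL n N (k - 1) z, (legendreCovector k F z).comp
    (ContinuousLinearMap.inr ℝ ℝ (Fin (k - 1 + 1) → Fib n)))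

lemma ContDiffOn.legendreExt (hU : IsOpen U) (hF : ContDiffOn ℝ ∞ F U) (k : ℕ) :
    ContDiffOn ℝ ∞ (legendreExt k F) U :=
  (truncL n N (k - 1)).contDiff.contDiffOn.prodMk (hF.legendreCovector hU k)

lemma ContDiffOn.legendreRes (hU : IsOpen U) (hF : ContDiffOn ℝ ∞ F U) (k : ℕ) :
    ContDiffOn ℝ ∞ (legendreRes k F) U :=
  (truncL n N (k - 1)).contDiff.contDiffOn.prodMk
    ((hF.legendreCovector hU k).clm_comp contDiffOn_const)

lemma fderiv_legendreExt (hU : IsOpen U) (hF : ContDiffOn ℝ ∞ F U) (k : ℕ) {z : JetModel n N}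
    (hz : z ∈ U) (u : JetModel n N) : fderiv ℝ (legendreExt k F) z u =
      (truncL n N (k - 1) u, fderiv ℝ (legendreCovector k F) z u) := by
  have hd := (hF.legendreCovector hU k).differentiableAt_of_isOpen hU hz
  have : HasFDerivAt (legendreExt k F) _ z :=
    (truncL n N (k - 1)).hasFDerivAt.prodMk hd.hasFDerivAt
  rw [this.fderiv]
  rfl

lemma fderiv_legendreRes (hU : IsOpen U) (hF : ContDiffOn ℝ ∞ F U) (k : ℕ) {z : JetModel n N}
    (hz : z ∈ U) (u : JetModel n N) : fderiv ℝ (legendreRes k F) z u =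
      (truncL n N (k - 1) u, (fderiv ℝ (legendreCovector k F) z u).comp
        (ContinuousLinearMap.inr ℝ ℝ (Fin (k - 1 + 1) → Fib n))) := by
  have hd := (hF.legendreCovector hU k).differentiableAt_of_isOpen hU hz
  have : HasFDerivAt (legendreRes k F) _ z :=
    (truncL n N (k - 1)).hasFDerivAt.prodMk
      (hd.hasFDerivAt.clm_comp (hasFDerivAt_const _ z))
  rw [this.fderiv]
  ext <;> simp

lemma fderiv_cartanForm_eq_comp (hU : IsOpen U) (hF : ContDiffOn ℝ ∞ F U) (k : ℕ)
    {z : JetModel n N} (hz : z ∈ U) (u v : JetModel n N) :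
    fderiv ℝ (cartanForm k F) z u v =
      fderiv ℝ (legendreCovector k F) z u (truncL n N (k - 1) v) := by
  have hd := (hF.legendreCovector hU k).differentiableAt_of_isOpen hU hz
  have : HasFDerivAt (cartanForm k F) _ z :=
    hd.hasFDerivAt.clm_comp (hasFDerivAt_const (truncL n N (k - 1)) z)
  rw [this.fderiv]
  simp

lemma truncL_eq_zero_iff (hk : 1 ≤ k) (u : JetModel n N) :
    truncL n N (k - 1) u = 0 ↔ u.1 = 0 ∧ ∀ s < k, qCoord s u = 0 := by
  constructor
  · intro h
    refine ⟨congrArg Prod.fst h, fun s hs => ?_⟩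
    rw [← qCoord_truncL (M := k - 1) (by omega), h, ← qCoordL_apply, map_zero]
  · rintro ⟨h1, h2⟩
    refine jetModel_ext h1 fun i hi => ?_
    rw [qCoord_truncL hi, h2 i (by omega), ← qCoordL_apply, map_zero]

/-- On vectors annihilated by `dt` and `dq_0, …, dq_{k-1}`, the differential of the Legendre
covector only has momentum components. -/
lemma fderiv_legendreCovector_apply (hU : IsOpen U) (hF : ContDiffOn ℝ ∞ F U)
    (h : IndepAbove k F) (hk : 1 ≤ k) (hN : k ≤ N) {z : JetModel n N} (hz : z ∈ U)
    {u : JetModel n N} (h1 : u.1 = 0) (h2 : ∀ s < k, qCoord s u = 0) (v : JetModel n N) :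
    fderiv ℝ (legendreCovector k F) z u (truncL n N (k - 1) v) =
      ∑ s ∈ Finset.range k, fderiv ℝ (momentum k F s) z u (contactForm s z v) := by
  rw [← fderiv_cartanForm_eq_comp hU hF k hz, fderiv_cartanForm hU hF h hk hN hz, h1,
    Finset.sum_eq_zero (s := Finset.range k) (f := fun s => momentumRate k F s z (qCoord s u))
      fun s hs => by rw [h2 s (Finset.mem_range.1 hs), map_zero]]
  simp

/-- On vectors with `dt = dq_0 = ⋯ = dq_{k-1} = 0`, pairing the derivative of the covector with the
coordinate directions of order `s` isolates the derivative of `p^s`. -/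
lemma injective_fderiv_legendreRes_iff (hU : IsOpen U) (hF : ContDiffOn ℝ ∞ F U)
    (h : IndepAbove k F) (hk : 1 ≤ k) (hN : k ≤ N) {z : JetModel n N} (hz : z ∈ U) :
    Function.Injective (fderiv ℝ (legendreRes k F) z) ↔ IsRegularAt k F z := by
  rw [injective_iff_map_eq_zero]
  refine forall_congr' fun u => ?_
  rw [fderiv_legendreRes hU hF k hz, Prod.mk_eq_zero, truncL_eq_zero_iff hk]
  rw [and_imp, and_imp]
  refine forall_congr' fun h1 => forall_congr' fun h2 => imp_congr_left ?_
  have key := fderiv_legendreCovector_apply hU hF h hk hN hz h1 h2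
  constructor
  · intro h3 s hs
    ext a
    have h4 := key (qDirection n N s a)
    -- The test vector has no `dt` component, so the restricted covector already sees it.
    have h5 : truncL n N (k - 1) (qDirection n N s a) = ContinuousLinearMap.inr ℝ ℝ _
        (truncL n N (k - 1) (qDirection n N s a)).2 := Prod.ext (by simp) rfl
    rw [h5, ← ContinuousLinearMap.comp_apply, h3, Finset.sum_eq_single s] at h4
    · rw [contactForm_apply, qCoord_qDirection_self (by omega)] at h4
      simpa using h4.symm
    · intro j _ hj
      rw [contactForm_apply, qCoord_qDirection_of_ne hj]
      simp
    · intro hs'; exact absurd (Finset.mem_range.2 hs) hs'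
  · intro h3
    ext1 x
    obtain ⟨v, hv⟩ := truncL_surjective (n := n) (show k - 1 ≤ N by omega)
      (ContinuousLinearMap.inr ℝ ℝ _ x)
    rw [ContinuousLinearMap.comp_apply, ← hv, key]
    exact Finset.sum_eq_zero fun s hs => by rw [h3 s (Finset.mem_range.1 hs)]; rfl

/-- The additional component `L - ∑ p^s q_{s+1}` brings nothing new: on the relevant vectors its
derivative is a combination of those of the momenta. -/
lemma injective_fderiv_legendreExt_iff (hU : IsOpen U) (hF : ContDiffOn ℝ ∞ F U)
    (h : IndepAbove k F) (hk : 1 ≤ k) (hN : k ≤ N) {z : JetModel n N} (hz : z ∈ U) :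
    Function.Injective (fderiv ℝ (legendreExt k F) z) ↔ IsRegularAt k F z := by
  constructor
  · intro hi u h1 h2 h3
    refine (injective_iff_map_eq_zero _).1 hi u ?_
    rw [fderiv_legendreExt hU hF k hz, (truncL_eq_zero_iff hk u).2 ⟨h1, h2⟩]
    refine Prod.ext rfl (ContinuousLinearMap.ext fun x => ?_)
    obtain ⟨v, rfl⟩ := truncL_surjective (n := n) (show k - 1 ≤ N by omega) x
    change fderiv ℝ (legendreCovector k F) z u _ = 0
    rw [fderiv_legendreCovector_apply hU hF h hk hN hz h1 h2]
    exact Finset.sum_eq_zero fun s hs => by rw [h3 s (Finset.mem_range.1 hs)]; rfl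
  · intro hr
    have h3 := (injective_fderiv_legendreRes_iff hU hF h hk hN hz).2 hr
    rw [injective_iff_map_eq_zero] at h3 ⊢
    intro u hu
    refine h3 u ?_
    rw [fderiv_legendreExt hU hF k hz, Prod.mk_eq_zero] at hu
    rw [fderiv_legendreRes hU hF k hz, hu.1, hu.2]
    rfl

end PoincareCartan

/-! ### Prolonged changes of coordinates and invariance of the Poincaré-Cartan form. -/

section Prolongation

variable {n N k : ℕ} {W : Type*} [NormedAddCommGroup W] [NormedSpace ℝ W]
  {G : JetModel n N → Fib n} {S S' : Set (JetModel n N)}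

/-- The prolongation `(t, q_0, …, q_N) ↦ (t, G, d_T G, …, d_T^N G)`. -/
def prolong (G : JetModel n N → Fib n) (z : JetModel n N) : JetModel n N :=
  (z.1, fun i : Fin (N + 1) => totalDeriv^[i] G z)

lemma qCoord_prolong {i : ℕ} (hi : i < N + 1) (z : JetModel n N) :
    qCoord i (prolong G z) = totalDeriv^[i] G z := qCoord_of_lt hi _

lemma contDiffOn_prolong (hS : IsOpen S) (hG : ContDiffOn ℝ ∞ G S) :
    ContDiffOn ℝ ∞ (prolong G) S :=
  contDiffOn_fst.prodMk (contDiffOn_pi.2 fun i => hG.iterate_totalDeriv hS i)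

lemma fderiv_prolong_fst (hS : IsOpen S) (hG : ContDiffOn ℝ ∞ G S) {z : JetModel n N}
    (hz : z ∈ S) (v : JetModel n N) : (fderiv ℝ (prolong G) z v).1 = v.1 := by
  have hd := (contDiffOn_prolong hS hG).differentiableAt_of_isOpen hS hz
  have h1 : HasFDerivAt (fun w => (prolong G w).1) _ z := hd.hasFDerivAt.fst
  have h2 : HasFDerivAt (fun w : JetModel n N => w.1) _ z :=
    (ContinuousLinearMap.fst ℝ ℝ (Fin (N + 1) → Fib n)).hasFDerivAt
  exact congrArg (fun D => D v) (h1.unique h2)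

lemma qCoord_fderiv_prolong (hS : IsOpen S) (hG : ContDiffOn ℝ ∞ G S) {z : JetModel n N}
    (hz : z ∈ S) {i : ℕ} (hi : i < N + 1) (v : JetModel n N) :
    qCoord i (fderiv ℝ (prolong G) z v) = fderiv ℝ (totalDeriv^[i] G) z v := by
  have hd := (contDiffOn_prolong hS hG).differentiableAt_of_isOpen hS hz
  have h1 : HasFDerivAt (fun w => qCoordL n N i (prolong G w)) _ z :=
    (qCoordL n N i).hasFDerivAt.comp z hd.hasFDerivAt
  have h2 : (fun w => qCoordL n N i (prolong G w)) = totalDeriv^[i] G := by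
    ext1 w; rw [qCoordL_apply, qCoord_prolong hi]
  rw [h2] at h1
  rw [h1.fderiv]
  simp

/-- The total derivative commutes with prolonged changes of coordinates. -/
lemma totalDeriv_comp_prolong (hS : IsOpen S) (hG : ContDiffOn ℝ ∞ G S) {m : ℕ} (hm : m + 1 ≤ N)
    {f : JetModel n N → W} (hf : IndepAbove m f) {z : JetModel n N} (hz : z ∈ S)
    (hfd : DifferentiableAt ℝ f (prolong G z)) :
    totalDeriv (fun w => f (prolong G w)) z = totalDeriv f (prolong G z) := by
  have hd := (contDiffOn_prolong hS hG).differentiableAt_of_isOpen hS hz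
  have h1 : HasFDerivAt (fun w => f (prolong G w)) _ z := hfd.hasFDerivAt.comp z hd.hasFDerivAt
  rw [totalDeriv_eq, totalDeriv_eq, h1.fderiv, ContinuousLinearMap.comp_apply, ← sub_eq_zero,
    ← map_sub]
  -- The image of the velocity and the velocity at the image point agree in all orders below `N`,
  -- hence in all orders that `f` depends on; this is where `m + 1 ≤ N` enters.
  refine hf.fderiv_apply_eq_zero _ _ ?_ fun i hi => ?_
  · rw [Prod.fst_sub, fderiv_prolong_fst hS hG hz]; simp [jetVelocity]
  · rw [← qCoordL_apply, map_sub, qCoordL_apply, qCoordL_apply,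
      qCoord_fderiv_prolong hS hG hz (by omega), qCoord_jetVelocity (by omega),
      qCoord_prolong (by omega), Function.iterate_succ_apply', totalDeriv_eq, sub_self]

variable {F F' : JetModel n N → ℝ}

/-- The transformation law of the momenta under prolonged changes of coordinates. -/
lemma momentum_prolong (hS : IsOpen S) (hG : ContDiffOn ℝ ∞ G S) (hG0 : IndepAbove 0 G)
    (hS' : IsOpen S') (hm : MapsTo (prolong G) S S') (hF' : ContDiffOn ℝ ∞ F' S')
    (h' : IndepAbove k F') (hF : ∀ z ∈ S, F z = F' (prolong G z)) (hN : 2 * k ≤ N + 1)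
    {s : ℕ} (hs : s ≤ k) {z : JetModel n N} (hz : z ∈ S) (a : Fib n) :
    momentum k F s z a = ∑ i ∈ Finset.range k,
      momentum k F' i (prolong G z) (fderiv ℝ (totalDeriv^[i] G) z (qDirection n N s a)) := by
  have hQ := fun i => hG.iterate_totalDeriv hS i
  have hQI := fun i => hG0.iterate_totalDeriv i
  have hτ := contDiffOn_prolong hS hG
  have hFs : ContDiffOn ℝ ∞ F S := (hF'.comp hτ hm).congr hF
  have hp' := fun i => hF'.momentum hS' k i
  -- Downward induction from `s = k`, where `p^k = 0` and the functions `d_T^i G`, `i < k`, do not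
  -- depend on `q_k`. The inductive step differentiates the law for `p^{s+1}` and uses `p^s =
  -- ∂L/∂q_{s+1} - d_T p^{s+1}`.
  induction hs using Nat.decreasingInduction generalizing z a with
  | self =>
    rw [momentum_eq_zero le_rfl, Pi.zero_apply, zero_apply, Finset.sum_eq_zero]
    intro i hi
    have := Finset.mem_range.1 hi
    rw [(hQI i).fderiv_qDirection (by omega), map_zero]
  | of_succ s hs ih =>
    have hsN : s + 1 ≤ N := by omega
    -- the derivative of `L`
    have h1 : partialQ F (s + 1) z a = ∑ i ∈ Finset.range (k + 1),
        partialQ F' i (prolong G z) (fderiv ℝ (totalDeriv^[i] G) z (qDirection n N (s + 1) a)) := by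
      have e : F =ᶠ[𝓝 z] fun w => F' (prolong G w) := by
        filter_upwards [hS.mem_nhds hz] with w hw using hF w hw
      have hc : HasFDerivAt (fun w => F' (prolong G w)) _ z :=
        (hF'.differentiableAt_of_isOpen hS' (hm hz)).hasFDerivAt.comp z
          (hτ.differentiableAt_of_isOpen hS hz).hasFDerivAt
      change fderiv ℝ F z (qDirection n N (s + 1) a) = _
      rw [e.fderiv_eq, hc.fderiv, ContinuousLinearMap.comp_apply,
        apply_decomp_of_le (fderiv ℝ F' (prolong G z)) (m := k + 1) (by omega)
          (fun i hi a => h'.fderiv_qDirection (by omega) _ a), fderiv_prolong_fst hS hG hz,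
        qDirection_fst, zero_smul, zero_add]
      refine Finset.sum_congr rfl fun i hi => ?_
      have := Finset.mem_range.1 hi
      rw [qCoord_fderiv_prolong hS hG hz (by omega)]
      rfl
    -- the total derivative of the momentum of order `s + 1`
    have h2 : ∀ i ∈ Finset.range k, totalDeriv (fun w => momentum k F' i (prolong G w)
          (fderiv ℝ (totalDeriv^[i] G) w (qDirection n N (s + 1) a))) z =
        totalDeriv (momentum k F' i) (prolong G z)
            (fderiv ℝ (totalDeriv^[i] G) z (qDirection n N (s + 1) a)) +
          momentum k F' i (prolong G z)
            (fderiv ℝ (totalDeriv^[i + 1] G) z (qDirection n N (s + 1) a) -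
              fderiv ℝ (totalDeriv^[i] G) z (qDirection n N s a)) := by
      intro i hi
      have hik := Finset.mem_range.1 hi
      have hcom : fderiv ℝ (totalDeriv^[i + 1] G) z (qDirection n N (s + 1) a) -
          fderiv ℝ (totalDeriv^[i] G) z (qDirection n N s a) =
          totalDeriv (fun w => fderiv ℝ (totalDeriv^[i] G) w (qDirection n N (s + 1) a)) z := by
        rw [Function.iterate_succ_apply', fderiv_totalDeriv_qDirection hS (hQ i) hsN hz a,
          add_sub_cancel_right]
      have hdQ : DifferentiableAt ℝ
          (fun w => fderiv ℝ (totalDeriv^[i] G) w (qDirection n N (s + 1) a)) z :=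
        (((hQ i).fderiv_of_isOpen hS (m := ∞) (by simp)).clm_apply
          contDiffOn_const).differentiableAt_of_isOpen hS hz
      rw [hcom]
      -- The index `0` is separate because `p^0` may have order `N`, and then `d_T` need not commute
      -- with the prolongation. Its coefficient vanishes anyway, since `G` does not depend on
      -- `q_{s+1}`.
      rcases Nat.eq_zero_or_pos i with rfl | hi0
      · have h0 : (fun w => fderiv ℝ (totalDeriv^[0] G) w (qDirection n N (s + 1) a)) =
            fun _ => 0 := funext fun w => (hQI 0).fderiv_qDirection (by omega) w a
        rw [congrFun h0 z]
        have h0' : (fun w => momentum k F' 0 (prolong G w)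
            (fderiv ℝ (totalDeriv^[0] G) w (qDirection n N (s + 1) a))) = fun _ => 0 :=
          funext fun w => by rw [congrFun h0 w, map_zero]
        rw [h0, h0']
        simp [totalDeriv_eq]
      · have hc := totalDeriv_comp_prolong hS hG (m := 2 * k - 1 - i) (by omega)
          (momentum_indepAbove h' hik) hz ((hp' i).differentiableAt_of_isOpen hS' (hm hz))
        have hdp : DifferentiableAt ℝ (fun w => momentum k F' i (prolong G w)) z :=
          ((hp' i).comp hτ hm).differentiableAt_of_isOpen hS hz
        rw [totalDeriv_eq, fderiv_clm_apply hdp hdQ, ← hc, totalDeriv_eq, totalDeriv_eq]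
        simp only [add_apply, ContinuousLinearMap.comp_apply, ContinuousLinearMap.flip_apply]
        rw [add_comm]
    have h3 : totalDeriv (momentum k F (s + 1)) z a = ∑ i ∈ Finset.range k,
        totalDeriv (fun w => momentum k F' i (prolong G w)
          (fderiv ℝ (totalDeriv^[i] G) w (qDirection n N (s + 1) a))) z := by
      have hd := (hFs.momentum hS k (s + 1)).differentiableAt_of_isOpen hS hz
      have e : (fun w => momentum k F (s + 1) w a) =ᶠ[𝓝 z] fun w => ∑ i ∈ Finset.range k,
          momentum k F' i (prolong G w)
            (fderiv ℝ (totalDeriv^[i] G) w (qDirection n N (s + 1) a)) := by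
        filter_upwards [hS.mem_nhds hz] with w hw using ih hw a
      have e1 : totalDeriv (momentum k F (s + 1)) z a =
          totalDeriv (fun w => momentum k F (s + 1) w a) z := by
        rw [totalDeriv_eq, totalDeriv_eq, fderiv_clm_apply hd (by fun_prop)]
        simp
      rw [e1, totalDeriv_eq, e.fderiv_eq, fderiv_fun_sum, sum_apply]
      · rfl
      · intro i _
        exact (((hp' i).comp hτ hm).clm_apply
          (((hQ i).fderiv_of_isOpen hS (m := ∞) (by simp)).clm_apply
            contDiffOn_const)).differentiableAt_of_isOpen hS hz
    have h4 := congrArg (fun D : Fib n →L[ℝ] ℝ => D a) (partialQ_succ_eq hS hFs hs hz)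
    simp only [add_apply] at h4
    rw [h1, h3, Finset.sum_congr rfl h2, Finset.sum_range_succ', Finset.sum_add_distrib] at h4
    have h5 : ∀ i ∈ Finset.range k, partialQ F' (i + 1) (prolong G z)
          (fderiv ℝ (totalDeriv^[i + 1] G) z (qDirection n N (s + 1) a)) =
        momentum k F' i (prolong G z)
          (fderiv ℝ (totalDeriv^[i + 1] G) z (qDirection n N (s + 1) a)) +
        totalDeriv (momentum k F' (i + 1)) (prolong G z)
          (fderiv ℝ (totalDeriv^[i + 1] G) z (qDirection n N (s + 1) a)) := by
      intro i hi
      rw [partialQ_succ_eq hS' hF' (Finset.mem_range.1 hi) (hm hz)]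
      rfl
    have h6 : fderiv ℝ (totalDeriv^[0] G) z (qDirection n N (s + 1) a) = 0 :=
      (hQI 0).fderiv_qDirection (by omega) z a
    -- The index can be shifted because both end terms vanish: at `0` since `G` has order zero, at
    -- `k` since the momentum of order `k` is zero. The terms with `d_T` of a new momentum then
    -- cancel.
    have h7 : ∑ i ∈ Finset.range k, totalDeriv (momentum k F' i) (prolong G z)
          (fderiv ℝ (totalDeriv^[i] G) z (qDirection n N (s + 1) a)) =
        ∑ i ∈ Finset.range k, totalDeriv (momentum k F' (i + 1)) (prolong G z)
          (fderiv ℝ (totalDeriv^[i + 1] G) z (qDirection n N (s + 1) a)) := by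
      have := Finset.sum_range_succ (fun i => totalDeriv (momentum k F' i) (prolong G z)
          (fderiv ℝ (totalDeriv^[i] G) z (qDirection n N (s + 1) a))) k
      rw [Finset.sum_range_succ', h6, map_zero, add_zero, momentum_eq_zero le_rfl,
        totalDeriv_eq] at this
      simpa using this.symm
    rw [Finset.sum_congr rfl h5, Finset.sum_add_distrib, h6, map_zero, add_zero, h7] at h4
    simp only [map_sub, Finset.sum_sub_distrib] at h4
    linarith

/-- The Poincaré-Cartan form is invariant under prolonged changes of coordinates. -/
lemma cartanForm_prolong (hS : IsOpen S) (hG : ContDiffOn ℝ ∞ G S) (hG0 : IndepAbove 0 G)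
    (hS' : IsOpen S') (hm : MapsTo (prolong G) S S') (hF' : ContDiffOn ℝ ∞ F' S')
    (h' : IndepAbove k F') (hF : ∀ z ∈ S, F z = F' (prolong G z)) (hk : 1 ≤ k)
    (hN : 2 * k ≤ N + 1) {z : JetModel n N} (hz : z ∈ S) (v : JetModel n N) :
    cartanForm k F z v = cartanForm k F' (prolong G z) (fderiv ℝ (prolong G) z v) := by
  have hQI := fun i => hG0.iterate_totalDeriv i
  rw [cartanForm_apply hk, cartanForm_apply hk, fderiv_prolong_fst hS hG hz, hF z hz]
  congr 1
  -- Contact forms transform linearly among themselves: `ω_i` at the image jet is the derivative of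
  -- `d_T^i G` applied to `v - v.1 • jetVelocity z`, a vector with no `dt` component and with
  -- coordinates `ω_s(v)` for `s < k`. The law for the momenta is the transpose, so `∑ p^s ω_s` is
  -- invariant.
  have h1 : ∀ i ∈ Finset.range k,
      contactForm i (prolong G z) (fderiv ℝ (prolong G) z v) =
        ∑ s ∈ Finset.range k, fderiv ℝ (totalDeriv^[i] G) z
          (qDirection n N s (contactForm s z v)) := by
    intro i hi
    have hik := Finset.mem_range.1 hi
    rw [contactForm_apply, qCoord_fderiv_prolong hS hG hz (by omega), fderiv_prolong_fst hS hG hz,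
      qCoord_prolong (by omega), Function.iterate_succ_apply', totalDeriv_eq, ← map_smul,
      ← map_sub, apply_decomp_of_le (fderiv ℝ (totalDeriv^[i] G) z) (m := k) (by omega)
        fun j hj a => (hQI i).fderiv_qDirection (by omega) z a]
    have h0 : (v - v.1 • jetVelocity z).1 = 0 := by simp [jetVelocity]
    rw [h0, zero_smul, zero_add]
    refine Finset.sum_congr rfl fun s hs => ?_
    have hsk := Finset.mem_range.1 hs
    rw [contactForm_apply, ← qCoordL_apply s (v - _), map_sub, map_smul, qCoordL_apply,
      qCoordL_apply, qCoord_jetVelocity (by omega)]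
  have h2 : ∀ s ∈ Finset.range k, momentum k F s z (contactForm s z v) =
      ∑ i ∈ Finset.range k, momentum k F' i (prolong G z) (fderiv ℝ (totalDeriv^[i] G) z
        (qDirection n N s (contactForm s z v))) := fun s hs =>
    momentum_prolong hS hG hG0 hS' hm hF' h' hF hN (Finset.mem_range.1 hs).le hz _
  rw [Finset.sum_congr rfl h2, Finset.sum_comm]
  refine Finset.sum_congr rfl fun i hi => ?_
  rw [h1 i hi, map_sum]

end Prolongation

/-! ### Changes of jet coordinates as prolongations of changes of fibre coordinates. -/

section JetCoordinates

variable {n : ℕ} {E : Type*} [TopologicalSpace E]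
  [ChartedSpace (EuclideanSpace ℝ (Fin (n + 1))) E] [IsManifold (𝓡 (n + 1)) ∞ E]
  {π : E → ℝ} [hπ : IsBundleOverLine n π] {r s N k : ℕ}

lemma Jet.proj_eq_jet_rep (h : s ≤ r) (j : Jet n π r) : j.proj h = j.rep.jet s := by
  conv_lhs => rw [← j.jet_rep]
  rfl

lemma Jet.pt_proj (h : s ≤ r) (j : Jet n π r) : (j.proj h).pt = j.pt := by
  rw [Jet.proj_eq_jet_rep, LocalSection.pt_jet]; rfl

lemma AdaptedChart.coords_proj (e : AdaptedChart n π) (h : s ≤ r) {j : Jet n π r}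
    (hj : j.pt ∈ e.chart.source) : e.coords s (j.proj h) = truncL n r s (e.coords r j) := by
  rw [Jet.proj_eq_jet_rep, e.coords_jet _ hj]
  refine Prod.ext rfl (funext fun i => ?_)
  rw [truncL_snd, qCoord_of_lt (show (i : ℕ) < r + 1 by omega)]
  rfl

/-- The set of jet coordinates of an adapted chart. -/
def AdaptedChart.jetDomain (e : AdaptedChart n π) (r : ℕ) : Set (JetModel n r) :=
  {z | (z.1, z.2 0) ∈ e.chart.target}

lemma AdaptedChart.isOpen_jetDomain (e : AdaptedChart n π) (r : ℕ) : IsOpen (e.jetDomain r) :=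
  e.chart.open_target.preimage (by fun_prop : Continuous fun z : JetModel n r => (z.1, z.2 0))

lemma AdaptedChart.coords_mem_jetDomain (e : AdaptedChart n π) {j : Jet n π r}
    (hj : j.pt ∈ e.chart.source) : e.coords r j ∈ e.jetDomain r :=
  (e.jetEquiv r).map_source hj

lemma AdaptedChart.pt_ofCoords_mem (e : AdaptedChart n π) {z : JetModel n r}
    (hz : z ∈ e.jetDomain r) : (e.ofCoords z : Jet n π r).pt ∈ e.chart.source :=
  (e.jetEquiv r).map_target hz

lemma AdaptedChart.ofCoords_coords (e : AdaptedChart n π) {j : Jet n π r}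
    (hj : j.pt ∈ e.chart.source) : e.ofCoords (e.coords r j) = j :=
  (e.jetEquiv r).left_inv hj

lemma AdaptedChart.coords_ofCoords (e : AdaptedChart n π) {z : JetModel n r}
    (hz : z ∈ e.jetDomain r) : e.coords r (e.ofCoords z : Jet n π r) = z :=
  (e.jetEquiv r).right_inv hz

lemma AdaptedChart.proj_ofCoords (e : AdaptedChart n π) (h : s ≤ r) {z : JetModel n r}
    (hz : z ∈ e.jetDomain r) :
    (e.ofCoords z : Jet n π r).proj h = e.ofCoords (truncL n r s z) := by
  have hj := e.pt_ofCoords_mem hz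
  rw [← e.ofCoords_coords (j := (e.ofCoords z : Jet n π r).proj h) (by rwa [Jet.pt_proj]),
    e.coords_proj h hj, e.coords_ofCoords hz]

lemma AdaptedChart.truncL_mem_jetDomain (e : AdaptedChart n π) {z : JetModel n r}
    (hz : z ∈ e.jetDomain r) (s : ℕ) : truncL n r s z ∈ e.jetDomain s := by
  change ((truncL n r s z).1, (truncL n r s z).2 0) ∈ e.chart.target
  rw [truncL_fst, truncL_snd]
  exact hz

/-- The change of fibre coordinates `q' (t, q)`, as a function of jet coordinates. -/
def AdaptedChart.fibreTransition (e e' : AdaptedChart n π) (N : ℕ) (z : JetModel n N) : Fib n :=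
  (e'.chart (e.chart.symm (z.1, qCoord 0 z))).2

/-- The set on which the change of jet coordinates is defined. -/
def AdaptedChart.overlap (e e' : AdaptedChart n π) (N : ℕ) : Set (JetModel n N) :=
  {z | (z.1, z.2 0) ∈ (e.chart.symm.trans e'.chart).source}

lemma AdaptedChart.isOpen_overlap (e e' : AdaptedChart n π) (N : ℕ) : IsOpen (e.overlap e' N) :=
  (e.chart.symm.trans e'.chart).open_source.preimage
    (by fun_prop : Continuous fun z : JetModel n N => (z.1, z.2 0))

lemma AdaptedChart.overlap_eq (e e' : AdaptedChart n π) (N : ℕ) :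
    e.overlap e' N = ((e.jetEquiv N).symm.trans (e'.jetEquiv N)).source :=
  (e.transition_source e').symm

lemma AdaptedChart.mem_overlap_iff (e e' : AdaptedChart n π) {z : JetModel n N} :
    z ∈ e.overlap e' N ↔ z ∈ e.jetDomain N ∧ (e.ofCoords z : Jet n π N).pt ∈ e'.chart.source := by
  rw [overlap_eq, PartialEquiv.trans_source]; rfl

lemma AdaptedChart.coords_mem_overlap (e e' : AdaptedChart n π) {j : Jet n π N}
    (hj : j.pt ∈ e.chart.source) (hj' : j.pt ∈ e'.chart.source) :
    e.coords N j ∈ e.overlap e' N :=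
  (e.mem_overlap_iff e').2 ⟨e.coords_mem_jetDomain hj, by rwa [e.ofCoords_coords hj]⟩

lemma AdaptedChart.indepAbove_fibreTransition (e e' : AdaptedChart n π) (N : ℕ) :
    IndepAbove 0 (e.fibreTransition e' N) := by
  intro z d h1 h2
  have : qCoord 0 (z + d) = qCoord 0 z := by rw [qCoord_add, h2 0 le_rfl, add_zero]
  simp only [fibreTransition, this]
  simp [h1]

lemma AdaptedChart.contDiffOn_fibreTransition (e e' : AdaptedChart n π) (N : ℕ) :
    ContDiffOn ℝ ∞ (e.fibreTransition e' N) (e.overlap e' N) := by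
  have hF : ContDiffOn ℝ ∞ (fun p => (e'.chart (e.chart.symm p)).2)
      (e.chart.symm.trans e'.chart).source := by
    refine ContDiffOn.snd (ContMDiffOn.contDiffOn ?_)
    refine e'.smooth.comp (e.smooth_symm.mono fun p hp => ?_) fun p hp => ?_
    · exact ((e.chart.symm.trans_source e'.chart) ▸ hp).1
    · exact ((e.chart.symm.trans_source e'.chart) ▸ hp).2
  exact hF.comp (contDiff_fst.prodMk (contDiff_qCoord 0)).contDiffOn fun z hz => hz

/-- Derivatives along the prolongation of a curve are total derivatives. -/
lemma iteratedDeriv_comp_prolongedCurve {G : JetModel n N → Fib n} {S : Set (JetModel n N)}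
    (hS : IsOpen S) (hG : ContDiffOn ℝ ∞ G S) (hG0 : IndepAbove 0 G) {c : ℝ → Fib n}
    (hc : ContDiff ℝ ∞ c) {i : ℕ} (hi : i ≤ N) {t : ℝ}
    (ht : ((t, fun j : Fin (N + 1) => iteratedDeriv j c t) : JetModel n N) ∈ S) :
    iteratedDeriv i (fun s => G (s, fun j : Fin (N + 1) => iteratedDeriv j c s)) t =
      totalDeriv^[i] G (t, fun j : Fin (N + 1) => iteratedDeriv j c t) := by
  set J : ℝ → JetModel n N := fun s => (s, fun j : Fin (N + 1) => iteratedDeriv j c s) with hJ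
  have hdc : ∀ j : ℕ, ∀ s, HasDerivAt (iteratedDeriv j c) (iteratedDeriv (j + 1) c s) s := by
    intro j s
    rw [iteratedDeriv_succ]
    exact ((hc.differentiable_iteratedDeriv j
      (WithTop.coe_lt_coe.2 (ENat.natCast_lt_top j))) s).hasDerivAt
  have hdJ : ∀ s, HasDerivAt J (1, fun j : Fin (N + 1) => iteratedDeriv (j + 1) c s) s :=
    fun s => (hasDerivAt_id s).prodMk (hasDerivAt_pi.2 fun j => hdc j s)
  have hJc : Continuous J := continuous_iff_continuousAt.2 fun s => (hdJ s).continuousAt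
  induction i generalizing t with
  | zero => rfl
  | succ i ih =>
    have h1 : iteratedDeriv i (fun s => G (J s)) =ᶠ[𝓝 t] fun s => totalDeriv^[i] G (J s) := by
      filter_upwards [(hS.preimage hJc).mem_nhds ht] with s hs using ih (by omega) hs
    have hd := (hG.iterate_totalDeriv hS i).differentiableAt_of_isOpen hS ht
    have h2 : HasDerivAt (fun s => totalDeriv^[i] G (J s)) _ t :=
      HasFDerivAt.comp_hasDerivAt (f := J) t hd.hasFDerivAt (hdJ t)
    rw [iteratedDeriv_succ, h1.deriv_eq, Function.iterate_succ_apply', h2.deriv, totalDeriv_eq, ← sub_eq_zero, ← map_sub]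
    -- The derivative of the prolonged curve differs from the truncated velocity at most in the
    -- component of order `N`, on which `d_T^i G` does not depend because `i < N`.
    refine (hG0.iterate_totalDeriv i).fderiv_apply_eq_zero _ _ (by simp [jetVelocity])
      fun j hj => ?_
    rw [qCoord_of_lt (by omega)]
    simp only [jetVelocity, Prod.snd_sub, Pi.sub_apply]
    rw [qCoord_of_lt (show j + 1 < N + 1 by omega), sub_self]

/-- The change of jet coordinates is the prolongation of the change of fibre coordinates. -/
lemma AdaptedChart.coords_ofCoords_eq_prolong (e e' : AdaptedChart n π) {z : JetModel n N}
    (hz : z ∈ e.overlap e' N) :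
    e'.coords N (e.ofCoords z) = prolong (e.fibreTransition e' N) z := by
  have hz' := hz
  rw [overlap, mem_ofPred_eq, OpenPartialHomeomorph.trans_source] at hz'
  have ht : (z.1, z.2 0) ∈ e.chart.target := hz'.1
  have hcurve : ContDiff ℝ ∞ (taylorCurve z) :=
    contDiff_taylorCurve.comp (contDiff_id.prodMk contDiff_const)
  have hJ : ((z.1, fun j : Fin (N + 1) => iteratedDeriv j (taylorCurve z) z.1) : JetModel n N)
      = z := Prod.ext rfl (funext fun j => iteratedDeriv_taylorCurve z j)
  simp only [AdaptedChart.ofCoords, ht, dif_pos]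
  rw [e'.coords_jet _ (by rw [e.taylorSection_self]; exact hz'.2)]
  refine Prod.ext rfl (funext fun i => ?_)
  have := iteratedDeriv_comp_prolongedCurve (e.isOpen_overlap e' N)
    (e.contDiffOn_fibreTransition e' N) (e.indepAbove_fibreTransition e' N) hcurve
    (i := i) (t := z.1) (by omega) (by rw [hJ]; exact hz)
  rw [hJ] at this
  change _ = totalDeriv^[i] (e.fibreTransition e' N) z
  rw [← this]
  congr 1

lemma AdaptedChart.mapsTo_prolong_fibreTransition (e e' : AdaptedChart n π) (N : ℕ) :
    MapsTo (prolong (e.fibreTransition e' N)) (e.overlap e' N) (e'.jetDomain N) := fun z hz => by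
  rw [← e.coords_ofCoords_eq_prolong e' hz]
  exact e'.coords_mem_jetDomain ((e.mem_overlap_iff e').1 hz).2

end JetCoordinates

/-! ### Coordinate expressions of the Lagrangian and their transformation. -/

section LagrangianCoordinates

variable {n : ℕ} {E : Type*} [TopologicalSpace E]
  [ChartedSpace (EuclideanSpace ℝ (Fin (n + 1))) E] [IsManifold (𝓡 (n + 1)) ∞ E]
  {π : E → ℝ} [hπ : IsBundleOverLine n π] {k : ℕ} {L : Jet n π k → ℝ}

lemma AdaptedChart.lagrangian_eq (e : AdaptedChart n π) (L : Jet n π k → ℝ)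
    (z : JetModel n (2 * k - 1)) :
    e.lagrangian L z = L (e.ofCoords (truncL n (2 * k - 1) k z)) := by
  unfold lagrangian
  congr 2
  exact Prod.ext rfl (funext fun i => (truncL_snd k z i).symm)

lemma AdaptedChart.indepAbove_lagrangian (e : AdaptedChart n π) (L : Jet n π k → ℝ) :
    IndepAbove k (e.lagrangian L) := by
  intro z d h1 h2
  rw [lagrangian_eq, lagrangian_eq]
  congr 2
  rw [map_add, add_eq_left]
  refine jetModel_ext h1 fun i hi => ?_
  rw [qCoord_truncL hi, h2 i (by omega), ← qCoordL_apply, map_zero]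

lemma AdaptedChart.contDiffOn_lagrangian (e : AdaptedChart n π)
    (hL : ContMDiff 𝓘(ℝ, JetModel n k) 𝓘(ℝ, ℝ) ∞ L) :
    ContDiffOn ℝ ∞ (e.lagrangian L) (e.jetDomain (2 * k - 1)) := by
  have h1 : ContMDiffOn 𝓘(ℝ, JetModel n k) 𝓘(ℝ, JetModel n k) ∞ (e.jetChart k).symm
      (e.jetChart k).target :=
    contMDiffOn_symm_of_mem_maximalAtlas
      (IsManifold.subset_maximalAtlas (e.jetChart_mem_atlas k))
  have h2 := (hL.comp_contMDiffOn h1).contDiffOn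
  refine (h2.comp (truncL n (2 * k - 1) k).contDiff.contDiffOn
    fun z hz => e.truncL_mem_jetDomain hz k).congr fun z _ => ?_
  rw [lagrangian_eq]
  rfl

lemma AdaptedChart.lagrangian_prolong (e e' : AdaptedChart n π) (L : Jet n π k → ℝ) (hk : 1 ≤ k)
    {z : JetModel n (2 * k - 1)} (hz : z ∈ e.overlap e' (2 * k - 1)) :
    e.lagrangian L z = e'.lagrangian L (prolong (e.fibreTransition e' (2 * k - 1)) z) := by
  obtain ⟨h1, h2⟩ := (e.mem_overlap_iff e').1 hz
  have hle : k ≤ 2 * k - 1 := by omega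
  rw [lagrangian_eq, lagrangian_eq, ← e.coords_ofCoords_eq_prolong e' hz,
    ← e.proj_ofCoords hle h1, ← e'.coords_proj hle h2, e'.ofCoords_coords]
  rwa [Jet.pt_proj]

lemma AdaptedChart.cartanForm_prolong (e e' : AdaptedChart n π)
    (hL : ContMDiff 𝓘(ℝ, JetModel n k) 𝓘(ℝ, ℝ) ∞ L) (hk : 1 ≤ k)
    {z : JetModel n (2 * k - 1)} (hz : z ∈ e.overlap e' (2 * k - 1)) :
    cartanForm k (e.lagrangian L) z =
      (cartanForm k (e'.lagrangian L) (prolong (e.fibreTransition e' (2 * k - 1)) z)).comp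
        (fderiv ℝ (prolong (e.fibreTransition e' (2 * k - 1))) z) := by
  refine ContinuousLinearMap.ext fun v => ?_
  exact _root_.cartanForm_prolong (e.isOpen_overlap e' _) (e.contDiffOn_fibreTransition e' _)
    (e.indepAbove_fibreTransition e' _) (e'.isOpen_jetDomain _)
    (e.mapsTo_prolong_fibreTransition e' _) (e'.contDiffOn_lagrangian hL)
    (e'.indepAbove_lagrangian L) (fun z hz => e.lagrangian_prolong e' L hk hz) hk (by omega) hz v

end LagrangianCoordinates

/-! ### The coordinate Poincaré-Cartan form as an alternating map, and its exterior derivative. -/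

section CartanForms

variable {n N k : ℕ} {F : JetModel n N → ℝ} {U : Set (JetModel n N)}

/-- The Poincaré-Cartan form in jet coordinates as an alternating map. -/
def cartanOne (k : ℕ) (F : JetModel n N → ℝ) (z : JetModel n N) : JetModel n N [⋀^Fin 1]→L[ℝ] ℝ :=
  ContinuousAlternatingMap.ofSubsingletonLIE (𝕜 := ℝ) 0 (cartanForm k F z)

lemma cartanOne_apply (z : JetModel n N) (v : Fin 1 → JetModel n N) :
    cartanOne k F z v = cartanForm k F z (v 0) := rfl

lemma ContDiffOn.cartanOne (hU : IsOpen U) (hF : ContDiffOn ℝ ∞ F U) (k : ℕ) :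
    ContDiffOn ℝ ∞ (cartanOne k F) U :=
  (ContinuousAlternatingMap.ofSubsingletonLIE (𝕜 := ℝ)
    (E := JetModel n N) (F := ℝ) (0 : Fin 1)).toContinuousLinearEquiv.contDiff.comp_contDiffOn (hF.cartanForm hU k)

lemma ContDiffOn.extDeriv {H : Type*} [NormedAddCommGroup H] [NormedSpace ℝ H] {p : ℕ}
    {U : Set H} {α : H → H [⋀^Fin p]→L[ℝ] ℝ} (hU : IsOpen U) (hα : ContDiffOn ℝ ∞ α U) :
    ContDiffOn ℝ ∞ (extDeriv α) U :=
  ContDiff.comp_contDiffOn (g := ContinuousAlternatingMap.alternatizeUncurryFinCLM (n := p) ℝ H ℝ)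
    (ContinuousLinearMap.contDiff _) (hα.fderiv_of_isOpen hU (m := ∞) (by simp))

lemma extDeriv_cartanOne_apply (hU : IsOpen U) (hF : ContDiffOn ℝ ∞ F U) {z : JetModel n N}
    (hz : z ∈ U) (u v : JetModel n N) :
    extDeriv (cartanOne k F) z ![u, v] =
      fderiv ℝ (cartanForm k F) z u v - fderiv ℝ (cartanForm k F) z v u := by
  have hd := (hF.cartanForm hU k).differentiableAt_of_isOpen hU hz
  have h1 : HasFDerivAt (cartanOne k F) _ z :=
    (ContinuousAlternatingMap.ofSubsingletonLIE (𝕜 := ℝ)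
    (E := JetModel n N) (F := ℝ) (0 : Fin 1)).toContinuousLinearEquiv.hasFDerivAt.comp z hd.hasFDerivAt
  have h2 : ∀ (u : JetModel n N) (w : Fin 1 → JetModel n N),
      fderiv ℝ (cartanOne k F) z u w = fderiv ℝ (cartanForm k F) z u (w 0) := by
    intro u w
    rw [h1.fderiv]
    rfl
  have h3 : extDeriv (cartanOne k F) z ![u, v] = ∑ i : Fin 2, (-1 : ℤ) ^ (i : ℕ) •
      fderiv ℝ (cartanOne k F) z (![u, v] i) (i.removeNth ![u, v]) :=
    ContinuousAlternatingMap.alternatizeUncurryFin_apply _ _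
  rw [h3, Fin.sum_univ_two, h2, h2]
  simp [Fin.removeNth, sub_eq_add_neg]

end CartanForms

/-! ### The Poincaré-Cartan forms and `dt` on the jet manifold: chart independence, smoothness,
closedness. -/

section ManifoldForms

variable {n : ℕ} {E : Type*} [TopologicalSpace E]
  [ChartedSpace (EuclideanSpace ℝ (Fin (n + 1))) E] [IsManifold (𝓡 (n + 1)) ∞ E]
  {π : E → ℝ} [hπ : IsBundleOverLine n π] {r k N : ℕ} {L : Jet n π k → ℝ}

lemma AdaptedChart.hasMFDerivAt_jetChart (e : AdaptedChart n π) {j : Jet n π r}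
    (hj : j.pt ∈ e.chart.source) : HasMFDerivAt 𝓘(ℝ, JetModel n r) 𝓘(ℝ, JetModel n r)
      (e.jetChart r) j (e.tangentMap j) :=
  ((e.mdifferentiable_jetChart r).mdifferentiableAt hj).hasMFDerivAt

lemma AdaptedChart.mem_nhds_source (e : AdaptedChart n π) {j : Jet n π r}
    (hj : j.pt ∈ e.chart.source) : {j : Jet n π r | j.pt ∈ e.chart.source} ∈ 𝓝 j :=
  (e.jetChart r).open_source.mem_nhds hj

/-- The differential of a change of jet charts. -/
lemma AdaptedChart.tangentMap_eq_comp (e e' : AdaptedChart n π) {j : Jet n π N}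
    (hj : j.pt ∈ e.chart.source) (hj' : j.pt ∈ e'.chart.source) :
    e'.tangentMap j =
      (fderiv ℝ (prolong (e.fibreTransition e' N)) (e.coords N j)).comp (e.tangentMap j) := by
  have h0 : prolong (e.fibreTransition e' N) =ᶠ[𝓝 (e.coords N j)]
      (e.jetEquiv N).symm.trans (e'.jetEquiv N) := by
    filter_upwards [(e.isOpen_overlap e' N).mem_nhds (e.coords_mem_overlap e' hj hj')] with z hz
    exact (e.coords_ofCoords_eq_prolong e' hz).symm
  rw [h0.fderiv_eq, ← e'.tangentMap_comp_inverse e hj' hj, ContinuousLinearMap.comp_assoc]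
  have := (e.isInvertible_tangentMap hj).inverse_comp_self
  exact (congrArg (fun D => (e'.tangentMap j).comp D) this).symm

lemma Jet.pt_lower (y : Jet n π (2 * k - 1)) : y.lower.pt = y.pt := Jet.pt_proj _ y

lemma AdaptedChart.coords_lower (e : AdaptedChart n π) {y : Jet n π (2 * k - 1)}
    (hy : y.pt ∈ e.chart.source) :
    e.coords (k - 1) y.lower = truncL n (2 * k - 1) (k - 1) (e.coords (2 * k - 1) y) :=
  e.coords_proj _ hy

lemma AdaptedChart.mdifferentiableAt_lower (e : AdaptedChart n π) {y : Jet n π (2 * k - 1)}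
    (hy : y.pt ∈ e.chart.source) : MDifferentiableAt 𝓘(ℝ, JetModel n (2 * k - 1))
      𝓘(ℝ, JetModel n (k - 1)) Jet.lower y := by
  have h2 : HasMFDerivAt 𝓘(ℝ, JetModel n (2 * k - 1)) 𝓘(ℝ, JetModel n (k - 1))
      (truncL n (2 * k - 1) (k - 1)) (e.jetChart (2 * k - 1) y)
      (truncL n (2 * k - 1) (k - 1)) :=
    (truncL n (2 * k - 1) (k - 1)).hasFDerivAt.hasMFDerivAt
  have h3 := h2.comp y (e.hasMFDerivAt_jetChart hy)
  have hz : truncL n (2 * k - 1) (k - 1) (e.coords (2 * k - 1) y) ∈ (e.jetChart (k - 1)).target :=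
    e.truncL_mem_jetDomain (e.coords_mem_jetDomain hy) _
  have h4 : MDifferentiableAt 𝓘(ℝ, JetModel n (k - 1)) 𝓘(ℝ, JetModel n (k - 1))
      (e.jetChart (k - 1)).symm (truncL n (2 * k - 1) (k - 1) (e.coords (2 * k - 1) y)) :=
    (e.mdifferentiable_jetChart (k - 1)).mdifferentiableAt_symm hz
  refine (h4.comp y h3.mdifferentiableAt).congr_of_eventuallyEq ?_
  filter_upwards [e.mem_nhds_source hy] with x hx
  change x.lower = e.ofCoords (truncL n (2 * k - 1) (k - 1) (e.coords (2 * k - 1) x))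
  rw [← e.coords_lower hx, e.ofCoords_coords]
  rwa [Jet.pt_lower]

/-- The projection `J^{2k-1} π → J^{k-1} π` in coordinates, at the level of differentials. -/
lemma AdaptedChart.tangentMap_comp_mfderiv_lower (e : AdaptedChart n π) {y : Jet n π (2 * k - 1)}
    (hy : y.pt ∈ e.chart.source) :
    (e.tangentMap y.lower).comp (mfderiv 𝓘(ℝ, JetModel n (2 * k - 1)) 𝓘(ℝ, JetModel n (k - 1))
      Jet.lower y) = (truncL n (2 * k - 1) (k - 1)).comp (e.tangentMap y) := by
  have h2 : HasMFDerivAt 𝓘(ℝ, JetModel n (2 * k - 1)) 𝓘(ℝ, JetModel n (k - 1))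
      (truncL n (2 * k - 1) (k - 1)) (e.jetChart (2 * k - 1) y)
      (truncL n (2 * k - 1) (k - 1)) :=
    (truncL n (2 * k - 1) (k - 1)).hasFDerivAt.hasMFDerivAt
  have h3 := h2.comp y (e.hasMFDerivAt_jetChart hy)
  have h4 := (e.hasMFDerivAt_jetChart (j := y.lower) (by rwa [Jet.pt_lower])).comp y
    (e.mdifferentiableAt_lower hy).hasMFDerivAt
  refine hasMFDerivAt_unique (h4.congr_of_eventuallyEq ?_) h3
  filter_upwards [e.mem_nhds_source hy] with x hx
  exact (e.coords_lower hx).symm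

lemma AdaptedChart.cartanForm_comp_tangentMap (e : AdaptedChart n π) {y : Jet n π (2 * k - 1)}
    (hy : y.pt ∈ e.chart.source) (F : JetModel n (2 * k - 1) → ℝ) :
    ((legendreCovector k F (e.coords (2 * k - 1) y)).comp (e.tangentMap y.lower)).comp
      (mfderiv 𝓘(ℝ, JetModel n (2 * k - 1)) 𝓘(ℝ, JetModel n (k - 1)) Jet.lower y) =
      (cartanForm k F (e.coords (2 * k - 1) y)).comp (e.tangentMap y) := by
  have := congrArg (fun D => (legendreCovector k F (e.coords (2 * k - 1) y)).comp D)
    (e.tangentMap_comp_mfderiv_lower hy)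
  exact this

lemma AdaptedChart.surjective_mfderiv_lower (e : AdaptedChart n π) {y : Jet n π (2 * k - 1)}
    (hk : 1 ≤ k) (hy : y.pt ∈ e.chart.source) :
    Function.Surjective (mfderiv 𝓘(ℝ, JetModel n (2 * k - 1)) 𝓘(ℝ, JetModel n (k - 1))
      Jet.lower y) := by
  intro w
  obtain ⟨D, hD⟩ := e.isInvertible_tangentMap hy
  obtain ⟨D', hD'⟩ := e.isInvertible_tangentMap (j := y.lower) (by rwa [Jet.pt_lower])
  obtain ⟨v, hv⟩ := truncL_surjective (n := n) (show k - 1 ≤ 2 * k - 1 by omega) (D' w)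
  refine ⟨D.symm v, D'.injective ?_⟩
  have h := congrArg (fun T => T (D.symm v)) (e.tangentMap_comp_mfderiv_lower hy)
  rw [← hD, ← hD'] at h
  rw [← hv]
  refine Eq.trans h ?_
  change truncL n (2 * k - 1) (k - 1) (D (D.symm v)) = _
  rw [D.apply_symm_apply]

/-- The local expression of the Legendre-Ostrogradsky map does not depend on the adapted chart. -/
lemma AdaptedChart.legendre_eq_legendre (e e' : AdaptedChart n π)
    (hL : ContMDiff 𝓘(ℝ, JetModel n k) 𝓘(ℝ, ℝ) ∞ L) (hk : 1 ≤ k) {y : Jet n π (2 * k - 1)}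
    (hy : y.pt ∈ e.chart.source) (hy' : y.pt ∈ e'.chart.source) :
    e.legendre L y = e'.legendre L y := by
  -- What is invariant a priori is the pull-back to `J^{2k-1} π`. The projection to `J^{k-1} π` is a
  -- submersion, so the pull-back determines the covector.
  have h1 : (cartanForm k (e.lagrangian L) (e.coords (2 * k - 1) y)).comp (e.tangentMap y) =
      (cartanForm k (e'.lagrangian L) (e'.coords (2 * k - 1) y)).comp (e'.tangentMap y) := by
    have hz := e.coords_mem_overlap e' hy hy'
    rw [e.cartanForm_prolong e' hL hk hz, e.tangentMap_eq_comp e' hy hy',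
      ← e.coords_ofCoords_eq_prolong e' hz, e.ofCoords_coords hy]
    rfl
  rw [← e.cartanForm_comp_tangentMap hy, ← e'.cartanForm_comp_tangentMap hy'] at h1
  unfold legendre
  congr 1
  refine ContinuousLinearMap.ext fun w => ?_
  obtain ⟨v, rfl⟩ := e.surjective_mfderiv_lower hk hy w
  exact congrArg (fun D => D v) h1

/-- The definition takes a chart depending on the jet; to differentiate, one fixed chart must serve
for all nearby jets. -/
lemma extendedLegendre_eq (e : AdaptedChart n π)
    (hL : ContMDiff 𝓘(ℝ, JetModel n k) 𝓘(ℝ, ℝ) ∞ L) (hk : 1 ≤ k) {y : Jet n π (2 * k - 1)}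
    (hy : y.pt ∈ e.chart.source) : extendedLegendre L y = e.legendre L y :=
  (adaptedChartAt n π y.pt).legendre_eq_legendre e hL hk (mem_adaptedChartAt_source y.pt) hy

lemma poincareCartanOne_eq (e : AdaptedChart n π)
    (hL : ContMDiff 𝓘(ℝ, JetModel n k) 𝓘(ℝ, ℝ) ∞ L) (hk : 1 ≤ k) {y : Jet n π (2 * k - 1)}
    (hy : y.pt ∈ e.chart.source) : poincareCartanOne L y =
      (cartanOne k (e.lagrangian L) (e.coords (2 * k - 1) y)).compContinuousLinearMap
        (e.tangentMap y) := by
  have h1 : ∀ v, (poincareCartanOne L y) v = (extendedLegendre L y).snd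
      (mfderiv 𝓘(ℝ, JetModel n (2 * k - 1)) 𝓘(ℝ, JetModel n (k - 1)) Jet.lower y (v 0)) :=
    fun v => rfl
  ext v
  rw [h1, extendedLegendre_eq e hL hk hy]
  exact congrArg (fun D => D (v 0)) (e.cartanForm_comp_tangentMap hy (e.lagrangian L))

lemma AdaptedChart.tangentMap_comp_mfderiv_symm (e : AdaptedChart n π) {z : JetModel n r}
    (hz : z ∈ e.jetDomain r) : (e.tangentMap (e.ofCoords z : Jet n π r)).comp
      (mfderiv 𝓘(ℝ, JetModel n r) 𝓘(ℝ, JetModel n r) (e.jetChart r).symm z) =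
        ContinuousLinearMap.id ℝ (JetModel n r) :=
  (e.mdifferentiable_jetChart r).comp_symm_deriv (x := z) hz

lemma inChart_poincareCartanOne (hL : ContMDiff 𝓘(ℝ, JetModel n k) 𝓘(ℝ, ℝ) ∞ L) (hk : 1 ≤ k)
    (x : Jet n π (2 * k - 1)) {z : JetModel n (2 * k - 1)}
    (hz : z ∈ (adaptedChartAt n π x.pt).jetDomain (2 * k - 1)) :
    DiffForm.inChart (poincareCartanOne L) x z =
      cartanOne k ((adaptedChartAt n π x.pt).lagrangian L) z := by
  set e := adaptedChartAt n π x.pt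
  have h1 := poincareCartanOne_eq e hL hk (e.pt_ofCoords_mem hz)
  have h2 := e.tangentMap_comp_mfderiv_symm hz
  rw [e.coords_ofCoords hz] at h1
  ext v
  change poincareCartanOne L (e.ofCoords z) (fun i => mfderiv 𝓘(ℝ, JetModel n (2 * k - 1))
    𝓘(ℝ, JetModel n (2 * k - 1)) (e.jetChart (2 * k - 1)).symm z (v i)) = _
  rw [h1]
  change cartanOne k (e.lagrangian L) z (fun i => ((e.tangentMap (e.ofCoords z)).comp
    (mfderiv 𝓘(ℝ, JetModel n (2 * k - 1))
    𝓘(ℝ, JetModel n (2 * k - 1)) (e.jetChart (2 * k - 1)).symm z)) (v i)) = _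
  rw [h2]
  rfl

/-- The exterior derivative commutes with pull-back by the change of coordinates, so the invariance
of the `1`-form passes to its differential. -/
lemma AdaptedChart.extDeriv_cartanOne_prolong (e e' : AdaptedChart n π)
    (hL : ContMDiff 𝓘(ℝ, JetModel n k) 𝓘(ℝ, ℝ) ∞ L) (hk : 1 ≤ k)
    {z : JetModel n (2 * k - 1)} (hz : z ∈ e.overlap e' (2 * k - 1)) :
    extDeriv (cartanOne k (e.lagrangian L)) z =
      (extDeriv (cartanOne k (e'.lagrangian L))
        (prolong (e.fibreTransition e' (2 * k - 1)) z)).compContinuousLinearMap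
        (fderiv ℝ (prolong (e.fibreTransition e' (2 * k - 1))) z) := by
  have hO := e.isOpen_overlap e' (2 * k - 1)
  have hτ := contDiffOn_prolong hO (e.contDiffOn_fibreTransition e' (2 * k - 1))
  rw [← extDeriv_pullback (r := ∞)]
  · refine Filter.EventuallyEq.extDeriv_eq ?_
    filter_upwards [hO.mem_nhds hz] with w hw
    ext v
    rw [cartanOne_apply, e.cartanForm_prolong e' hL hk hw]
    rfl
  · exact ((e'.contDiffOn_lagrangian hL).cartanOne
      (e'.isOpen_jetDomain _) k).differentiableOn (by simp) |>.differentiableAt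
      ((e'.isOpen_jetDomain _).mem_nhds (e.mapsTo_prolong_fibreTransition e' _ hz))
  · exact hτ.contDiffAt (hO.mem_nhds hz)
  · simpa using two_le_infty

/-- `DiffForm.d` is computed in the preferred chart at the point; naturality of the exterior
derivative moves the computation to an arbitrary adapted chart. -/
lemma poincareCartanTwo_eq (e : AdaptedChart n π)
    (hL : ContMDiff 𝓘(ℝ, JetModel n k) 𝓘(ℝ, ℝ) ∞ L) (hk : 1 ≤ k) {y : Jet n π (2 * k - 1)}
    (hy : y.pt ∈ e.chart.source) : poincareCartanTwo L y =
      (-extDeriv (cartanOne k (e.lagrangian L))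
        (e.coords (2 * k - 1) y)).compContinuousLinearMap (e.tangentMap y) := by
  set e₀ := adaptedChartAt n π y.pt with he₀
  have hy₀ : y.pt ∈ e₀.chart.source := mem_adaptedChartAt_source y.pt
  have h1 : extDeriv (DiffForm.inChart (poincareCartanOne L) y) (e₀.coords (2 * k - 1) y) =
      extDeriv (cartanOne k (e₀.lagrangian L)) (e₀.coords (2 * k - 1) y) := by
    refine Filter.EventuallyEq.extDeriv_eq ?_
    filter_upwards [(e₀.isOpen_jetDomain _).mem_nhds (e₀.coords_mem_jetDomain hy₀)] with z hz
    exact inChart_poincareCartanOne hL hk y hz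
  have hz := e.coords_mem_overlap e₀ hy hy₀
  rw [e.extDeriv_cartanOne_prolong e₀ hL hk hz, ← e.coords_ofCoords_eq_prolong e₀ hz,
    e.ofCoords_coords hy, ← h1]
  ext v
  have h2 := e.tangentMap_eq_comp e₀ hy hy₀
  change -(extDeriv (DiffForm.inChart (poincareCartanOne L) y) (e₀.coords (2 * k - 1) y)
    fun i => e₀.tangentMap y (v i)) = _
  rw [h2]
  rfl

lemma inChart_poincareCartanTwo (hL : ContMDiff 𝓘(ℝ, JetModel n k) 𝓘(ℝ, ℝ) ∞ L) (hk : 1 ≤ k)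
    (x : Jet n π (2 * k - 1)) {z : JetModel n (2 * k - 1)}
    (hz : z ∈ (adaptedChartAt n π x.pt).jetDomain (2 * k - 1)) :
    DiffForm.inChart (poincareCartanTwo L) x z =
      -extDeriv (cartanOne k ((adaptedChartAt n π x.pt).lagrangian L)) z := by
  set e := adaptedChartAt n π x.pt
  have h1 := poincareCartanTwo_eq e hL hk (e.pt_ofCoords_mem hz)
  have h2 := e.tangentMap_comp_mfderiv_symm hz
  rw [e.coords_ofCoords hz] at h1
  ext v
  change poincareCartanTwo L (e.ofCoords z) (fun i => mfderiv 𝓘(ℝ, JetModel n (2 * k - 1))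
    𝓘(ℝ, JetModel n (2 * k - 1)) (e.jetChart (2 * k - 1)).symm z (v i)) = _
  rw [h1]
  change (-extDeriv (cartanOne k (e.lagrangian L)) z) (fun i => ((e.tangentMap (e.ofCoords z)).comp
    (mfderiv 𝓘(ℝ, JetModel n (2 * k - 1))
    𝓘(ℝ, JetModel n (2 * k - 1)) (e.jetChart (2 * k - 1)).symm z)) (v i)) = _
  rw [h2]
  rfl

lemma isSmooth_poincareCartanTwo (hL : ContMDiff 𝓘(ℝ, JetModel n k) 𝓘(ℝ, ℝ) ∞ L) (hk : 1 ≤ k) :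
    DiffForm.IsSmooth (poincareCartanTwo (π := π) L) := by
  intro x
  set e := adaptedChartAt n π x.pt
  have h1 := (((e.contDiffOn_lagrangian hL).cartanOne (e.isOpen_jetDomain _) k).extDeriv
    (e.isOpen_jetDomain _)).neg
  exact h1.congr fun z hz => inChart_poincareCartanTwo hL hk x hz

lemma d_poincareCartanTwo (hL : ContMDiff 𝓘(ℝ, JetModel n k) 𝓘(ℝ, ℝ) ∞ L) (hk : 1 ≤ k) :
    DiffForm.d (poincareCartanTwo (π := π) L) = fun _ => 0 := by
  funext x
  set e := adaptedChartAt n π x.pt with he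
  have hx : x.pt ∈ e.chart.source := mem_adaptedChartAt_source x.pt
  have hz := e.coords_mem_jetDomain hx
  have hO := (e.isOpen_jetDomain (2 * k - 1)).mem_nhds hz
  have h1 : extDeriv (DiffForm.inChart (poincareCartanTwo L) x) (e.coords (2 * k - 1) x) = 0 := by
    have h2 : DiffForm.inChart (poincareCartanTwo L) x =ᶠ[𝓝 (e.coords (2 * k - 1) x)]
        (-1 : ℝ) • extDeriv (cartanOne k (e.lagrangian L)) := by
      filter_upwards [hO] with z hz
      rw [inChart_poincareCartanTwo hL hk x hz, Pi.smul_apply, neg_one_smul]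
    rw [h2.extDeriv_eq, extDeriv_smul, extDeriv_extDeriv_apply (r := ∞) (((e.contDiffOn_lagrangian
      hL).cartanOne (e.isOpen_jetDomain _) k).contDiffAt hO) (by simpa using two_le_infty),
      smul_zero]
  ext v
  change extDeriv (DiffForm.inChart (poincareCartanTwo L) x) (e.coords (2 * k - 1) x) _ = _
  rw [h1]
  rfl

lemma timeForm_apply (e : AdaptedChart n π) {y : Jet n π (2 * k - 1)}
    (hy : y.pt ∈ e.chart.source)
    (v : Fin 1 → TangentSpace 𝓘(ℝ, JetModel n (2 * k - 1)) y) :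
    timeForm n π k y v = (e.tangentMap y (v 0)).1 := by
  change y.dt (v 0) = _
  rw [e.dt_eq hy]
  rfl

/-- Adapted charts preserve `t`, so `dt` has constant coefficients; smoothness and closedness follow
at once. -/
lemma inChart_timeForm (x : Jet n π (2 * k - 1)) {z : JetModel n (2 * k - 1)}
    (hz : z ∈ (adaptedChartAt n π x.pt).jetDomain (2 * k - 1)) :
    DiffForm.inChart (timeForm n π k) x z =
      ContinuousAlternatingMap.ofSubsingleton ℝ (JetModel n (2 * k - 1)) ℝ 0
        (ContinuousLinearMap.fst ℝ ℝ _) := by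
  set e := adaptedChartAt n π x.pt
  have h2 := e.tangentMap_comp_mfderiv_symm hz
  ext v
  change timeForm n π k (e.ofCoords z) (fun i => mfderiv 𝓘(ℝ, JetModel n (2 * k - 1))
    𝓘(ℝ, JetModel n (2 * k - 1)) (e.jetChart (2 * k - 1)).symm z (v i)) = _
  refine (timeForm_apply e (e.pt_ofCoords_mem hz) _).trans ?_
  exact congrArg (fun D : JetModel n (2 * k - 1) →L[ℝ] JetModel n (2 * k - 1) => (D (v 0)).1) h2

lemma isSmooth_timeForm : DiffForm.IsSmooth (timeForm n π k) := fun x =>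
  contDiffOn_const.congr fun _ hz => inChart_timeForm x hz

lemma d_timeForm : DiffForm.d (timeForm n π k) = fun _ => 0 := by
  funext x
  set e := adaptedChartAt n π x.pt with he
  have hx : x.pt ∈ e.chart.source := mem_adaptedChartAt_source x.pt
  have hO := (e.isOpen_jetDomain (2 * k - 1)).mem_nhds (e.coords_mem_jetDomain hx)
  have h1 : extDeriv (DiffForm.inChart (timeForm n π k) x) (e.coords (2 * k - 1) x) = 0 := by
    have h2 : DiffForm.inChart (timeForm n π k) x =ᶠ[𝓝 (e.coords (2 * k - 1) x)]
        fun _ => ContinuousAlternatingMap.ofSubsingleton ℝ (JetModel n (2 * k - 1)) ℝ 0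
          (ContinuousLinearMap.fst ℝ ℝ _) := by
      filter_upwards [hO] with z hz using inChart_timeForm x hz
    rw [h2.extDeriv_eq, extDeriv, fderiv_fun_const]
    exact (ContinuousAlternatingMap.alternatizeUncurryFinCLM ℝ (JetModel n (2 * k - 1)) ℝ).map_zero
  ext v
  change extDeriv (DiffForm.inChart (timeForm n π k) x) (e.coords (2 * k - 1) x) _ = _
  rw [h1]
  rfl

end ManifoldForms

/-! ### Local diffeomorphisms and immersions through injectivity of the derivative. -/

section InverseFunction

variable {H H' : Type*} [NormedAddCommGroup H] [NormedSpace ℝ H] [FiniteDimensional ℝ H]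
  [NormedAddCommGroup H'] [NormedSpace ℝ H'] [FiniteDimensional ℝ H']

/-- The inverse function theorem for smooth maps on open sets. -/
lemma exists_openPartialHomeomorph_of_contDiffOn {g : H → H'} {U : Set H} (hU : IsOpen U)
    (hg : ContDiffOn ℝ ∞ g U) {z : H} (hz : z ∈ U) (A : H ≃L[ℝ] H')
    (hA : HasFDerivAt g (A : H →L[ℝ] H') z) :
    ∃ e : OpenPartialHomeomorph H H', z ∈ e.source ∧ e.source ⊆ U ∧ (∀ w, e w = g w) ∧
      ContDiffOn ℝ ∞ e.symm e.target := by
  have : CompleteSpace H := FiniteDimensional.complete ℝ H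
  have hgz := hg.contDiffAt (hU.mem_nhds hz)
  let e₀ := hgz.toOpenPartialHomeomorph g hA (by simp)
  have hcont : ContinuousOn (fderiv ℝ g) U := hg.continuousOn_fderiv_of_isOpen hU (by simp)
  -- Restricting to the open set of invertible derivatives makes the inverse smooth on the whole
  -- target, not only at the image of `z`.
  let V := U ∩ fderiv ℝ g ⁻¹' range ((↑) : (H ≃L[ℝ] H') → H →L[ℝ] H')
  have hV : IsOpen V := hcont.isOpen_inter_preimage hU ContinuousLinearEquiv.isOpen
  refine ⟨e₀.restrOpen V hV, ?_, ?_, fun w => rfl, fun w hw => ?_⟩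
  · exact ⟨hgz.mem_toOpenPartialHomeomorph_source hA (by simp), hz, ⟨A, hA.fderiv.symm⟩⟩
  · rw [OpenPartialHomeomorph.restrOpen_source]
    exact fun w hw => hw.2.1
  · have hs := (e₀.restrOpen V hV).map_target hw
    rw [OpenPartialHomeomorph.restrOpen_source] at hs
    obtain ⟨hsU, B, hB⟩ := hs.2
    have hga := hg.contDiffAt (hU.mem_nhds hsU)
    refine ((e₀.restrOpen V hV).contDiffAt_symm (f₀' := B) hw ?_ hga).contDiffWithinAt
    rw [hB]
    exact (hga.differentiableAt (by simp)).hasFDerivAt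

lemma injective_fderiv_of_leftInverse {g : H → H'} {ρ : H' → H} {z : H}
    (hg : DifferentiableAt ℝ g z) (hρ : DifferentiableAt ℝ ρ (g z))
    (h : ∀ᶠ w in 𝓝 z, ρ (g w) = w) : Function.Injective (fderiv ℝ g z) := by
  have h1 : HasFDerivAt (fun w => ρ (g w)) _ z := hρ.hasFDerivAt.comp z hg.hasFDerivAt
  have h2 : HasFDerivAt (fun w => ρ (g w)) (ContinuousLinearMap.id ℝ H) z :=
    (hasFDerivAt_id z).congr_of_eventuallyEq h
  have h3 := h1.unique h2
  intro u v huv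
  have : ∀ u, fderiv ℝ ρ (g z) (fderiv ℝ g z u) = u := fun u => congrArg (fun D => D u) h3
  rw [← this u, huv, this]

variable {M : Type*} [TopologicalSpace M] [ChartedSpace H M] [IsManifold 𝓘(ℝ, H) ∞ M]
  {N : Type*} [TopologicalSpace N] [ChartedSpace H' N] [IsManifold 𝓘(ℝ, H') ∞ N]
  {f : M → N} {x : M} {φ : OpenPartialHomeomorph M H} {ψ : OpenPartialHomeomorph N H'}
  {g : H → H'} {U : Set H}

/-- If a map has a smooth local left inverse, its local representatives have injective
derivatives. -/
lemma injective_fderiv_of_contMDiffAt_leftInverse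
    (hφ : φ ∈ IsManifold.maximalAtlas 𝓘(ℝ, H) ∞ M) (hψ : ψ ∈ IsManifold.maximalAtlas 𝓘(ℝ, H') ∞ N)
    (hx : x ∈ φ.source) (hfx : f x ∈ ψ.source) (hg : DifferentiableAt ℝ g (φ x))
    (hfg : ∀ᶠ y in 𝓝 x, f y ∈ ψ.source ∧ ψ (f y) = g (φ y)) {ρ : N → M}
    (hρ : ContMDiffAt 𝓘(ℝ, H') 𝓘(ℝ, H) ∞ ρ (f x)) (h : ∀ᶠ y in 𝓝 x, ρ (f y) = y) :
    Function.Injective (fderiv ℝ g (φ x)) := by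
  have hgx : g (φ x) = ψ (f x) := hfg.self_of_nhds.2.symm
  have h1 : ContMDiffAt 𝓘(ℝ, H') 𝓘(ℝ, H') ∞ ψ.symm (g (φ x)) := by
    rw [hgx]; exact contMDiffAt_symm_of_mem_maximalAtlas hψ (ψ.map_source hfx)
  have h2 : ψ.symm (g (φ x)) = f x := by rw [hgx, ψ.left_inv hfx]
  have h3 : ContMDiffAt 𝓘(ℝ, H) 𝓘(ℝ, H) ∞ φ (ρ (ψ.symm (g (φ x)))) := by
    rw [h2, h.self_of_nhds]; exact contMDiffAt_of_mem_maximalAtlas hφ hx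
  have h4 : ContMDiffAt 𝓘(ℝ, H') 𝓘(ℝ, H) ∞ ρ (ψ.symm (g (φ x))) := by rwa [h2]
  have h3' : ContMDiffAt 𝓘(ℝ, H') 𝓘(ℝ, H) ∞ (fun w => φ (ρ (ψ.symm w))) (g (φ x)) :=
    ContMDiffAt.comp (g := φ) (f := fun w => ρ (ψ.symm w)) (g (φ x)) h3
      (ContMDiffAt.comp (g := ρ) (f := ψ.symm) (g (φ x)) h4 h1)
  have h5 := h3'.contDiffAt.differentiableAt (by simp)
  refine injective_fderiv_of_leftInverse hg h5 ?_
  have h6 := (φ.tendsto_symm hx).eventually (hfg.and h)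
  filter_upwards [h6, φ.open_target.mem_nhds (φ.map_source hx)] with w hw hwt
  obtain ⟨⟨hw1, hw2⟩, hw3⟩ := hw
  rw [φ.right_inv hwt] at hw2
  rw [← hw2, ψ.left_inv hw1, hw3, φ.right_inv hwt]

/-- A map is a local diffeomorphism at a point if and only if its local representatives have an
injective derivative (in equal dimensions). -/
lemma isLocalDiffeomorphAt_iff_injective (hd : Module.finrank ℝ H = Module.finrank ℝ H')
    (hφ : φ ∈ IsManifold.maximalAtlas 𝓘(ℝ, H) ∞ M) (hψ : ψ ∈ IsManifold.maximalAtlas 𝓘(ℝ, H') ∞ N)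
    (hx : x ∈ φ.source) (hfx : f x ∈ ψ.source) (hU : IsOpen U) (hg : ContDiffOn ℝ ∞ g U)
    (hxU : φ x ∈ U) (hfg : ∀ᶠ y in 𝓝 x, f y ∈ ψ.source ∧ ψ (f y) = g (φ y)) :
    IsLocalDiffeomorphAt 𝓘(ℝ, H) 𝓘(ℝ, H') ∞ f x ↔ Function.Injective (fderiv ℝ g (φ x)) := by
  have hgd := (hg.contDiffAt (hU.mem_nhds hxU)).differentiableAt (by simp)
  constructor
  · rintro ⟨Φ, hxΦ, hfΦ⟩
    have hfx' : f x ∈ Φ.target := by rw [hfΦ hxΦ]; exact Φ.map_source hxΦ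
    refine injective_fderiv_of_contMDiffAt_leftInverse hφ hψ hx hfx hgd hfg (ρ := Φ.invFun)
      (Φ.contMDiffOn_invFun.contMDiffAt (Φ.open_target.mem_nhds hfx')) ?_
    filter_upwards [Φ.open_source.mem_nhds hxΦ] with y hy
    rw [hfΦ hy]
    exact Φ.left_inv' hy
  · intro hinj
    let A : H ≃L[ℝ] H' := (LinearEquiv.ofInjectiveOfFinrankEq
      (fderiv ℝ g (φ x)).toLinearMap hinj hd).toContinuousLinearEquiv
    have hA : HasFDerivAt g (A : H →L[ℝ] H') (φ x) := by
      have : (A : H →L[ℝ] H') = fderiv ℝ g (φ x) := by ext v; rfl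
      rw [this]; exact hgd.hasFDerivAt
    obtain ⟨e, hze, hesrc, heg, hes⟩ := exists_openPartialHomeomorph_of_contDiffOn
      (hU.inter φ.open_target) (hg.mono inter_subset_left) ⟨hxU, φ.map_source hx⟩ A hA
    obtain ⟨O, hO, hOo, hxO⟩ := eventually_nhds_iff.1 hfg
    have hge : e.source ⊆ U := fun w hw => (hesrc hw).1
    -- The restriction to `O` ensures that `f` really is `ψ.symm ∘ g ∘ φ` on the source.
    let P : OpenPartialHomeomorph M N := (φ.trans (e.trans ψ.symm)).restrOpen O hOo
    have hPs : P.source = (φ.trans (e.trans ψ.symm)).source ∩ O :=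
      OpenPartialHomeomorph.restrOpen_source _ _ _
    have hmem : ∀ y ∈ P.source, y ∈ φ.source ∧ φ y ∈ e.source ∧ e (φ y) ∈ ψ.target ∧ y ∈ O := by
      intro y hy
      rw [hPs, OpenPartialHomeomorph.trans_source, OpenPartialHomeomorph.trans_source] at hy
      exact ⟨hy.1.1, hy.1.2.1, hy.1.2.2, hy.2⟩
    have hxP : x ∈ P.source := by
      rw [hPs, OpenPartialHomeomorph.trans_source, OpenPartialHomeomorph.trans_source]
      refine ⟨⟨hx, hze, ?_⟩, hxO⟩
      change e (φ x) ∈ ψ.target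
      rw [heg, ← (hO x hxO).2]
      exact ψ.map_source hfx
    have hPe : ∀ y, P y = ψ.symm (g (φ y)) := fun y => congrArg ψ.symm (heg (φ y))
    have hmem' : ∀ w ∈ P.target, w ∈ ψ.source ∧ ψ w ∈ e.target ∧ e.symm (ψ w) ∈ φ.target := by
      intro w hw
      obtain ⟨h1, h2, h3, -⟩ := hmem _ (P.map_target hw)
      have h4 : ψ.symm (e (φ (P.symm w))) = w := P.right_inv hw
      have h5 : ψ w = e (φ (P.symm w)) := by rw [← ψ.right_inv h3, h4]
      refine ⟨by rw [← h4]; exact ψ.map_target h3, by rw [h5]; exact e.map_source h2, ?_⟩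
      rw [h5, e.left_inv h2]
      exact φ.map_source h1
    refine ⟨⟨P.toPartialEquiv, P.open_source, P.open_target, ?_, ?_⟩, hxP, fun y hy => ?_⟩
    · have h1 : ContMDiffOn 𝓘(ℝ, H) 𝓘(ℝ, H) ∞ φ P.source :=
        (contMDiffOn_of_mem_maximalAtlas hφ).mono fun y hy => (hmem y hy).1
      have h2 : ContMDiffOn 𝓘(ℝ, H) 𝓘(ℝ, H') ∞ (fun y => g (φ y)) P.source :=
        hg.contMDiffOn.comp h1 fun y hy => hge (hmem y hy).2.1
      refine ((contMDiffOn_symm_of_mem_maximalAtlas hψ).comp h2 fun y hy => ?_).congr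
        fun y _ => hPe y
      rw [mem_preimage, ← heg]
      exact (hmem y hy).2.2.1
    · have h1 : ContMDiffOn 𝓘(ℝ, H') 𝓘(ℝ, H') ∞ ψ P.target :=
        (contMDiffOn_of_mem_maximalAtlas hψ).mono fun w hw => (hmem' w hw).1
      have h2 : ContMDiffOn 𝓘(ℝ, H') 𝓘(ℝ, H) ∞ (fun w => e.symm (ψ w)) P.target :=
        hes.contMDiffOn.comp h1 fun w hw => (hmem' w hw).2.1
      exact (contMDiffOn_symm_of_mem_maximalAtlas hφ).comp h2 fun w hw => (hmem' w hw).2.2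
    · change f y = P y
      have := hO y (hmem y hy).2.2.2
      rw [hPe, ← this.2, ψ.left_inv this.1]

variable {F : Type*} [NormedAddCommGroup F] [NormedSpace ℝ F] [FiniteDimensional ℝ F]

/-- A map with a local representative of injective derivative is an immersion at the point. -/
lemma isImmersionAtOfComplement_of_injective
    (hd : Module.finrank ℝ H + Module.finrank ℝ F = Module.finrank ℝ H')
    (hφ : φ ∈ IsManifold.maximalAtlas 𝓘(ℝ, H) ∞ M) (hψ : ψ ∈ IsManifold.maximalAtlas 𝓘(ℝ, H') ∞ N)
    (hx : x ∈ φ.source) (hU : IsOpen U) (hg : ContDiffOn ℝ ∞ g U)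
    (hxU : φ x ∈ U) (hfg : ∀ᶠ y in 𝓝 x, f y ∈ ψ.source ∧ ψ (f y) = g (φ y))
    (hinj : Function.Injective (fderiv ℝ g (φ x))) :
    Manifold.IsImmersionAtOfComplement F 𝓘(ℝ, H) 𝓘(ℝ, H') ∞ f x := by
  have hgd := (hg.contDiffAt (hU.mem_nhds hxU)).differentiableAt (by simp)
  set A := fderiv ℝ g (φ x)
  obtain ⟨q, hq⟩ := Submodule.exists_isCompl (LinearMap.range A.toLinearMap)
  have hq' : Module.finrank ℝ F = Module.finrank ℝ q := by
    have h1 := Submodule.finrank_add_eq_of_isCompl hq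
    have h2 := LinearMap.finrank_range_of_inj (f := A.toLinearMap) hinj
    omega
  let B₀ : F ≃ₗ[ℝ] q := LinearEquiv.ofFinrankEq _ _ hq'
  let C₀ : (H × F) ≃ₗ[ℝ] H' := ((LinearEquiv.ofInjective A.toLinearMap hinj).prodCongr B₀).trans
    (Submodule.prodEquivOfIsCompl _ q hq)
  let C : (H × F) ≃L[ℝ] H' := C₀.toContinuousLinearEquiv
  let B : F →L[ℝ] H' := (q.subtype ∘ₗ B₀.toLinearMap).toContinuousLinearMap
  have hC : ∀ p, C p = A p.1 + B p.2 := fun p => rfl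
  -- Adding a complement of the range of the derivative completes `g` to a local diffeomorphism
  -- whose derivative at `(φ x, 0)` is the isomorphism `C`.
  let G : H × F → H' := fun p => g p.1 + B p.2
  have hG : ContDiffOn ℝ ∞ G (U ×ˢ univ) :=
    (hg.comp contDiffOn_fst fun p hp => hp.1).add (B.contDiff.comp contDiff_snd).contDiffOn
  have hGd : HasFDerivAt G (C : (H × F) →L[ℝ] H') (φ x, 0) := by
    have h1 : HasFDerivAt G _ (φ x, (0 : F)) := (HasFDerivAt.comp (φ x, (0 : F))
      (f := Prod.fst) (g := g) hgd.hasFDerivAt hasFDerivAt_fst).add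
      (B.hasFDerivAt.comp (φ x, (0 : F)) (f := Prod.snd) hasFDerivAt_snd)
    refine h1.congr_fderiv (ContinuousLinearMap.ext fun p => ?_)
    exact (hC p).symm
  obtain ⟨e, hze, hesrc, heg, hes⟩ := exists_openPartialHomeomorph_of_contDiffOn
    (hU.prod isOpen_univ) hG ⟨hxU, mem_univ _⟩ C hGd
  obtain ⟨O, hO, hOo, hxO⟩ := eventually_nhds_iff.1 hfg
  -- The local inverse of `G` straightens the image: in this chart `f` reads `w ↦ C (w, 0)`, as the
  -- definition of an immersion demands.
  let cod : OpenPartialHomeomorph N H' := (ψ.trans e.symm).transHomeomorph C.toHomeomorph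
  have hcods : ∀ w, w ∈ cod.source ↔ w ∈ ψ.source ∧ ψ w ∈ e.target := fun w => by
    change w ∈ (ψ.trans e.symm).source ↔ _
    rw [OpenPartialHomeomorph.trans_source]; rfl
  have hcod : cod ∈ IsManifold.maximalAtlas 𝓘(ℝ, H') ∞ N := by
    refine OpenPartialHomeomorph.mem_maximalAtlas_of_contMDiffOn _ ?_ ?_
    · have h1 : ContMDiffOn 𝓘(ℝ, H') 𝓘(ℝ, H') ∞ ψ cod.source :=
        (contMDiffOn_of_mem_maximalAtlas hψ).mono fun w hw => ((hcods w).1 hw).1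
      have h2 : ContDiffOn ℝ ∞ (fun w => C (e.symm w)) e.target := C.contDiff.comp_contDiffOn hes
      exact h2.contMDiffOn.comp h1 fun w hw => ((hcods w).1 hw).2
    · have ht : ∀ w ∈ cod.target, C.symm w ∈ e.source ∧ e (C.symm w) ∈ ψ.target := by
        intro w hw
        have hw' : C.symm w ∈ (ψ.trans e.symm).target := hw
        rw [OpenPartialHomeomorph.trans_target] at hw'
        exact hw'
      have h1 : ContDiffOn ℝ ∞ (fun w => e (C.symm w)) cod.target := by
        refine ((hG.comp C.symm.contDiff.contDiffOn fun w hw => hesrc (ht w hw).1).congr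
          fun w _ => heg _)
      exact (contMDiffOn_symm_of_mem_maximalAtlas hψ).comp h1.contMDiffOn fun w hw => (ht w hw).2
  let S : Set M := O ∩ (φ.source ∩ φ ⁻¹' ((fun w => (w, (0 : F))) ⁻¹' e.source))
  have hS : IsOpen S := hOo.inter (φ.isOpen_inter_preimage
    (e.open_source.preimage (by fun_prop : Continuous fun w : H => (w, (0 : F)))))
  have hxS : x ∈ S := ⟨hxO, hx, hze⟩
  have hkey : ∀ y ∈ S, f y ∈ cod.source ∧ cod (f y) = C (φ y, 0) := by
    rintro y ⟨hy1, hy2, hy3⟩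
    have h1 : ψ (f y) = e (φ y, 0) := by rw [(hO y hy1).2, heg]; simp [G]
    refine ⟨(hcods _).2 ⟨(hO y hy1).1, by rw [h1]; exact e.map_source hy3⟩, ?_⟩
    change C (e.symm (ψ (f y))) = _
    rw [h1, e.left_inv hy3]
  have hsrc : (φ.restr S).source = φ.source ∩ S := by
    rw [OpenPartialHomeomorph.restr_source, hS.interior_eq]
  refine Manifold.IsImmersionAtOfComplement.mk_of_charts C (φ.restr S) cod (hsrc ▸ ⟨hx, hxS⟩)
    (hkey x hxS).1 (restr_mem_maximalAtlas (contDiffGroupoid ∞ 𝓘(ℝ, H)) hφ hS)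
    hcod (fun y hy => (hkey y (hsrc ▸ hy).2).1) fun w hw => ?_
  have hw' : w ∈ (φ.restr S).target := by simpa using hw
  have h1 := (φ.restr S).map_target hw'
  rw [hsrc] at h1
  have h2 := (hkey _ h1.2).2
  have h3 : φ ((φ.restr S).symm w) = w := (φ.restr S).right_inv hw'
  rw [h3] at h2
  simpa using h2

/-- The local representatives of an immersion have injective derivatives. -/
lemma injective_fderiv_of_isImmersionAt {F : Type*} [NormedAddCommGroup F] [NormedSpace ℝ F]
    (hφ : φ ∈ IsManifold.maximalAtlas 𝓘(ℝ, H) ∞ M) (hψ : ψ ∈ IsManifold.maximalAtlas 𝓘(ℝ, H') ∞ N)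
    (hx : x ∈ φ.source) (hfx : f x ∈ ψ.source) (hg : DifferentiableAt ℝ g (φ x))
    (hfg : ∀ᶠ y in 𝓝 x, f y ∈ ψ.source ∧ ψ (f y) = g (φ y))
    (h : Manifold.IsImmersionAtOfComplement F 𝓘(ℝ, H) 𝓘(ℝ, H') ∞ f x) :
    Function.Injective (fderiv ℝ g (φ x)) := by
  have hw : ∀ y ∈ h.domChart.source, h.codChart (f y) = h.equiv (h.domChart y, 0) := by
    intro y hy
    have h1 := h.writtenInCharts (show h.domChart y ∈ (h.domChart.extend 𝓘(ℝ, H)).target from by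
      simpa using h.domChart.map_source hy)
    simpa [h.domChart.left_inv hy] using h1
  have hxd := h.mem_domChart_source
  have h1 : ContMDiffAt 𝓘(ℝ, H') 𝓘(ℝ, H') ∞ h.codChart (f x) :=
    contMDiffAt_of_mem_maximalAtlas h.codChart_mem_maximalAtlas h.mem_codChart_source
  have h2 : ContMDiffAt 𝓘(ℝ, H') 𝓘(ℝ, H) ∞ (fun w => (h.equiv.symm (h.codChart w)).1) (f x) :=
    ContMDiffAt.comp (g := fun w => (h.equiv.symm w).1) (f := h.codChart) (f x)
      (contDiff_fst.comp h.equiv.symm.contDiff).contDiffAt.contMDiffAt h1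
  have h3 : ∀ y ∈ h.domChart.source, (h.equiv.symm (h.codChart (f y))).1 = h.domChart y := by
    intro y hy
    rw [hw y hy, ContinuousLinearEquiv.symm_apply_apply]
  -- In the charts of the immersion the map is `w ↦ (w, 0)`, so the first projection yields a smooth
  -- local left inverse.
  refine injective_fderiv_of_contMDiffAt_leftInverse hφ hψ hx hfx hg hfg
    (ρ := fun w => h.domChart.symm (h.equiv.symm (h.codChart w)).1)
    (ContMDiffAt.comp (g := h.domChart.symm) (f x) ?_ h2) ?_
  · rw [h3 x hxd]
    exact contMDiffAt_symm_of_mem_maximalAtlas h.domChart_mem_maximalAtlas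
      (h.domChart.map_source hxd)
  · filter_upwards [h.domChart.open_source.mem_nhds hxd] with y hy
    rw [h3 y hy, h.domChart.left_inv hy]

end InverseFunction

/-! ### The form `β^m ∧ η` as an alternatization; Darboux frames. -/

section ExteriorPower

variable {V : Type*} [AddCommGroup V] [Module ℝ V] {m : ℕ}

/-- The positions of the `2m + 1` arguments of `α^m ∧ η`. -/
abbrev WedgeIndex (m : ℕ) : Type := (Fin m × Fin 2) ⊕ Fin 1

/-- The enumeration of the arguments of `α^m ∧ η`. -/
def wedgeIndexEquiv (m : ℕ) : WedgeIndex m ≃ Fin (2 * m + 1) :=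
  ((finProdFinEquiv.trans (finCongr (Nat.mul_comm m 2))).sumCongr (Equiv.refl (Fin 1))).trans
    finSumFinEquiv

lemma wedgeIndexEquiv_inl_zero (i : Fin m) :
    wedgeIndexEquiv m (Sum.inl (i, 0)) = ⟨2 * i, by omega⟩ := by
  ext; simp [wedgeIndexEquiv, finProdFinEquiv]

lemma wedgeIndexEquiv_inl_one (i : Fin m) :
    wedgeIndexEquiv m (Sum.inl (i, 1)) = ⟨2 * i + 1, by omega⟩ := by
  ext; simp [wedgeIndexEquiv, finProdFinEquiv]; omega

lemma wedgeIndexEquiv_inr (c : Fin 1) :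
    wedgeIndexEquiv m (Sum.inr c) = Fin.last (2 * m) := by
  ext; simp [wedgeIndexEquiv]

/-- The product `β (v_0, v_1) ⋯ β (v_{2m-2}, v_{2m-1}) η (v_{2m})`. -/
def wedgeProduct (m : ℕ) (β : V →ₗ[ℝ] V →ₗ[ℝ] ℝ) (η : V →ₗ[ℝ] ℝ) :
    MultilinearMap ℝ (fun _ : WedgeIndex m => V) ℝ where
  toFun v := (∏ i : Fin m, β (v (Sum.inl (i, 0))) (v (Sum.inl (i, 1)))) * η (v (Sum.inr 0))
  map_update_add' {d} v j x y := by
    obtain rfl : d = instDecidableEqSum := Subsingleton.elim _ _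
    rcases j with ⟨i, b⟩ | c
    -- Only the factor of index `i` involves the updated argument.
    · have h : ∀ w, ∏ l : Fin m, β (Function.update v (Sum.inl (i, b)) w (Sum.inl (l, 0)))
            (Function.update v (Sum.inl (i, b)) w (Sum.inl (l, 1))) =
          β (Function.update v (Sum.inl (i, b)) w (Sum.inl (i, 0)))
            (Function.update v (Sum.inl (i, b)) w (Sum.inl (i, 1))) *
          ∏ l ∈ Finset.univ.erase i, β (v (Sum.inl (l, 0))) (v (Sum.inl (l, 1))) := fun w => by
        rw [← Finset.mul_prod_erase _ _ (Finset.mem_univ i)]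
        congr 1
        refine Finset.prod_congr rfl fun l hl => ?_
        have := Finset.ne_of_mem_erase hl
        rw [Function.update_of_ne (by simp [this]), Function.update_of_ne (by simp [this])]
      rw [h, h, h]
      fin_cases b <;> simp <;> ring
    · obtain rfl : c = 0 := Subsingleton.elim _ _
      simp; ring
  map_update_smul' {d} v j x y := by
    obtain rfl : d = instDecidableEqSum := Subsingleton.elim _ _
    rcases j with ⟨i, b⟩ | c
    · have h : ∀ w, ∏ l : Fin m, β (Function.update v (Sum.inl (i, b)) w (Sum.inl (l, 0)))
            (Function.update v (Sum.inl (i, b)) w (Sum.inl (l, 1))) =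
          β (Function.update v (Sum.inl (i, b)) w (Sum.inl (i, 0)))
            (Function.update v (Sum.inl (i, b)) w (Sum.inl (i, 1))) *
          ∏ l ∈ Finset.univ.erase i, β (v (Sum.inl (l, 0))) (v (Sum.inl (l, 1))) := fun w => by
        rw [← Finset.mul_prod_erase _ _ (Finset.mem_univ i)]
        congr 1
        refine Finset.prod_congr rfl fun l hl => ?_
        have := Finset.ne_of_mem_erase hl
        rw [Function.update_of_ne (by simp [this]), Function.update_of_ne (by simp [this])]
      rw [h, h]
      fin_cases b <;> simp <;> ring
    · obtain rfl : c = 0 := Subsingleton.elim _ _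
      simp; ring

lemma wedgeProduct_apply (β : V →ₗ[ℝ] V →ₗ[ℝ] ℝ) (η : V →ₗ[ℝ] ℝ) (v : WedgeIndex m → V) :
    wedgeProduct m β η v =
      (∏ i : Fin m, β (v (Sum.inl (i, 0))) (v (Sum.inl (i, 1)))) * η (v (Sum.inr 0)) := rfl

/-- Conjugating permutations by the enumeration of the arguments preserves signs. Indexing by pairs
plus one extra position makes the pairing visible and gives access to the alternating map API. -/
lemma sum_perm_wedge_eq (β : V →ₗ[ℝ] V →ₗ[ℝ] ℝ) (η : V →ₗ[ℝ] ℝ) (v : Fin (2 * m + 1) → V) :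
    ∑ σ : Equiv.Perm (Fin (2 * m + 1)), ((Equiv.Perm.sign σ : ℤ) : ℝ) *
      ((∏ i : Fin m, β (v (σ ⟨2 * i, by omega⟩)) (v (σ ⟨2 * i + 1, by omega⟩))) *
        η (v (σ (Fin.last (2 * m))))) =
    MultilinearMap.alternatization (wedgeProduct m β η) (v ∘ wedgeIndexEquiv m) := by
  rw [MultilinearMap.alternatization_apply, ← (wedgeIndexEquiv m).permCongr.sum_comp]
  refine Finset.sum_congr rfl fun σ _ => ?_
  rw [Equiv.Perm.sign_permCongr, Units.smul_def, zsmul_eq_mul]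
  simp only [MultilinearMap.domDomCongr_apply, wedgeProduct_apply, Equiv.permCongr_apply,
    ← wedgeIndexEquiv_inl_zero, ← wedgeIndexEquiv_inl_one, ← wedgeIndexEquiv_inr (0 : Fin 1),
    Equiv.symm_apply_apply, Function.comp_apply]

/-- If `u` is in the kernels of `β` and `η` and the dimension is `2m + 1`, then `β^m ∧ η = 0`. -/
lemma alternatization_wedgeProduct_eq_zero [FiniteDimensional ℝ V]
    (hV : Module.finrank ℝ V = 2 * m + 1) {β : V →ₗ[ℝ] V →ₗ[ℝ] ℝ} {η : V →ₗ[ℝ] ℝ} {u : V}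
    (hu : u ≠ 0) (h1 : ∀ v, β u v = 0) (h2 : ∀ v, β v u = 0) (h3 : η u = 0)
    (v : WedgeIndex m → V) :
    MultilinearMap.alternatization (wedgeProduct m β η) v = 0 := by
  by_cases hv : LinearIndependent ℝ v
  · let b := basisOfLinearIndependentOfCardEqFinrank hv (by simp [hV]; ring)
    obtain ⟨j, hj⟩ : ∃ j, b.repr u j ≠ 0 := by
      by_contra! h
      exact hu (b.repr.map_eq_zero_iff.1 (Finsupp.ext h))
    -- Replacing `v j` by `u` multiplies the value by the nonzero coordinate of `u` along `v j`; on
    -- the other hand each term of the alternatization then contains a factor annihilated by `u`.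
    have h4 : MultilinearMap.alternatization (wedgeProduct m β η) (Function.update v j u) =
        b.repr u j * MultilinearMap.alternatization (wedgeProduct m β η) v := by
      have hb : ∀ l, b l = v l := fun l => by simp [b]
      conv_lhs => rw [← b.sum_repr u]
      rw [AlternatingMap.map_update_sum, Finset.sum_eq_single j]
      · rw [AlternatingMap.map_update_smul, hb,
          Function.update_eq_self, smul_eq_mul]
      · intro l _ hl
        rw [AlternatingMap.map_update_smul, hb,
          AlternatingMap.map_update_self _ _ hl.symm, smul_zero]
      · simp
    have h5 : MultilinearMap.alternatization (wedgeProduct m β η) (Function.update v j u) = 0 := by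
      rw [MultilinearMap.alternatization_apply]
      refine Finset.sum_eq_zero fun σ _ => ?_
      rw [MultilinearMap.domDomCongr_apply, wedgeProduct_apply]
      rcases hx : σ.symm j with ⟨i, c⟩ | c
      · rw [Finset.prod_eq_zero (Finset.mem_univ i), zero_mul, smul_zero]
        have hx' := (Equiv.symm_apply_eq σ).1 hx
        fin_cases c <;> simp at hx' <;> simp [← hx', h1, h2]
      · have hx' := (Equiv.symm_apply_eq σ).1 hx
        obtain rfl : c = 0 := Subsingleton.elim _ _
        simp [← hx', h3]
    rw [h5] at h4
    exact (mul_eq_zero.1 h4.symm).resolve_left hj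
  · exact AlternatingMap.map_linearDependent _ _ hv

variable {ξ : V →ₗ[ℝ] WedgeIndex m → ℝ} {β : V →ₗ[ℝ] V →ₗ[ℝ] ℝ} {η : V →ₗ[ℝ] ℝ}

/-- A Darboux frame: `β^m ∧ η` does not vanish. -/
lemma exists_alternatization_wedgeProduct_ne_zero (hξ : Function.Surjective ξ)
    (hβ : ∀ u v, β u v = ∑ i, (ξ u (Sum.inl (i, 0)) * ξ v (Sum.inl (i, 1)) -
      ξ u (Sum.inl (i, 1)) * ξ v (Sum.inl (i, 0))))
    (hη : ∀ u, η u = ξ u (Sum.inr 0)) :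
    ∃ v : WedgeIndex m → V, MultilinearMap.alternatization (wedgeProduct m β η) v ≠ 0 := by
  choose v hv using fun j => hξ (Pi.single j 1)
  -- On the dual frame all terms of the alternatization are nonnegative and the identity contributes
  -- `1`, so the sum is positive and no count of the permutations is needed.
  refine ⟨v, ne_of_gt ?_⟩
  have hη' : ∀ j, η (v j) ≠ 0 → j = Sum.inr 0 := by
    intro j h
    rw [hη, hv] at h
    by_contra hj
    exact h (Pi.single_eq_of_ne (Ne.symm hj) _)
  have hη1 : η (v (Sum.inr 0)) = 1 := by rw [hη, hv]; simp
  have hβ1 : ∀ i (ε : Equiv.Perm (Fin 2)),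
      β (v (Sum.inl (i, ε 0))) (v (Sum.inl (i, ε 1))) = ((Equiv.Perm.sign ε : ℤ) : ℝ) := by
    intro i ε
    rw [hβ, Finset.sum_eq_single i]
    · have h2 : ∀ ε : Equiv.Perm (Fin 2), ε = 1 ∨ ε = Equiv.swap 0 1 := by decide
      rcases h2 ε with rfl | rfl <;> simp [hv]
    · intro l _ hl
      have h1 : ∀ b c, (Sum.inl (l, b) : WedgeIndex m) ≠ Sum.inl (i, c) := by simp [hl]
      simp [hv, h1]
    · simp
  have hβ' : ∀ j j', β (v j) (v j') ≠ 0 → ∃ i, ∃ ε : Equiv.Perm (Fin 2),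
      j = Sum.inl (i, ε 0) ∧ j' = Sum.inl (i, ε 1) := by
    intro j j' h
    rw [hβ] at h
    obtain ⟨i, -, hi⟩ := Finset.exists_ne_zero_of_sum_ne_zero h
    rw [hv, hv] at hi
    have hs : ∀ j x, (Pi.single j 1 : WedgeIndex m → ℝ) x ≠ 0 → j = x := by
      intro j x h
      by_contra hjx
      exact h (Pi.single_eq_of_ne (Ne.symm hjx) _)
    by_cases h1 : (Pi.single j 1 : WedgeIndex m → ℝ) (Sum.inl (i, 0)) *
        (Pi.single j' 1 : WedgeIndex m → ℝ) (Sum.inl (i, 1)) = 0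
    · rw [h1, zero_sub, neg_ne_zero] at hi
      obtain ⟨h2, h3⟩ := mul_ne_zero_iff.1 hi
      exact ⟨i, Equiv.swap 0 1, hs _ _ h2, hs _ _ h3⟩
    · obtain ⟨h2, h3⟩ := mul_ne_zero_iff.1 h1
      exact ⟨i, 1, hs _ _ h2, hs _ _ h3⟩
  rw [MultilinearMap.alternatization_apply]
  refine Finset.sum_pos' (fun σ _ => ?_) ⟨1, Finset.mem_univ _, ?_⟩
  · rw [MultilinearMap.domDomCongr_apply, wedgeProduct_apply, Units.smul_def, zsmul_eq_mul]
    by_cases h0 : (∏ i : Fin m, β (v (σ (Sum.inl (i, 0)))) (v (σ (Sum.inl (i, 1))))) *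
        η (v (σ (Sum.inr 0))) = 0
    · rw [h0, mul_zero]
    obtain ⟨h1, h2⟩ := mul_ne_zero_iff.1 h0
    rw [Finset.prod_ne_zero_iff] at h1
    choose τ ε hτ using fun i => hβ' _ _ (h1 i (Finset.mem_univ i))
    have hσ : ∀ i b, σ (Sum.inl (i, b)) = Sum.inl (τ i, ε i b) := by
      intro i b
      fin_cases b
      exacts [(hτ i).1, (hτ i).2]
    have hlast := hη' _ h2
    have hτi : Function.Injective τ := by
      intro i j hij
      have h3 := hσ i ((ε i).symm 0)
      have h4 := hσ j ((ε j).symm 0)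
      rw [Equiv.apply_symm_apply] at h3 h4
      rw [hij, ← h4] at h3
      have := σ.injective h3
      simp only [Sum.inl.injEq, Prod.mk.injEq] at this
      exact this.1
    let T : Equiv.Perm (Fin m) := Equiv.ofBijective τ (Finite.injective_iff_bijective.1 hτi)
    -- A permutation with nonzero term permutes the pairs by `T` and flips pair `i` by `ε i`. The
    -- permutation `T` acts on two copies of `Fin m`, so it does not affect the sign, and the signs
    -- of the flips are squared against the values of `β`.
    have hσ' : σ = ((Equiv.prodCongrLeft fun _ : Fin 2 => T) * Equiv.prodCongrRight ε).sumCongr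
        (1 : Equiv.Perm (Fin 1)) := by
      ext1 x
      rcases x with ⟨i, b⟩ | c
      · rw [hσ]; rfl
      · obtain rfl : c = 0 := Subsingleton.elim _ _
        rw [hlast]; rfl
    have hs : Equiv.Perm.sign σ = ∏ i, Equiv.Perm.sign (ε i) := by
      rw [hσ', Equiv.Perm.sign_sumCongr, Equiv.Perm.sign_mul, Equiv.Perm.sign_prodCongrLeft,
        Equiv.Perm.sign_prodCongrRight]
      simp
    rw [hlast, hη1, mul_one, hs]
    simp only [hσ, hβ1]
    push_cast
    rw [← Finset.prod_mul_distrib]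
    refine Finset.prod_nonneg fun i _ => ?_
    exact mul_self_nonneg _
  · rw [MultilinearMap.domDomCongr_apply, wedgeProduct_apply]
    have := fun i => hβ1 i 1
    simp only [Equiv.Perm.coe_one, id, Equiv.Perm.sign_one] at this
    simp [this, hη1]

/-- The rank of `β` in a Darboux frame. -/
lemma finrank_range_of_bijective (hξ : Function.Bijective ξ)
    (hβ : ∀ u v, β u v = ∑ i, (ξ u (Sum.inl (i, 0)) * ξ v (Sum.inl (i, 1)) -
      ξ u (Sum.inl (i, 1)) * ξ v (Sum.inl (i, 0)))) :
    Module.finrank ℝ (LinearMap.range β) = 2 * m := by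
  let Ξ : V ≃ₗ[ℝ] WedgeIndex m → ℝ := LinearEquiv.ofBijective ξ hξ
  have : FiniteDimensional ℝ V := Ξ.symm.finiteDimensional
  have hV : Module.finrank ℝ V = 2 * m + 1 := by rw [Ξ.finrank_eq]; simp; ring
  let v := fun j => Ξ.symm (Pi.single j 1)
  have hv : ∀ j, ξ (v j) = Pi.single j 1 := fun j => Ξ.apply_symm_apply _
  -- Pairing with the frame vectors kills all coordinates but the last, so the kernel is a line.
  have hker : LinearMap.ker β = Submodule.span ℝ {v (Sum.inr 0)} := by
    ext u
    rw [LinearMap.mem_ker, Submodule.mem_span_singleton]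
    constructor
    · intro hu
      refine ⟨ξ u (Sum.inr 0), hξ.1 ?_⟩
      rw [map_smul, hv]
      ext j
      rcases j with ⟨i, b⟩ | c
      · have h0 : ∀ w, ∑ l, (ξ u (Sum.inl (l, 0)) * ξ w (Sum.inl (l, 1)) -
            ξ u (Sum.inl (l, 1)) * ξ w (Sum.inl (l, 0))) = 0 := fun w => by rw [← hβ, hu]; rfl
        have h1 : ∀ c, ξ u (Sum.inl (i, c)) = 0 := by
          intro c
          fin_cases c
          · have := h0 (v (Sum.inl (i, 1)))
            rw [Finset.sum_eq_single i] at this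
            · simpa [hv] using this
            · intro l _ hl; simp [hv, hl]
            · simp
          · have := h0 (v (Sum.inl (i, 0)))
            rw [Finset.sum_eq_single i] at this
            · simpa [hv] using this
            · intro l _ hl; simp [hv, hl]
            · simp
        simp [h1]
      · obtain rfl : c = 0 := Subsingleton.elim _ _
        simp
    · rintro ⟨c, rfl⟩
      ext w
      simp [hβ, hv]
  have hne : v (Sum.inr 0) ≠ 0 := by
    intro h
    have := hv (Sum.inr 0)
    rw [h, map_zero] at this
    simpa using congrFun this (Sum.inr 0)
  have h1 := LinearMap.finrank_range_add_finrank_ker β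
  rw [hker, finrank_span_singleton hne, hV] at h1
  omega

end ExteriorPower

/-! ### Alternating `2`-forms as bilinear forms. -/

section Pairing

variable {V V' : Type*} [AddCommGroup V] [Module ℝ V] [AddCommGroup V'] [Module ℝ V']

/-- The bilinear form of an alternating `2`-form. -/
def AlternatingMap.pairing (α : V [⋀^Fin 2]→ₗ[ℝ] ℝ) : V →ₗ[ℝ] V →ₗ[ℝ] ℝ where
  toFun u := (AlternatingMap.ofSubsingleton ℝ V ℝ (0 : Fin 1)).symm (α.curryLeft u)
  map_add' u v := by rw [map_add]; rfl
  map_smul' c u := by rw [map_smul]; rfl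

lemma AlternatingMap.pairing_apply (α : V [⋀^Fin 2]→ₗ[ℝ] ℝ) (u v : V) :
    α.pairing u v = α ![u, v] := by
  change α (Matrix.vecCons u fun _ => v) = _
  congr 1
  ext i; fin_cases i <;> rfl

lemma AlternatingMap.pairing_swap (α : V [⋀^Fin 2]→ₗ[ℝ] ℝ) (u v : V) :
    α.pairing u v = -α.pairing v u := by
  rw [α.pairing_apply, α.pairing_apply, ← α.map_swap _ (show (0 : Fin 2) ≠ 1 by decide)]
  congr 1
  ext i; fin_cases i <;> rfl

/-- The two maps differ by an identification of `1`-forms with linear forms, so they have the same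
kernel. -/
lemma AlternatingMap.finrank_range_curryLeft [FiniteDimensional ℝ V] (α : V [⋀^Fin 2]→ₗ[ℝ] ℝ) :
    Module.finrank ℝ (LinearMap.range α.curryLeft) =
      Module.finrank ℝ (LinearMap.range α.pairing) := by
  have h1 : LinearMap.ker α.curryLeft = LinearMap.ker α.pairing := by
    ext u
    rw [LinearMap.mem_ker, LinearMap.mem_ker]
    exact ((AlternatingMap.ofSubsingleton ℝ V ℝ (0 : Fin 1)).symm.injective.eq_iff
      (a := α.curryLeft u) (b := 0)).symm
  have h2 := LinearMap.finrank_range_add_finrank_ker α.curryLeft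
  have h3 := LinearMap.finrank_range_add_finrank_ker α.pairing
  rw [h1] at h2
  omega

end Pairing

/-! ### The Darboux coframe of a Lagrangian and the kernel of `Ω` at degenerate points. -/

section Darboux

variable {n N k : ℕ} {F : JetModel n N → ℝ} {U : Set (JetModel n N)} {z : JetModel n N}

/-- The coframe `(ω_s^A, dp_A^s - (d_T p_A^s) dt, dt)` attached to a Lagrangian. -/
def darbouxMap (k : ℕ) (F : JetModel n N → ℝ) (z : JetModel n N) :
    JetModel n N →ₗ[ℝ] WedgeIndex (k * n) → ℝ where
  toFun u := Sum.elim
    (fun x => ![contactForm (finProdFinEquiv.symm x.1).1 z u (finProdFinEquiv.symm x.1).2,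
      momentumForm k F (finProdFinEquiv.symm x.1).1 z u
        (EuclideanSpace.single (finProdFinEquiv.symm x.1).2 1)] x.2)
    fun _ => u.1
  map_add' u v := by
    ext x; rcases x with ⟨i, b⟩ | c
    · fin_cases b <;> simp
    · simp
  map_smul' c u := by
    ext x; rcases x with ⟨i, b⟩ | c
    · fin_cases b <;> simp
    · simp

lemma darbouxMap_inl_zero (u : JetModel n N) (s : Fin k) (a : Fin n) :
    darbouxMap k F z u (Sum.inl (finProdFinEquiv (s, a), 0)) = contactForm s z u a := by
  simp only [darbouxMap, LinearMap.coe_mk, AddHom.coe_mk, Sum.elim_inl,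
    Equiv.symm_apply_apply, Matrix.cons_val_zero]

lemma darbouxMap_inl_one (u : JetModel n N) (s : Fin k) (a : Fin n) :
    darbouxMap k F z u (Sum.inl (finProdFinEquiv (s, a), 1)) =
      momentumForm k F s z u (EuclideanSpace.single a 1) := by
  simp only [darbouxMap, LinearMap.coe_mk, AddHom.coe_mk, Sum.elim_inl,
    Equiv.symm_apply_apply, Matrix.cons_val_one, Matrix.cons_val_fin_one]

lemma apply_eq_sum_single (D : Fib n →L[ℝ] ℝ) (w : Fib n) :
    D w = ∑ a, w a * D (EuclideanSpace.single a 1) := by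
  conv_lhs => rw [← (EuclideanSpace.basisFun (Fin n) ℝ).sum_repr w]
  simp

lemma eq_zero_of_apply_single {D : Fib n →L[ℝ] ℝ}
    (h : ∀ a, D (EuclideanSpace.single a 1) = 0) : D = 0 := by
  ext w
  rw [apply_eq_sum_single]
  simp [h]

/-- Once `dt` vanishes on a vector, `ω_s` reduces to `dq_s` and the momentum form to `dp^s`. -/
lemma injective_darbouxMap_iff :
    Function.Injective (darbouxMap k F z) ↔ IsRegularAt k F z := by
  rw [injective_iff_map_eq_zero]
  have hc : ∀ s (u : JetModel n N), u.1 = 0 → contactForm s z u = qCoord s u := fun s u h => by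
    rw [contactForm_apply, h, zero_smul, sub_zero]
  have hm : ∀ s (u : JetModel n N), u.1 = 0 →
      momentumForm k F s z u = fderiv ℝ (momentum k F s) z u := fun s u h => by
    rw [momentumForm_apply, h, zero_smul, sub_zero]
  refine forall_congr' fun u => ⟨fun h h1 h2 h3 => h ?_, fun h h0 => ?_⟩
  · ext x
    rcases x with ⟨i, b⟩ | c
    · obtain ⟨⟨s, a⟩, rfl⟩ := finProdFinEquiv.surjective i
      fin_cases b
      · refine (darbouxMap_inl_zero u s a).trans ?_
        rw [hc _ _ h1, h2 s s.2]; rfl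
      · refine (darbouxMap_inl_one u s a).trans ?_
        rw [hm _ _ h1, h3 s s.2]; rfl
    · exact h1
  · have h1 : u.1 = 0 := congrFun h0 (Sum.inr 0)
    refine h h1 (fun s hs => ?_) fun s hs => ?_
    · rw [← hc s u h1]
      ext a
      exact (darbouxMap_inl_zero u ⟨s, hs⟩ a).symm.trans (congrFun h0 _)
    · rw [← hm s u h1]
      exact eq_zero_of_apply_single fun a =>
        (darbouxMap_inl_one u ⟨s, hs⟩ a).symm.trans (congrFun h0 _)

lemma neg_extDeriv_cartanOne_eq (hU : IsOpen U) (hF : ContDiffOn ℝ ∞ F U)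
    (h : IndepAbove k F) (hk : 1 ≤ k) (hN : k ≤ N) (hz : z ∈ U) (u v : JetModel n N) :
    (-extDeriv (cartanOne k F) z) ![u, v] =
      ∑ s ∈ Finset.range k, (momentumForm k F s z v (contactForm s z u) -
        momentumForm k F s z u (contactForm s z v)) := by
  change -(extDeriv (cartanOne k F) z ![u, v]) = _
  rw [extDeriv_cartanOne_apply hU hF hz, fderiv_cartanForm_sub hU hF h hk hN hz,
    ← Finset.sum_neg_distrib]
  exact Finset.sum_congr rfl fun s _ => neg_sub _ _

lemma neg_extDeriv_cartanOne_eq_darboux (hU : IsOpen U) (hF : ContDiffOn ℝ ∞ F U)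
    (h : IndepAbove k F) (hk : 1 ≤ k) (hN : k ≤ N) (hz : z ∈ U) (u v : JetModel n N) :
    (-extDeriv (cartanOne k F) z) ![u, v] =
      ∑ i, (darbouxMap k F z u (Sum.inl (i, 0)) * darbouxMap k F z v (Sum.inl (i, 1)) -
        darbouxMap k F z u (Sum.inl (i, 1)) * darbouxMap k F z v (Sum.inl (i, 0))) := by
  rw [neg_extDeriv_cartanOne_eq hU hF h hk hN hz, ← finProdFinEquiv.sum_comp,
    Fintype.sum_prod_type, Finset.sum_range]
  refine Finset.sum_congr rfl fun s _ => ?_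
  rw [apply_eq_sum_single (momentumForm k F s z v), apply_eq_sum_single (momentumForm k F s z u),
    ← Finset.sum_sub_distrib]
  refine Finset.sum_congr rfl fun a _ => ?_
  rw [darbouxMap_inl_zero, darbouxMap_inl_zero, darbouxMap_inl_one, darbouxMap_inl_one]
  ring

/-- At a degenerate point some vector annihilates both `dt` and the Poincaré-Cartan `2`-form. -/
lemma exists_ne_zero_of_not_isRegularAt (hU : IsOpen U) (hF : ContDiffOn ℝ ∞ F U)
    (h : IndepAbove k F) (hk : 1 ≤ k) (hN : k ≤ N) (hz : z ∈ U) (hr : ¬IsRegularAt k F z) :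
    ∃ u : JetModel n N, u ≠ 0 ∧ u.1 = 0 ∧ ∀ v, (-extDeriv (cartanOne k F) z) ![u, v] = 0 := by
  rw [← injective_darbouxMap_iff, injective_iff_map_eq_zero] at hr
  push Not at hr
  obtain ⟨u, hu, hu0⟩ := hr
  refine ⟨u, hu0, congrFun hu (Sum.inr 0), fun v => ?_⟩
  rw [neg_extDeriv_cartanOne_eq_darboux hU hF h hk hN hz]
  simp [hu]

/-- A nondegenerate Hessian `∂²L/∂q_k∂q_k` makes the Lagrangian regular. -/
lemma isRegularAt_of_injective (hU : IsOpen U) (hF : ContDiffOn ℝ ∞ F U)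
    (h : IndepAbove k F) (hN : N + 1 = 2 * k) (hz : z ∈ U)
    (hW : ∀ a, fderiv ℝ (partialQ F k) z (qDirection n N k a) = 0 → a = 0) :
    IsRegularAt k F z := by
  intro u h1 h2 h3
  -- The system is triangular: `p^{k-1-j}` has order at most `k + j`, and its derivative in
  -- `q_{k+j}` is the Hessian up to sign. When the lower coordinates of `u` vanish, its differential
  -- gives the equation for the coordinate of order `k + j`.
  have key : ∀ j, j < k → qCoord (k + j) u = 0 := by
    intro j
    induction j using Nat.strong_induction_on with
    | _ j ih =>
      intro hj
      have hs : k - 1 - j < k := by omega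
      have h4 := h3 _ hs
      rw [apply_decomp_of_le (m := k + j + 1) _ (by omega) (fun i hi a =>
        (momentum_indepAbove h hs).fderiv_qDirection (by omega) z a), h1, zero_smul, zero_add,
        Finset.sum_eq_single (k + j)] at h4
      · have h5 := fderiv_momentum_top hU hF h hs (by omega) hz (qCoord (k + j) u)
        rw [show 2 * k - 1 - (k - 1 - j) = k + j by omega, h4] at h5
        exact hW _ ((smul_eq_zero.1 h5.symm).resolve_left (pow_ne_zero _ (by norm_num)))
      · intro i hi hne
        have h6 : qCoord i u = 0 := by
          have := Finset.mem_range.1 hi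
          by_cases hik : i < k
          · exact h2 i hik
          · have := ih (i - k) (by omega) (by omega)
            rwa [show k + (i - k) = i by omega] at this
        rw [h6, map_zero, map_zero]
      · intro h'; exact absurd (Finset.mem_range.2 (by omega)) h'
  refine jetModel_ext (by rw [h1]; rfl) fun i hi => ?_
  have h0 : qCoord i (0 : JetModel n N) = 0 := by rw [← qCoordL_apply, map_zero]
  rw [h0]
  by_cases hik : i < k
  · exact h2 i hik
  · have := key (i - k) (by omega)
    rwa [show k + (i - k) = i by omega] at this

lemma contactForm_jetVelocity {s : ℕ} (hs : s < N + 1) :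
    contactForm s z (jetVelocity z) = 0 := by
  rw [contactForm_apply, qCoord_jetVelocity hs]
  simp [jetVelocity]

lemma momentumForm_jetVelocity {s : ℕ} (hs : s ≠ 0) :
    momentumForm k F s z (jetVelocity z) = 0 := by
  rw [momentumForm_apply, momentumRate, if_neg hs, totalDeriv_eq]
  simp [jetVelocity]

/-- For `k ≥ 2` the kernel of the Poincaré-Cartan `2`-form has dimension at least `2` at a
degenerate point. -/
lemma two_le_finrank_ker (hU : IsOpen U) (hF : ContDiffOn ℝ ∞ F U) (h : IndepAbove k F)
    (hk : 2 ≤ k) (hN : N + 1 = 2 * k) (hz : z ∈ U) (hr : ¬IsRegularAt k F z) :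
    2 ≤ Module.finrank ℝ (LinearMap.ker
      (-extDeriv (cartanOne k F) z).toAlternatingMap.pairing) := by
  obtain ⟨a, ha, ha0⟩ : ∃ a, fderiv ℝ (partialQ F k) z (qDirection n N k a) = 0 ∧ a ≠ 0 := by
    by_contra! hW
    exact hr (isRegularAt_of_injective hU hF h hN hz hW)
  -- Since `k ≥ 2`, the order `2k - 2` is at least `k`, so these directions are invisible to the
  -- contact forms of order below `k`. For `k = 1` it would be the order of `q_0`.
  let B : ℝ × ℝ × Fib n →ₗ[ℝ] JetModel n N :=
    (LinearMap.toSpanSingleton ℝ _ (jetVelocity z)).coprod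
      ((LinearMap.toSpanSingleton ℝ _ (qDirection n N (2 * k - 2) a)).coprod
        (qDirection n N (2 * k - 1)).toLinearMap)
  have hB : ∀ p, B p = p.1 • jetVelocity z + (p.2.1 • qDirection n N (2 * k - 2) a +
      qDirection n N (2 * k - 1) p.2.2) := fun p => rfl
  have hBi : Function.Injective B := by
    rw [injective_iff_map_eq_zero]
    rintro ⟨c, d, b⟩ h0
    rw [hB] at h0
    have hc : c = 0 := by
      have := congrArg Prod.fst h0
      simpa [jetVelocity] using this
    have hq : ∀ i, qCoord i (0 : JetModel n N) = 0 := fun i => by rw [← qCoordL_apply, map_zero]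
    rw [hc, zero_smul, zero_add] at h0
    have hd := congrArg (qCoord (2 * k - 2)) h0
    have hb := congrArg (qCoord (2 * k - 1)) h0
    rw [qCoord_add, qCoord_smul, hq, qCoord_qDirection_self (by omega),
      qCoord_qDirection_of_ne (by omega), add_zero] at hd
    rw [qCoord_add, qCoord_smul, hq, qCoord_qDirection_self (by omega),
      qCoord_qDirection_of_ne (by omega), smul_zero, zero_add] at hb
    exact Prod.ext hc (Prod.ext ((smul_eq_zero.1 hd).resolve_right ha0) hb)
  have hBc : ∀ s < k, ∀ p, contactForm s z (B p) = 0 := by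
    intro s hs p
    rw [hB, map_add, map_add, map_smul, map_smul, contactForm_jetVelocity (by omega),
      contactForm_apply, contactForm_apply, qCoord_qDirection_of_ne (by omega),
      qCoord_qDirection_of_ne (by omega)]
    simp
  -- The velocity is killed by the choice of the rate. By orders, `q_{2k-1}` affects only `p^0`, and
  -- `q_{2k-2}` only `p^0` and `p^1`; the derivative of `p^1` is the Hessian up to sign, and
  -- vanishes on `a`.
  have hBm : ∀ s < k, s ≠ 0 → ∀ p, momentumForm k F s z (B p) = 0 := by
    intro s hs h0 p
    have h1 : fderiv ℝ (momentum k F s) z (qDirection n N (2 * k - 2) a) = 0 := by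
      by_cases h1 : s = 1
      · have := fderiv_momentum_top hU hF h hs (by omega) hz a
        rw [ha, smul_zero] at this
        rwa [show 2 * k - 2 = 2 * k - 1 - s by omega]
      · exact (momentum_indepAbove h hs).fderiv_qDirection (by omega) z a
    rw [hB, map_add, map_add, map_smul, map_smul, momentumForm_jetVelocity h0,
      momentumForm_apply, momentumForm_apply, h1,
      (momentum_indepAbove h hs).fderiv_qDirection (by omega)]
    simp
  -- Only the `n` conditions of order zero remain on a space of dimension `n + 2`.
  let Ψ : ℝ × ℝ × Fib n →ₗ[ℝ] Fib n →L[ℝ] ℝ := (momentumForm k F 0 z).toLinearMap ∘ₗ B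
  have hle : (LinearMap.ker Ψ).map B ≤ LinearMap.ker
      (-extDeriv (cartanOne k F) z).toAlternatingMap.pairing := by
    rintro _ ⟨p, hp, rfl⟩
    have hp' : momentumForm k F 0 z (B p) = 0 := hp
    rw [LinearMap.mem_ker]
    refine LinearMap.ext fun v => ?_
    rw [AlternatingMap.pairing_apply]
    refine (neg_extDeriv_cartanOne_eq hU hF h (by omega) (by omega) hz (B p) v).trans ?_
    refine Finset.sum_eq_zero fun s hs => ?_
    have hs' := Finset.mem_range.1 hs
    rw [hBc s hs', map_zero]
    by_cases h0 : s = 0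
    · subst h0; rw [hp']; simp
    · rw [hBm s hs' h0]; simp
  have h1 := LinearMap.finrank_range_add_finrank_ker Ψ
  have h2 : Module.finrank ℝ (LinearMap.range Ψ) ≤ n := by
    refine (Submodule.finrank_le _).trans ?_
    rw [← (LinearMap.toContinuousLinearMap (𝕜 := ℝ) (E := Fib n) (F' := ℝ)).finrank_eq,
      Module.finrank_linearMap]
    simp
  have h3 : Module.finrank ℝ (ℝ × ℝ × Fib n) = n + 2 := by simp; ring
  have h4 := Submodule.finrank_mono hle
  rw [← (Submodule.equivMapOfInjective B hBi (LinearMap.ker Ψ)).finrank_eq] at h4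
  omega

end Darboux

/-! ### Rank and volume condition at a jet in terms of regularity. -/

section Pointwise

variable {n : ℕ} {E : Type*} [TopologicalSpace E]
  [ChartedSpace (EuclideanSpace ℝ (Fin (n + 1))) E] [IsManifold (𝓡 (n + 1)) ∞ E]
  {π : E → ℝ} [hπ : IsBundleOverLine n π] {k : ℕ} {L : Jet n π k → ℝ}

lemma finrank_jetModel (hk : 1 ≤ k) :
    Module.finrank ℝ (JetModel n (2 * k - 1)) = 2 * (k * n) + 1 := by
  rw [Module.finrank_prod, Module.finrank_self, Module.finrank_pi_fintype]
  simp only [finrank_euclideanSpace, Fintype.card_fin, Finset.sum_const, Finset.card_univ,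
    smul_eq_mul]
  rw [show 2 * k - 1 + 1 = 2 * k by omega]
  ring

/-- The tangent spaces are modelled on the jet coordinates. -/
def AdaptedChart.tangentEquiv (e : AdaptedChart n π) {y : Jet n π (2 * k - 1)}
    (hy : y.pt ∈ e.chart.source) :
    TangentSpace 𝓘(ℝ, JetModel n (2 * k - 1)) y ≃ₗ[ℝ] JetModel n (2 * k - 1) :=
  (e.isInvertible_tangentMap hy).choose.toLinearEquiv

lemma AdaptedChart.tangentEquiv_apply (e : AdaptedChart n π) {y : Jet n π (2 * k - 1)}
    (hy : y.pt ∈ e.chart.source) (u : TangentSpace 𝓘(ℝ, JetModel n (2 * k - 1)) y) :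
    e.tangentEquiv hy u = e.tangentMap y u :=
  congrArg (fun D : TangentSpace 𝓘(ℝ, JetModel n (2 * k - 1)) y →L[ℝ] JetModel n (2 * k - 1) =>
    D u) (e.isInvertible_tangentMap hy).choose_spec

instance (y : Jet n π (2 * k - 1)) :
    FiniteDimensional ℝ (TangentSpace 𝓘(ℝ, JetModel n (2 * k - 1)) y) :=
  inferInstanceAs (FiniteDimensional ℝ (JetModel n (2 * k - 1)))

lemma finrank_tangentSpace (hk : 1 ≤ k) (y : Jet n π (2 * k - 1)) :
    Module.finrank ℝ (TangentSpace 𝓘(ℝ, JetModel n (2 * k - 1)) y) = 2 * (k * n) + 1 :=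
  finrank_jetModel hk

lemma poincareCartanTwo_apply (e : AdaptedChart n π)
    (hL : ContMDiff 𝓘(ℝ, JetModel n k) 𝓘(ℝ, ℝ) ∞ L) (hk : 1 ≤ k) {y : Jet n π (2 * k - 1)}
    (hy : y.pt ∈ e.chart.source) (u v : TangentSpace 𝓘(ℝ, JetModel n (2 * k - 1)) y) :
    poincareCartanTwo L y ![u, v] =
      (-extDeriv (cartanOne k (e.lagrangian L)) (e.coords (2 * k - 1) y))
        ![e.tangentEquiv hy u, e.tangentEquiv hy v] := by
  rw [poincareCartanTwo_eq e hL hk hy, e.tangentEquiv_apply, e.tangentEquiv_apply]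
  change (-extDeriv (cartanOne k (e.lagrangian L)) (e.coords (2 * k - 1) y)) _ = _
  congr 1
  ext1 i; fin_cases i <;> rfl

lemma powWedge_eq (e : AdaptedChart n π) {y : Jet n π (2 * k - 1)}
    (hy : y.pt ∈ e.chart.source) (m : ℕ)
    (v : Fin (2 * m + 1) → TangentSpace 𝓘(ℝ, JetModel n (2 * k - 1)) y) :
    DiffForm.powWedge m (poincareCartanTwo L) (timeForm n π k) y v =
      (2 ^ m : ℝ)⁻¹ * MultilinearMap.alternatization (wedgeProduct m
        (poincareCartanTwo L y).toAlternatingMap.pairing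
        (LinearMap.fst ℝ ℝ _ ∘ₗ (e.tangentEquiv hy).toLinearMap)) (v ∘ wedgeIndexEquiv m) := by
  rw [← sum_perm_wedge_eq, DiffForm.powWedge]
  congr 1
  refine Finset.sum_congr rfl fun σ _ => ?_
  rw [timeForm_apply e hy]
  simp only [AlternatingMap.pairing_apply, LinearMap.comp_apply, LinearMap.fst_apply,
    LinearEquiv.coe_coe, e.tangentEquiv_apply]
  rfl

lemma pairing_poincareCartanTwo (e : AdaptedChart n π)
    (hL : ContMDiff 𝓘(ℝ, JetModel n k) 𝓘(ℝ, ℝ) ∞ L) (hk : 1 ≤ k) {y : Jet n π (2 * k - 1)}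
    (hy : y.pt ∈ e.chart.source) (u v : TangentSpace 𝓘(ℝ, JetModel n (2 * k - 1)) y) :
    (poincareCartanTwo L y).toAlternatingMap.pairing u v =
      (-extDeriv (cartanOne k (e.lagrangian L))
        (e.coords (2 * k - 1) y)).toAlternatingMap.pairing
        (e.tangentEquiv hy u) (e.tangentEquiv hy v) := by
  rw [AlternatingMap.pairing_apply, AlternatingMap.pairing_apply]
  exact poincareCartanTwo_apply e hL hk hy u v

/-- The coframe of `darbouxMap` on the tangent space of the jet manifold. -/
def AdaptedChart.darboux (e : AdaptedChart n π) (L : Jet n π k → ℝ) {y : Jet n π (2 * k - 1)}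
    (hy : y.pt ∈ e.chart.source) :
    TangentSpace 𝓘(ℝ, JetModel n (2 * k - 1)) y →ₗ[ℝ] WedgeIndex (k * n) → ℝ :=
  darbouxMap k (e.lagrangian L) (e.coords (2 * k - 1) y) ∘ₗ (e.tangentEquiv hy).toLinearMap

/-- There are as many forms in the coframe as the dimension `2kn + 1` of the jet space, so
injectivity suffices. -/
lemma AdaptedChart.bijective_darboux (e : AdaptedChart n π) (hk : 1 ≤ k)
    {y : Jet n π (2 * k - 1)} (hy : y.pt ∈ e.chart.source)
    (hr : IsRegularAt k (e.lagrangian L) (e.coords (2 * k - 1) y)) :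
    Function.Bijective (e.darboux L hy) := by
  have hi : Function.Injective (e.darboux L hy) :=
    (injective_darbouxMap_iff.2 hr).comp (e.tangentEquiv hy).injective
  refine ⟨hi, (LinearMap.injective_iff_surjective_of_finrank_eq_finrank ?_).1 hi⟩
  rw [finrank_tangentSpace hk]
  simp; ring

lemma AdaptedChart.pairing_eq_darboux (e : AdaptedChart n π)
    (hL : ContMDiff 𝓘(ℝ, JetModel n k) 𝓘(ℝ, ℝ) ∞ L) (hk : 1 ≤ k) {y : Jet n π (2 * k - 1)}
    (hy : y.pt ∈ e.chart.source) (u v : TangentSpace 𝓘(ℝ, JetModel n (2 * k - 1)) y) :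
    (poincareCartanTwo L y).toAlternatingMap.pairing u v =
      ∑ i, (e.darboux L hy u (Sum.inl (i, 0)) * e.darboux L hy v (Sum.inl (i, 1)) -
        e.darboux L hy u (Sum.inl (i, 1)) * e.darboux L hy v (Sum.inl (i, 0))) := by
  rw [AlternatingMap.pairing_apply]
  exact (poincareCartanTwo_apply e hL hk hy u v).trans
    (neg_extDeriv_cartanOne_eq_darboux (e.isOpen_jetDomain _) (e.contDiffOn_lagrangian hL)
      (e.indepAbove_lagrangian L) hk (by omega) (e.coords_mem_jetDomain hy) _ _)

/-- The volume condition is the regularity of the Lagrangian. -/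
lemma exists_powWedge_ne_zero_iff (e : AdaptedChart n π)
    (hL : ContMDiff 𝓘(ℝ, JetModel n k) 𝓘(ℝ, ℝ) ∞ L) (hk : 1 ≤ k) {y : Jet n π (2 * k - 1)}
    (hy : y.pt ∈ e.chart.source) :
    (∃ v, DiffForm.powWedge (k * n) (poincareCartanTwo L) (timeForm n π k) y v ≠ 0) ↔
      IsRegularAt k (e.lagrangian L) (e.coords (2 * k - 1) y) := by
  constructor
  · rintro ⟨v, hv⟩
    by_contra hr
    obtain ⟨u, hu0, hu1, hu⟩ := exists_ne_zero_of_not_isRegularAt (e.isOpen_jetDomain _)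
      (e.contDiffOn_lagrangian hL) (e.indepAbove_lagrangian L) hk (by omega)
      (e.coords_mem_jetDomain hy) hr
    have h1 : ∀ w, (poincareCartanTwo L y).toAlternatingMap.pairing
        ((e.tangentEquiv hy).symm u) w = 0 := fun w => by
      rw [AlternatingMap.pairing_apply]
      refine (poincareCartanTwo_apply e hL hk hy _ _).trans ?_
      rw [LinearEquiv.apply_symm_apply, hu]
    refine hv ?_
    rw [powWedge_eq e hy, alternatization_wedgeProduct_eq_zero (finrank_tangentSpace hk y)
      (u := (e.tangentEquiv hy).symm u) (by simpa using hu0) h1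
      (fun w => by rw [AlternatingMap.pairing_swap, h1, neg_zero]) (by simpa using hu1), mul_zero]
  · intro hr
    obtain ⟨v, hv⟩ := exists_alternatization_wedgeProduct_ne_zero
      (e.bijective_darboux hk hy hr).2 (e.pairing_eq_darboux hL hk hy)
      (η := LinearMap.fst ℝ ℝ _ ∘ₗ (e.tangentEquiv hy).toLinearMap) (fun _ => rfl)
    refine ⟨v ∘ (wedgeIndexEquiv (k * n)).symm, ?_⟩
    rw [powWedge_eq e hy, Function.comp_assoc, Equiv.symm_comp_self, Function.comp_id]
    exact mul_ne_zero (by positivity) hv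

lemma rank_poincareCartanTwo_of_isRegularAt (e : AdaptedChart n π)
    (hL : ContMDiff 𝓘(ℝ, JetModel n k) 𝓘(ℝ, ℝ) ∞ L) (hk : 1 ≤ k) {y : Jet n π (2 * k - 1)}
    (hy : y.pt ∈ e.chart.source)
    (hr : IsRegularAt k (e.lagrangian L) (e.coords (2 * k - 1) y)) :
    DiffForm.rank (poincareCartanTwo L) y = 2 * (k * n) :=
  (AlternatingMap.finrank_range_curryLeft _).trans
    (finrank_range_of_bijective (e.bijective_darboux hk hy hr) (e.pairing_eq_darboux hL hk hy))

/-- Rank-nullity in dimension `2kn + 1`: rank `2kn` leaves a kernel of dimension one, whereas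
degeneracy forces at least two. -/
lemma isRegularAt_of_rank_poincareCartanTwo (e : AdaptedChart n π)
    (hL : ContMDiff 𝓘(ℝ, JetModel n k) 𝓘(ℝ, ℝ) ∞ L) (hk : 2 ≤ k) {y : Jet n π (2 * k - 1)}
    (hy : y.pt ∈ e.chart.source)
    (hr : DiffForm.rank (poincareCartanTwo L) y = 2 * (k * n)) :
    IsRegularAt k (e.lagrangian L) (e.coords (2 * k - 1) y) := by
  by_contra h
  have h1 := two_le_finrank_ker (e.isOpen_jetDomain _)
      (e.contDiffOn_lagrangian hL) (e.indepAbove_lagrangian L) hk (by omega)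
      (e.coords_mem_jetDomain hy) h
  have h2 : LinearMap.ker (-extDeriv (cartanOne k (e.lagrangian L))
        (e.coords (2 * k - 1) y)).toAlternatingMap.pairing ≤
      (LinearMap.ker (poincareCartanTwo L y).toAlternatingMap.pairing).map
        (e.tangentEquiv hy).toLinearMap := by
    intro u hu
    refine ⟨(e.tangentEquiv hy).symm u, ?_, by simp⟩
    refine LinearMap.mem_ker.2 (LinearMap.ext fun w => ?_)
    rw [pairing_poincareCartanTwo e hL (by omega) hy, LinearEquiv.apply_symm_apply,
      LinearMap.mem_ker.1 hu]
    rfl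
  have h3 := Submodule.finrank_mono h2
  have h4 := LinearMap.finrank_range_add_finrank_ker
    (poincareCartanTwo L y).toAlternatingMap.pairing
  have h5 : Module.finrank ℝ (LinearMap.range
      (poincareCartanTwo L y).toAlternatingMap.pairing) = 2 * (k * n) :=
    (AlternatingMap.finrank_range_curryLeft _).symm.trans hr
  rw [finrank_tangentSpace (by omega), h5] at h4
  have h6 := Submodule.finrank_map_le (e.tangentEquiv hy).toLinearMap
    (LinearMap.ker (poincareCartanTwo L y).toAlternatingMap.pairing)
  omega

end Pointwise

/-! ### Local representatives of the Legendre maps and the global equivalences. -/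

section LegendreCharts

variable {n : ℕ} {E : Type*} [TopologicalSpace E]
  [ChartedSpace (EuclideanSpace ℝ (Fin (n + 1))) E] [IsManifold (𝓡 (n + 1)) ∞ E]
  {π : E → ℝ} [hπ : IsBundleOverLine n π] {k r : ℕ} {L : Jet n π k → ℝ}

/-- The chart of `J^r π^*` induced by an adapted chart of `E`. -/
def AdaptedChart.dualChart (e : AdaptedChart n π) (r : ℕ) :
    OpenPartialHomeomorph (RestrictedDual n π r) (RestrictedModel n r) :=
  (restrictedCore n π r).openPartialHomeomorph (e.dualEquiv r) (mem_range_self e)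

lemma AdaptedChart.dualChart_mem_atlas (e : AdaptedChart n π) (r : ℕ) :
    e.dualChart r ∈ atlas (RestrictedModel n r) (RestrictedDual n π r) :=
  mem_iUnion.2 ⟨e.dualEquiv r, mem_iUnion.2 ⟨mem_range_self e, rfl⟩⟩

/-- The differential of the jet chart in the definition of the Legendre map cancels against its
inverse in the momentum coordinates. -/
lemma AdaptedChart.dualChart_restrictedLegendre (e : AdaptedChart n π)
    (hL : ContMDiff 𝓘(ℝ, JetModel n k) 𝓘(ℝ, ℝ) ∞ L) (hk : 1 ≤ k) {y : Jet n π (2 * k - 1)}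
    (hy : y.pt ∈ e.chart.source) :
    restrictedLegendre L y ∈ (e.dualChart (k - 1)).source ∧
      e.dualChart (k - 1) (restrictedLegendre L y) =
        legendreRes k (e.lagrangian L) (e.jetChart (2 * k - 1) y) := by
  have hy' : y.lower.pt ∈ e.chart.source := by rwa [Jet.pt_lower]
  rw [restrictedLegendre, extendedLegendre_eq e hL hk hy]
  refine ⟨hy', Prod.ext (e.coords_lower hy) ?_⟩
  refine (e.vert_out hy' _).trans ?_
  change (((legendreCovector k (e.lagrangian L) (e.coords (2 * k - 1) y)).comp
    (e.tangentMap y.lower)).comp (e.tangentMap y.lower).inverse).comp _ = _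
  rw [ContinuousLinearMap.comp_assoc _ (e.tangentMap y.lower),
    (e.isInvertible_tangentMap hy').self_comp_inverse]
  rfl

lemma isLocalDiffeomorphAt_restrictedLegendre_iff (e : AdaptedChart n π)
    (hL : ContMDiff 𝓘(ℝ, JetModel n k) 𝓘(ℝ, ℝ) ∞ L) (hk : 1 ≤ k) {y : Jet n π (2 * k - 1)}
    (hy : y.pt ∈ e.chart.source) :
    IsLocalDiffeomorphAt 𝓘(ℝ, JetModel n (2 * k - 1)) 𝓘(ℝ, RestrictedModel n (k - 1)) ∞
      (restrictedLegendre L) y ↔ IsRegularAt k (e.lagrangian L) (e.coords (2 * k - 1) y) := by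
  have hz := e.coords_mem_jetDomain hy
  have hF := e.contDiffOn_lagrangian hL
  rw [← injective_fderiv_legendreRes_iff (e.isOpen_jetDomain _) hF (e.indepAbove_lagrangian L)
    hk (by omega) hz]
  refine isLocalDiffeomorphAt_iff_injective (φ := e.jetChart (2 * k - 1))
    (ψ := e.dualChart (k - 1)) (U := e.jetDomain (2 * k - 1)) ?_
    (IsManifold.subset_maximalAtlas (e.jetChart_mem_atlas _))
    (IsManifold.subset_maximalAtlas (e.dualChart_mem_atlas _)) hy
    (e.dualChart_restrictedLegendre hL hk hy).1 (e.isOpen_jetDomain _)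
    (hF.legendreRes (e.isOpen_jetDomain _) k) hz ?_
  · rw [finrank_jetModel hk, Module.finrank_prod, Module.finrank_prod,
      ← (LinearMap.toContinuousLinearMap (𝕜 := ℝ) (E := Fin (k - 1 + 1) → Fib n)
        (F' := ℝ)).finrank_eq, Module.finrank_linearMap, Module.finrank_pi_fintype]
    simp [Nat.sub_add_cancel hk]
    ring
  · filter_upwards [e.mem_nhds_source hy] with w hw
    exact e.dualChart_restrictedLegendre hL hk hw

/-- The preferred chart of the cotangent bundle at `x` comes from the preferred jet chart at its
base point, hence the condition on `e`. In that chart the fibre coordinate of a covector pulled back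
by the differential of the jet chart is the original coordinate covector. -/
lemma chartAt_extendedLegendre (e : AdaptedChart n π) (x : JetCotangent n π (k - 1))
    (he : e = adaptedChartAt n π x.proj.pt)
    (hL : ContMDiff 𝓘(ℝ, JetModel n k) 𝓘(ℝ, ℝ) ∞ L) (hk : 1 ≤ k) {y : Jet n π (2 * k - 1)}
    (hy : y.pt ∈ e.chart.source) :
    extendedLegendre L y ∈ (chartAt (ModelProd (JetModel n (k - 1)) (JetModel n (k - 1) →L[ℝ] ℝ))
        x).source ∧
      chartAt (ModelProd (JetModel n (k - 1)) (JetModel n (k - 1) →L[ℝ] ℝ)) x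
        (extendedLegendre L y) =
        legendreExt k (e.lagrangian L) (e.jetChart (2 * k - 1) y) := by
  have hy' : y.lower.pt ∈ e.chart.source := by rwa [Jet.pt_lower]
  have hx : y.lower ∈ (chartAt (JetModel n (k - 1)) x.proj).source := by rw [he] at hy'; exact hy'
  rw [extendedLegendre_eq e hL hk hy]
  constructor
  · rw [FiberBundle.chartedSpace_chartAt]
    simp only [mfld_simps]
    exact ⟨⟨hx, trivial⟩, hx⟩
  · rw [FiberBundle.chartedSpace_chartAt]
    have h1 : ((e.tangentMap y.lower).comp ((trivializationAt (JetModel n (k - 1))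
        (TangentSpace 𝓘(ℝ, JetModel n (k - 1))) x.proj).symmL ℝ y.lower)) =
        ContinuousLinearMap.id ℝ (JetModel n (k - 1)) := by
      have h2 := TangentBundle.continuousLinearMapAt_trivializationAt
        (I := 𝓘(ℝ, JetModel n (k - 1))) hx
      have h3 : mfderiv 𝓘(ℝ, JetModel n (k - 1)) 𝓘(ℝ, JetModel n (k - 1))
        (extChartAt 𝓘(ℝ, JetModel n (k - 1)) x.proj) y.lower = e.tangentMap y.lower := by
        rw [he]; rfl
      rw [h3] at h2
      rw [← h2]
      refine ContinuousLinearMap.ext fun v => ?_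
      exact Bundle.Trivialization.continuousLinearMapAt_symmL _ hx v
    refine Prod.ext (he ▸ e.coords_lower hy) ?_
    change ContinuousLinearMap.inCoordinates (JetModel n (k - 1))
      (TangentSpace 𝓘(ℝ, JetModel n (k - 1))) ℝ (Bundle.Trivial (Jet n π (k - 1)) ℝ) x.proj y.lower
      x.proj y.lower ((legendreCovector k (e.lagrangian L) (e.coords (2 * k - 1) y)).comp
        (e.tangentMap y.lower)) = legendreCovector k (e.lagrangian L) (e.coords (2 * k - 1) y)
    have h4 := congrArg (fun D =>
      (legendreCovector k (e.lagrangian L) (e.coords (2 * k - 1) y)).comp D) h1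
    have h5 : (trivializationAt ℝ (Bundle.Trivial (Jet n π (k - 1)) ℝ)
        x.proj).continuousLinearMapAt ℝ y.lower = ContinuousLinearMap.id ℝ ℝ :=
      Bundle.Trivial.continuousLinearMapAt_trivialization ℝ _ _ _
    rw [ContinuousLinearMap.inCoordinates, h5]
    exact h4

lemma finrank_jetCotangentModel (hk : 1 ≤ k) :
    Module.finrank ℝ (JetModel n (2 * k - 1)) + Module.finrank ℝ ℝ =
      Module.finrank ℝ (JetModel n (k - 1) × (JetModel n (k - 1) →L[ℝ] ℝ)) := by
  rw [finrank_jetModel hk, Module.finrank_prod,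
    ← (LinearMap.toContinuousLinearMap (𝕜 := ℝ) (E := JetModel n (k - 1))
      (F' := ℝ)).finrank_eq, Module.finrank_linearMap, Module.finrank_prod,
    Module.finrank_pi_fintype]
  simp [Nat.sub_add_cancel hk]
  ring

/-- The extended Legendre-Ostrogradsky map is an immersion at a jet, in the model
`𝓘(ℝ, E × E')` of a product, exactly at the regular points. -/
lemma isImmersionAt_extendedLegendre (e : AdaptedChart n π) {y : Jet n π (2 * k - 1)}
    (he : e = adaptedChartAt n π y.lower.pt)
    (hL : ContMDiff 𝓘(ℝ, JetModel n k) 𝓘(ℝ, ℝ) ∞ L) (hk : 1 ≤ k)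
    (hr : IsRegularAt k (e.lagrangian L) (e.coords (2 * k - 1) y)) :
    Manifold.IsImmersionAtOfComplement ℝ 𝓘(ℝ, JetModel n (2 * k - 1))
      (𝓘(ℝ, JetModel n (k - 1)).prod 𝓘(ℝ, JetModel n (k - 1) →L[ℝ] ℝ)) ∞
      (extendedLegendre L) y := by
  have hy : y.pt ∈ e.chart.source := by
    rw [← Jet.pt_lower, he]; exact mem_adaptedChartAt_source _
  have hz := e.coords_mem_jetDomain hy
  have hF := e.contDiffOn_lagrangian hL
  have hψ := IsManifold.chart_mem_maximalAtlas
    (I := 𝓘(ℝ, JetModel n (k - 1)).prod 𝓘(ℝ, JetModel n (k - 1) →L[ℝ] ℝ)) (n := ∞)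
    (extendedLegendre L y)
  have hm : IsManifold (𝓘(ℝ, JetModel n (k - 1)).prod 𝓘(ℝ, JetModel n (k - 1) →L[ℝ] ℝ)) ∞
    (JetCotangent n π (k - 1)) := inferInstance
  -- The cotangent bundle carries a product model; it is rewritten as the trivial model on the
  -- product space, for which the immersion criterion is stated.
  rw [← modelWithCornersSelf_prod] at hm hψ ⊢
  let _ : ChartedSpace (JetModel n (k - 1) × (JetModel n (k - 1) →L[ℝ] ℝ))
      (JetCotangent n π (k - 1)) := inferInstanceAs (ChartedSpace
        (ModelProd (JetModel n (k - 1)) (JetModel n (k - 1) →L[ℝ] ℝ)) (JetCotangent n π (k - 1)))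
  have : IsManifold 𝓘(ℝ, JetModel n (k - 1) × (JetModel n (k - 1) →L[ℝ] ℝ)) ∞
    (JetCotangent n π (k - 1)) := hm
  exact isImmersionAtOfComplement_of_injective
    (H' := JetModel n (k - 1) × (JetModel n (k - 1) →L[ℝ] ℝ)) (φ := e.jetChart (2 * k - 1))
    (U := e.jetDomain (2 * k - 1)) (finrank_jetCotangentModel hk)
    (IsManifold.subset_maximalAtlas (e.jetChart_mem_atlas _)) hψ hy
    (e.isOpen_jetDomain _) (hF.legendreExt (e.isOpen_jetDomain _) k) hz
    (by filter_upwards [e.mem_nhds_source hy] with w hw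
        exact chartAt_extendedLegendre e _ he hL hk hw)
    ((injective_fderiv_legendreExt_iff (e.isOpen_jetDomain _) hF (e.indepAbove_lagrangian L)
      hk (by omega) hz).2 hr)

lemma isRegularAt_of_isImmersionAt (e : AdaptedChart n π) {y : Jet n π (2 * k - 1)}
    (he : e = adaptedChartAt n π y.lower.pt)
    (hL : ContMDiff 𝓘(ℝ, JetModel n k) 𝓘(ℝ, ℝ) ∞ L) (hk : 1 ≤ k) {G : Type*}
    [NormedAddCommGroup G] [NormedSpace ℝ G]
    (h : Manifold.IsImmersionAtOfComplement G 𝓘(ℝ, JetModel n (2 * k - 1))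
      (𝓘(ℝ, JetModel n (k - 1)).prod 𝓘(ℝ, JetModel n (k - 1) →L[ℝ] ℝ)) ∞
      (extendedLegendre L) y) :
    IsRegularAt k (e.lagrangian L) (e.coords (2 * k - 1) y) := by
  have hy : y.pt ∈ e.chart.source := by
    rw [← Jet.pt_lower, he]; exact mem_adaptedChartAt_source _
  have hz := e.coords_mem_jetDomain hy
  have hF := e.contDiffOn_lagrangian hL
  have hψ := IsManifold.chart_mem_maximalAtlas
    (I := 𝓘(ℝ, JetModel n (k - 1)).prod 𝓘(ℝ, JetModel n (k - 1) →L[ℝ] ℝ)) (n := ∞)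
    (extendedLegendre L y)
  have hm : IsManifold (𝓘(ℝ, JetModel n (k - 1)).prod 𝓘(ℝ, JetModel n (k - 1) →L[ℝ] ℝ)) ∞
    (JetCotangent n π (k - 1)) := inferInstance
  rw [← modelWithCornersSelf_prod] at hm hψ h
  refine (injective_fderiv_legendreExt_iff (e.isOpen_jetDomain _) hF (e.indepAbove_lagrangian L)
      hk (by omega) hz).1 ?_
  let _ : ChartedSpace (JetModel n (k - 1) × (JetModel n (k - 1) →L[ℝ] ℝ))
      (JetCotangent n π (k - 1)) := inferInstanceAs (ChartedSpace
        (ModelProd (JetModel n (k - 1)) (JetModel n (k - 1) →L[ℝ] ℝ)) (JetCotangent n π (k - 1)))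
  have : IsManifold 𝓘(ℝ, JetModel n (k - 1) × (JetModel n (k - 1) →L[ℝ] ℝ)) ∞
    (JetCotangent n π (k - 1)) := hm
  exact injective_fderiv_of_isImmersionAt
    (H' := JetModel n (k - 1) × (JetModel n (k - 1) →L[ℝ] ℝ)) (φ := e.jetChart (2 * k - 1))
    (IsManifold.subset_maximalAtlas (e.jetChart_mem_atlas _)) hψ hy
    (chartAt_extendedLegendre e _ he hL hk hy).1
    ((hF.legendreExt (e.isOpen_jetDomain _) k).differentiableAt_of_isOpen (e.isOpen_jetDomain _) hz)
    (by filter_upwards [e.mem_nhds_source hy] with w hw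
        exact chartAt_extendedLegendre e _ he hL hk hw) h

/-- The Lagrangian is regular at every jet. -/
def IsRegularLagrangian (L : Jet n π k → ℝ) : Prop :=
  ∀ y : Jet n π (2 * k - 1), IsRegularAt k ((adaptedChartAt n π y.lower.pt).lagrangian L)
    ((adaptedChartAt n π y.lower.pt).coords (2 * k - 1) y)

lemma pt_mem_adaptedChartAt_lower (y : Jet n π (2 * k - 1)) :
    y.pt ∈ (adaptedChartAt n π y.lower.pt).chart.source := by
  have h := mem_adaptedChartAt_source (n := n) (π := π) y.lower.pt
  rwa [Jet.pt_lower] at h ⊢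

lemma isCosymplectic_poincareCartanTwo_iff
    (hL : ContMDiff 𝓘(ℝ, JetModel n k) 𝓘(ℝ, ℝ) ∞ L) (hk : 1 ≤ k) :
    IsCosymplectic (k * n) (poincareCartanTwo L) (timeForm n π k) ↔ IsRegularLagrangian L :=
  ⟨fun h y => (exists_powWedge_ne_zero_iff _ hL hk (pt_mem_adaptedChartAt_lower y)).1 (h.volume y),
    fun h => ⟨finrank_jetModel hk, isSmooth_poincareCartanTwo hL hk, isSmooth_timeForm,
      d_poincareCartanTwo hL hk, d_timeForm, fun y =>
      (exists_powWedge_ne_zero_iff _ hL hk (pt_mem_adaptedChartAt_lower y)).2 (h y)⟩⟩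

lemma isLocalDiffeomorph_restrictedLegendre_iff
    (hL : ContMDiff 𝓘(ℝ, JetModel n k) 𝓘(ℝ, ℝ) ∞ L) (hk : 1 ≤ k) :
    IsLocalDiffeomorph 𝓘(ℝ, JetModel n (2 * k - 1)) 𝓘(ℝ, RestrictedModel n (k - 1)) ∞
      (restrictedLegendre L) ↔ IsRegularLagrangian L :=
  forall_congr' fun y =>
    isLocalDiffeomorphAt_restrictedLegendre_iff _ hL hk (pt_mem_adaptedChartAt_lower y)

lemma isImmersion_extendedLegendre_iff
    (hL : ContMDiff 𝓘(ℝ, JetModel n k) 𝓘(ℝ, ℝ) ∞ L) (hk : 1 ≤ k) :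
    Manifold.IsImmersion 𝓘(ℝ, JetModel n (2 * k - 1))
      (𝓘(ℝ, JetModel n (k - 1)).prod 𝓘(ℝ, JetModel n (k - 1) →L[ℝ] ℝ)) ∞
      (extendedLegendre L) ↔ IsRegularLagrangian L :=
  ⟨fun ⟨_, _, _, h⟩ y => isRegularAt_of_isImmersionAt _ rfl hL hk (h y),
    fun h => ⟨ℝ, inferInstance, inferInstance, fun y =>
      isImmersionAt_extendedLegendre _ rfl hL hk (h y)⟩⟩

/-- The dimension `2kn + 1` is odd, so the largest possible rank is `2kn`. -/
lemma hasMaximalRank_iff_rank_eq (hk : 1 ≤ k) :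
    DiffForm.HasMaximalRank (poincareCartanTwo L) ↔
      ∀ y, DiffForm.rank (poincareCartanTwo L) y = 2 * (k * n) := by
  refine forall_congr' fun y => ?_
  rw [finrank_tangentSpace hk, show (2 * (k * n) + 1) / 2 = k * n by omega]

lemma IsRegularLagrangian.hasMaximalRank (h : IsRegularLagrangian L)
    (hL : ContMDiff 𝓘(ℝ, JetModel n k) 𝓘(ℝ, ℝ) ∞ L) (hk : 1 ≤ k) :
    DiffForm.HasMaximalRank (poincareCartanTwo L) :=
  (hasMaximalRank_iff_rank_eq hk).2 fun y =>
    rank_poincareCartanTwo_of_isRegularAt _ hL hk (pt_mem_adaptedChartAt_lower y) (h y)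

lemma hasMaximalRank_poincareCartanTwo_iff
    (hL : ContMDiff 𝓘(ℝ, JetModel n k) 𝓘(ℝ, ℝ) ∞ L) (hk : 2 ≤ k) :
    DiffForm.HasMaximalRank (poincareCartanTwo L) ↔ IsRegularLagrangian L :=
  ⟨fun h y => isRegularAt_of_rank_poincareCartanTwo _ hL hk (pt_mem_adaptedChartAt_lower y)
    ((hasMaximalRank_iff_rank_eq (by omega)).1 h y), fun h => h.hasMaximalRank hL (by omega)⟩

end LegendreCharts

theorem mainTheorem9 {n k : ℕ} (hk : 1 ≤ k) {E : Type*} [TopologicalSpace E] [T2Space E]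
    [SecondCountableTopology E] [ChartedSpace (EuclideanSpace ℝ (Fin (n + 1))) E]
    [IsManifold (𝓡 (n + 1)) ∞ E] (π : E → ℝ) [IsBundleOverLine n π] (L : Jet n π k → ℝ)
    (hL : ContMDiff 𝓘(ℝ, JetModel n k) 𝓘(ℝ, ℝ) ∞ L) :
    (2 ≤ k → List.TFAE
      [DiffForm.HasMaximalRank (poincareCartanTwo L),
        IsCosymplectic (k * n) (poincareCartanTwo L) (timeForm n π k),
        IsLocalDiffeomorph 𝓘(ℝ, JetModel n (2 * k - 1)) 𝓘(ℝ, RestrictedModel n (k - 1)) ∞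
          (restrictedLegendre L),
        Manifold.IsImmersion 𝓘(ℝ, JetModel n (2 * k - 1))
          (𝓘(ℝ, JetModel n (k - 1)).prod 𝓘(ℝ, JetModel n (k - 1) →L[ℝ] ℝ)) ∞
          (extendedLegendre L)]) ∧
    List.TFAE
      [IsCosymplectic (k * n) (poincareCartanTwo L) (timeForm n π k),
        IsLocalDiffeomorph 𝓘(ℝ, JetModel n (2 * k - 1)) 𝓘(ℝ, RestrictedModel n (k - 1)) ∞
          (restrictedLegendre L),
        Manifold.IsImmersion 𝓘(ℝ, JetModel n (2 * k - 1))
          (𝓘(ℝ, JetModel n (k - 1)).prod 𝓘(ℝ, JetModel n (k - 1) →L[ℝ] ℝ)) ∞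
          (extendedLegendre L)] ∧
    (IsCosymplectic (k * n) (poincareCartanTwo L) (timeForm n π k) →
      DiffForm.HasMaximalRank (poincareCartanTwo L)) := by
  have h2 := isCosymplectic_poincareCartanTwo_iff hL hk
  have h3 := isLocalDiffeomorph_restrictedLegendre_iff hL hk
  have h4 := isImmersion_extendedLegendre_iff hL hk
  refine ⟨fun hk2 => ?_, ?_, fun h => (h2.1 h).hasMaximalRank hL hk⟩
  · have h1 := hasMaximalRank_poincareCartanTwo_iff hL hk2
    tfae_have 1 ↔ 2 := h1.trans h2.symm
    tfae_have 2 ↔ 3 := h2.trans h3.symm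
    tfae_have 3 ↔ 4 := h3.trans h4.symm
    tfae_finish
  · tfae_have 1 ↔ 2 := h2.trans h3.symm
    tfae_have 2 ↔ 3 := h3.trans h4.symm
    tfae_finish

end
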